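/- Let $k$ be an algebraically closed field of characteristic $0$. A ribbon of genus $g$ over $k$ is a $k$-scheme $C$ obtained by gluing $U_1=\operatorname{Spec} k[x,\varepsilon]/(\varepsilon^2)$ and $U_2=\operatorname{Spec} k[y,\eta]/(\eta^2)$ along the open subschemes $x\neq 0$ and $y\neq 0$ by an isomorphism $$x\mapsto y^{-1}-y^{-2}f(y)\eta,\qquad \varepsilon\mapsto y^{-g-1}\eta,\qquad f(y)=f_1y^{-1}+\dots+f_{g-2}y^{-(g-2)},\quad f_i\in k.$$ Its dualizing sheaf $\omega_C$ is generated by $\frac{dx\wedge d\varepsilon}{\varepsilon^2}$ on $U_1$ and by $\frac{dy\wedge d\eta}{\eta^2}$ on $U_2$. The ribbon is canonically embedded if the sections of $\omega_C$ define a closed embedding $C\subset\mathbb{P}^{g-1}$. For $m\ge 2$, its $m$-th Hilbert point is the class, up to scalars, of the $N$-th exterior power $\bigwedge^N\operatorname{Sym}^m H^0(C,\omega_C)\to\bigwedge^N H^0(C,\omega_C^m)\cong k$ of the restriction map $\operatorname{Sym}^m H^0(C,\omega_C)\to H^0(C,\omega_C^m)$, where $N=h^0(C,\omega_C^m)$;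 it is defined when the restriction map is surjective. The Hilbert point is unstable if every homogeneous $\operatorname{SL}_g$-invariant polynomial function of positive degree on the space of $N$-forms on $\operatorname{Sym}^m H^0(C,\omega_C)$ vanishes at it. **Corollary.** If $g$ is even, then every canonically embedded ribbon of genus $g$ which admits a nontrivial $\mathbb{G}_m$-action is Hilbert unstable: for every $m\ge 2$, its $m$-th Hilbert point is defined and unstable. -/

import Mathlib

open CategoryTheory AlgebraicGeometry Polynomial LaurentPolynomial
open scoped DualNumber

universe u

namespace Ribbon

noncomputable section

/-! ### The gluing data of a ribbon -/

/-- The coordinate ring `k[x, ε]/(ε²)` of each of the two affine charts of a ribbon. -/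
abbrev ChartRing (k : Type u) [Field k] : Type u := DualNumber k[X]

/-- The coordinate ring `k[y, y⁻¹, η]/(η²)` of the overlap of the two charts. -/
abbrev OverlapRing (k : Type u) [Field k] : Type u := DualNumber k[T;T⁻¹]

/-- The `k`-algebra map `k[x, ε]/(ε²) → k[y, y⁻¹, η]/(η²)` with `x ↦ a` and `ε ↦ e • η`. -/
def chartMap (k : Type u) [Field k] (a : OverlapRing k) (e : k[T;T⁻¹]) :
    ChartRing k →ₐ[k] OverlapRing k :=
  DualNumber.lift ⟨(Polynomial.aeval a, TrivSqZeroExt.inr e),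
    TrivSqZeroExt.inr_mul_inr _ _ _, fun _ => Commute.all _ _⟩

/-- The Laurent polynomial `f(y) = f₁ y⁻¹ + ⋯ + f_{g-2} y^{-(g-2)}`. -/
def tail {k : Type u} [Field k] (g : ℕ) (f : Fin (g - 2) → k) : k[T;T⁻¹] :=
  ∑ i, LaurentPolynomial.C (f i) * LaurentPolynomial.T (-((i : ℤ) + 1))

/-- The image `y⁻¹ - y⁻² f(y) η` of `x` under the gluing isomorphism. -/
def imageX {k : Type u} [Field k] (g : ℕ) (f : Fin (g - 2) → k) : OverlapRing k :=
  TrivSqZeroExt.inl (LaurentPolynomial.T (-1)) -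
    TrivSqZeroExt.inr (LaurentPolynomial.T (-2) * tail g f)

/-- The image `y^{-g-1} η` of `ε` under the gluing isomorphism. -/
def imageEps (k : Type u) [Field k] (g : ℕ) : OverlapRing k :=
  TrivSqZeroExt.inr (LaurentPolynomial.T (-(g : ℤ) - 1))

/-- Restriction of functions from the first chart `U₁ = Spec k[x, ε]/(ε²)` to the overlap,
written in the coordinates `y`, `η`: the gluing map
`x ↦ y⁻¹ - y⁻² f(y) η`, `ε ↦ y^{-g-1} η`. -/
def resOne {k : Type u} [Field k] (g : ℕ) (f : Fin (g - 2) → k) :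
    ChartRing k →ₐ[k] OverlapRing k :=
  chartMap k (imageX g f) (LaurentPolynomial.T (-(g : ℤ) - 1))

/-- Restriction of functions from the second chart `U₂ = Spec k[y, η]/(η²)` to the overlap:
the localization map `y ↦ y`, `η ↦ η`. -/
def resTwo (k : Type u) [Field k] : ChartRing k →ₐ[k] OverlapRing k :=
  chartMap k (TrivSqZeroExt.inl (LaurentPolynomial.T 1)) 1

/-- `p : C ⟶ Spec k` is the ribbon of genus `g` obtained by gluing `U₁ = Spec k[x, ε]/(ε²)` and
`U₂ = Spec k[y, η]/(η²)` along their open subschemes `x ≠ 0` and `y ≠ 0` by the isomorphism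
`x ↦ y⁻¹ - y⁻² f(y) η`, `ε ↦ y^{-g-1} η`: the two charts are open subschemes which cover `C`, and
their intersection is `Spec k[y, y⁻¹, η]/(η²)`, included in `U₁` and `U₂` by the two
restriction maps. -/
structure Presentation {k : Type u} [Field k] (g : ℕ) {C : Scheme.{u}}
    (p : C ⟶ Spec (CommRingCat.of k)) where
  /-- the coefficients `f₁, …, f_{g-2}` of the gluing function -/
  f : Fin (g - 2) → k
  /-- the first chart -/
  chartOne : Spec (CommRingCat.of (ChartRing k)) ⟶ C
  /-- the second chart -/
  chartTwo : Spec (CommRingCat.of (ChartRing k)) ⟶ C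
  isOpenImmersion_one : IsOpenImmersion chartOne
  isOpenImmersion_two : IsOpenImmersion chartTwo
  cover : ∀ c : C, c ∈ Set.range chartOne ∨ c ∈ Set.range chartTwo
  isPullback : IsPullback
    (Spec.map (CommRingCat.ofHom (resOne g f).toRingHom))
    (Spec.map (CommRingCat.ofHom (resTwo k).toRingHom)) chartOne chartTwo
  over_one : chartOne ≫ p = Spec.map (CommRingCat.ofHom (algebraMap k (ChartRing k)))
  over_two : chartTwo ≫ p = Spec.map (CommRingCat.ofHom (algebraMap k (ChartRing k)))

/-! ### Actions of the multiplicative group -/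

/-- An action of the algebraic group `𝔾ₘ` over `k` on a `k`-scheme `p : C ⟶ Spec k`, in terms of
points: for every `k`-scheme `T`, the group `𝔾ₘ(T) = Γ(T, 𝒪_T)ˣ` acts on the set `C(T)` of
`k`-morphisms `T ⟶ C`, naturally in `T`. (A morphism `c : T ⟶ C` is a point over `k` for the
structure morphism `c ≫ p` of `T`.) By the Yoneda lemma these data are the same as
a morphism `𝔾ₘ ×ₖ C ⟶ C` over `k` which satisfies the axioms of an action. -/
structure GmAction {k : Type u} [Field k] {C : Scheme.{u}}
    (p : C ⟶ Spec (CommRingCat.of k)) where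
  act : ∀ {T : Scheme.{u}}, (Γ(T, ⊤))ˣ → (T ⟶ C) → (T ⟶ C)
  act_over : ∀ {T : Scheme.{u}} (t : (Γ(T, ⊤))ˣ) (c : T ⟶ C), act t c ≫ p = c ≫ p
  one_act : ∀ {T : Scheme.{u}} (c : T ⟶ C), act 1 c = c
  mul_act : ∀ {T : Scheme.{u}} (s t : (Γ(T, ⊤))ˣ) (c : T ⟶ C),
    act (s * t) c = act s (act t c)
  natural : ∀ {S T : Scheme.{u}} (r : S ⟶ T) (t : (Γ(T, ⊤))ˣ) (c : T ⟶ C),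
    r ≫ act t c = act (Units.map (r.appTop.hom : Γ(T, ⊤) →* Γ(S, ⊤)) t) (r ≫ c)

/-- The action is nontrivial: some point of `𝔾ₘ` moves some point of `C`. -/
def GmAction.IsNontrivial {k : Type u} [Field k] {C : Scheme.{u}}
    {p : C ⟶ Spec (CommRingCat.of k)} (α : GmAction p) : Prop :=
  ∃ (T : Scheme.{u}) (t : (Γ(T, ⊤))ˣ) (c : T ⟶ C), α.act t c ≠ c

/-! ### The canonical bundle and its powers -/

/-- The derivative of a Laurent polynomial. -/
def laurentDeriv {k : Type u} [Field k] (p : k[T;T⁻¹]) : k[T;T⁻¹] :=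
  ∑ n ∈ p.coeff.support,
    LaurentPolynomial.C ((n : k) * p.coeff n) * LaurentPolynomial.T (n - 1)

/-- The partial derivative `∂/∂y` of `a + b η`, namely `a' + b' η`. -/
def partialY {k : Type u} [Field k] (s : OverlapRing k) : OverlapRing k :=
  TrivSqZeroExt.inl (laurentDeriv s.fst) + TrivSqZeroExt.inr (laurentDeriv s.snd)

/-- The partial derivative `∂/∂η` of `a + b η`, namely `b`. -/
def partialEta {k : Type u} [Field k] (s : OverlapRing k) : OverlapRing k :=
  TrivSqZeroExt.inl s.snd

/-- By adjunction, `ω_C` is free on `U₁` and on `U₂`, with generators `dx ∧ dε / ε²` and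
`dy ∧ dη / η²`. This is the transition function `J` on the overlap, defined by
`dx ∧ dε / ε² = J · dy ∧ dη / η²`: the Jacobian determinant of `(x, ε)` with
respect to `(y, η)`, times `η² / ε² = y^{2g+2}`. -/
def jacobian {k : Type u} [Field k] (g : ℕ) (f : Fin (g - 2) → k) : OverlapRing k :=
  (partialY (imageX g f) * partialEta (imageEps k g) -
      partialEta (imageX g f) * partialY (imageEps k g)) *
    TrivSqZeroExt.inl (LaurentPolynomial.T (2 * (g : ℤ) + 2))

/-- The space `H⁰(C, ω_C^m)` of global sections: the pairs `(s₁, s₂)` for which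
`s₁ (dx ∧ dε / ε²)^m` on `U₁` and `s₂ (dy ∧ dη / η²)^m` on `U₂` agree on the overlap. -/
def canonicalSections {k : Type u} [Field k] (g : ℕ) (f : Fin (g - 2) → k) (m : ℕ) :
    Submodule k (ChartRing k × ChartRing k) where
  carrier := {s | resOne g f s.1 * jacobian g f ^ m = resTwo k s.2}
  add_mem' {a b} ha hb := by
    simp only [Set.mem_ofPred_eq, Prod.fst_add, Prod.snd_add, map_add, add_mul] at *
    rw [ha, hb]
  zero_mem' := by simp
  smul_mem' c a ha := by
    simp only [Set.mem_ofPred_eq, Prod.smul_fst, Prod.smul_snd, map_smul, smul_mul_assoc] at *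
    rw [ha]

/-- The canonical linear system is very ample, that is, the sections of `ω_C` define a closed
embedding of `C` in `ℙ(H⁰(C, ω_C))`: each of the two charts is the nonvanishing locus of a section
`s` of `ω_C`, and the coordinate ring of this chart is generated by the quotients `v / s` of
sections of `ω_C`. -/
def IsCanonicallyEmbedded {k : Type u} [Field k] (g : ℕ) (f : Fin (g - 2) → k) : Prop :=
  (∃ s ∈ canonicalSections g f 1, IsUnit s.1 ∧ ¬ IsUnit s.2 ∧
    Algebra.adjoin k {a : ChartRing k | ∃ v ∈ canonicalSections g f 1, a * s.1 = v.1} = ⊤) ∧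
  (∃ s ∈ canonicalSections g f 1, IsUnit s.2 ∧ ¬ IsUnit s.1 ∧
    Algebra.adjoin k {a : ChartRing k | ∃ v ∈ canonicalSections g f 1, a * s.2 = v.2} = ⊤)

/-! ### Hilbert points and their instability -/

/-- The space `Sym^m` of homogeneous forms of degree `m` on `ℙ^{n-1}`. -/
abbrev Forms (k : Type u) [Field k] (n m : ℕ) : Type u :=
  MvPolynomial.homogeneousSubmodule (Fin n) k m

/-- The linear substitution `X_j ↦ ∑_i A_{ij} X_i` on forms of degree `m`. -/
def subst {k : Type u} [Field k] {n : ℕ} (m : ℕ) (A : Matrix.SpecialLinearGroup (Fin n) k) :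
    Forms k n m →ₗ[k] Forms k n m :=
  (MvPolynomial.aeval (R := k) fun j =>
      ∑ i, MvPolynomial.C (A.1 i j) * (MvPolynomial.X i : MvPolynomial (Fin n) k)).toLinearMap.restrict
    fun F hF => by
      rw [MvPolynomial.mem_homogeneousSubmodule] at hF ⊢
      have h := hF.aeval (fun j => ∑ i, MvPolynomial.C (A.1 i j) *
        (MvPolynomial.X i : MvPolynomial (Fin n) k)) (n := 1) (fun j =>
          MvPolynomial.IsHomogeneous.sum _ _ _ fun i _ => by
            simpa using (MvPolynomial.isHomogeneous_C (Fin n) (A.1 i j)).mul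
              (MvPolynomial.isHomogeneous_X k i))
      rwa [one_mul] at h

/-- Evaluating a form of degree `m` at sections of `ω_C` gives a section of `ω_C^m`. -/
theorem aeval_mem {k : Type u} [Field k] (g : ℕ) (f : Fin (g - 2) → k) {n : ℕ} (m : ℕ)
    (s : Fin n → canonicalSections g f 1) (F : MvPolynomial (Fin n) k) (hF : F.IsHomogeneous m) :
    MvPolynomial.aeval (fun i => (s i : ChartRing k × ChartRing k)) F
      ∈ canonicalSections g f m := by
  rw [MvPolynomial.aeval_def, MvPolynomial.eval₂_eq]
  refine Submodule.sum_mem _ fun d hd => ?_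
  have hdeg : ∑ i, d i = m := by
    have := hF (MvPolynomial.mem_support_iff.mp hd)
    simpa [Finsupp.weight_apply, Finsupp.sum_fintype] using this
  rw [← Algebra.smul_def]
  refine Submodule.smul_mem _ _ ?_
  have hs : ∀ i, resOne g f (s i : ChartRing k × ChartRing k).1 * jacobian g f =
      resTwo k (s i : ChartRing k × ChartRing k).2 := fun i => by
    have h : resOne g f (s i : ChartRing k × ChartRing k).1 * jacobian g f ^ 1 =
      resTwo k (s i : ChartRing k × ChartRing k).2 := (s i).2
    rwa [pow_one] at h
  have hd' : ∏ i ∈ d.support, (s i : ChartRing k × ChartRing k) ^ d i =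
      ∏ i, (s i : ChartRing k × ChartRing k) ^ d i :=
    Finset.prod_subset (Finset.subset_univ _) fun i _ hi => by
      rw [Finsupp.notMem_support_iff.mp hi, pow_zero]
  rw [hd']
  change resOne g f (∏ i, (s i : ChartRing k × ChartRing k) ^ d i).1 * jacobian g f ^ m =
    resTwo k (∏ i, (s i : ChartRing k × ChartRing k) ^ d i).2
  simp only [Prod.fst_prod, Prod.snd_prod, Prod.pow_fst, Prod.pow_snd, map_prod, map_pow, ← hs,
    mul_pow, Finset.prod_mul_distrib, Finset.prod_pow_eq_pow_sum, hdeg]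

/-- The restriction map `Sym^m H⁰(C, ω_C) → H⁰(C, ω_C^m)` of the canonical curve, in the homogeneous
coordinates of `ℙ(H⁰(C, ω_C))` given by the sections `s₁, …, s_n` of `ω_C`. -/
def restriction {k : Type u} [Field k] (g : ℕ) (f : Fin (g - 2) → k) {n : ℕ} (m : ℕ)
    (s : Fin n → canonicalSections g f 1) : Forms k n m →ₗ[k] canonicalSections g f m :=
  ((MvPolynomial.aeval fun i =>
      (s i : ChartRing k × ChartRing k)).toLinearMap).restrict
    fun F hF => aeval_mem g f m s F ((MvPolynomial.mem_homogeneousSubmodule _ _).mp hF)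

/-- For a family `act` of maps of the vector space `V` (the operators of a representation of a
group), the point of `ℙ(V)` given by `x` is unstable: every homogeneous
invariant polynomial function of positive degree on `V` vanishes at `x`. Polynomial functions on `V`
are written as polynomials in linear functionals. -/
def IsUnstablePoint {k : Type u} [Field k] {V : Type u} [AddCommGroup V] [Module k V] {G : Type u}
    (act : G → V → V) (x : V) : Prop :=
  ∀ d : ℕ, 0 < d → ∀ P : MvPolynomial (Module.Dual k V) k, P.IsHomogeneous d →
    (∀ (A : G) (v : V), MvPolynomial.eval (fun φ => φ (act A v)) P =
      MvPolynomial.eval (fun φ => φ v) P) →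
    MvPolynomial.eval (fun φ => φ x) P = 0

/-- The `m`-th Hilbert point of the canonically embedded ribbon is defined and is unstable.

The Hilbert point is defined if `Sym^m H⁰(C, ω_C) → H⁰(C, ω_C^m)` is surjective, with a target of
some finite dimension `N`. It is then the `N`-th exterior power
`Λ^N Sym^m H⁰(C, ω_C) → Λ^N H⁰(C, ω_C^m) ≅ k`, up to scalars, as a point of the projective space
of alternating `N`-forms on `Sym^m H⁰(C, ω_C)`, on which `SL_g` acts by linear substitutions. (The
invariants of the right action `v ↦ v ∘ Λ^N A` are those of the left action `v ↦ v ∘ Λ^N A⁻¹`.) -/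
def IsHilbertUnstableAt {k : Type u} [Field k] (g : ℕ) (f : Fin (g - 2) → k)
    (b : Module.Basis (Fin g) k (canonicalSections g f 1)) (m : ℕ) : Prop :=
  Function.Surjective (restriction g f m b) ∧
  ∃ (N : ℕ) (e : Module.Basis (Fin N) k (canonicalSections g f m)),
    IsUnstablePoint (k := k) (V := Forms k g m [⋀^Fin N]→ₗ[k] k)
      (fun (A : Matrix.SpecialLinearGroup (Fin g) k) v => v.compLinearMap (subst m A))
      (e.det.compLinearMap (restriction g f m b))

/-- A canonically embedded ribbon is Hilbert unstable: its `m`-th Hilbert point is unstable for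
all `m ≥ 2`. -/
def IsHilbertUnstable {k : Type u} [Field k] (g : ℕ) (f : Fin (g - 2) → k)
    (b : Module.Basis (Fin g) k (canonicalSections g f 1)) : Prop :=
  ∀ m : ℕ, 2 ≤ m → IsHilbertUnstableAt g f b m

end

end Ribbon

/-! Instability is forced by one torus element. Suppose compatible endomorphisms of `H⁰(ω)` and
`H⁰(ω^m)` have determinants `1` and `δ`. The matrix of the first lies in `SL_g` and multiplies the
Hilbert point by `δ`, so an invariant `P` of degree `d` satisfies `P(x) = δ^d P(x)`. If `δ` is not a
root of unity, then `P(x) = 0` (`IsDestabilized.isHilbertUnstableAt`). It remains to find such a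
pair of endomorphisms.

Differentiating the action at `1 ∈ 𝔾ₘ` gives a vector field on the ribbon. It is nonzero because, in
characteristic `0` and on a separated scheme, an action with zero generator is trivial
(`exists_vectorField`). On the reduced curve `ℙ¹` it induces `α ∂_y` with `deg α ≤ 2`. That this
field lifts to the ribbon means that the gluing function `f`, taken modulo changes of coordinates in
the charts, is an eigenvector of `α ∂_y` (`exists_isInvariant`). A canonically embedded ribbon is
not split, so `f ≠ 0`, and then also `α ≠ 0`. Translating `y` and exchanging the charts turns `α
∂_y` into a multiple of `y ∂_y` or `∂_y`, and the eigenvectors of these are monomials. The ribbon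
may therefore be taken with `f = c y^{-l}`, `1 ≤ l ≤ g - 2` (`isGood_of_isInvariant`).

For `f = c y^{-l}` everything is explicit. `H⁰(ω)` is spanned by lifts of `y^a`, `0 ≤ a ≤ g - 1`.
`H⁰(ω^m)` is spanned by lifts of `y^a`, `0 ≤ a ≤ m(g - 1)`, together with `K = m(g - 1) - g`
elements `y^i η`. Products of sections of `ω` span it (`sectionsOf_monomial_pow`). The torus `y ↦ t²
y`, `η ↦ t^{2l+2} η`, twisted by `t^{-m(g-1)}`, acts on the lifts of the `y^a` with weights that
cancel in pairs, so its determinant on `H⁰(ω)` is `1`. The weights on the `y^i η` add up to `K (2l +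
1 - g)`. For even `g` the second factor is odd, hence nonzero, and `t = 2` has infinite order
(`isGood_monomial`). -/

namespace Ribbon
noncomputable section

/-! ### Infinitesimal and formal actions -/

/-- A unit of a ring, as a unit of the global functions on its spectrum. -/
def specUnit {B : Type u} [CommRing B] (u : Bˣ) : (Γ(Spec (CommRingCat.of B), ⊤))ˣ :=
  Units.map ((Scheme.ΓSpecIso (CommRingCat.of B)).inv.hom : B →* _) u

/-- The map of spectra given by a ring homomorphism. -/
abbrev sp {A B : Type u} [CommRing A] [CommRing B] (φ : A →+* B) :
    Spec (CommRingCat.of B) ⟶ Spec (CommRingCat.of A) :=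
  Spec.map (CommRingCat.ofHom φ)

theorem sp_comp {A B B' : Type u} [CommRing A] [CommRing B] [CommRing B'] (φ : A →+* B)
    (ψ : B →+* B') : sp (ψ.comp φ) = sp ψ ≫ sp φ := by
  simp [sp, CommRingCat.ofHom_comp, Spec.map_comp]

theorem sp_injective {A B : Type u} [CommRing A] [CommRing B] {φ ψ : A →+* B}
    (h : sp φ = sp ψ) : φ = ψ := by
  have := Spec.map_injective h
  exact congrArg CommRingCat.Hom.hom this

theorem specUnit_map {B B' : Type u} [CommRing B] [CommRing B'] (ψ : B →+* B') (u : Bˣ) :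
    Units.map ((sp ψ).appTop.hom : _ →* _) (specUnit u) = specUnit (Units.map (ψ : B →* B') u) := by
  ext
  have := Scheme.ΓSpecIso_inv_naturality (CommRingCat.ofHom ψ)
  have h2 := congrArg (fun f => f.hom (u : B)) this
  exact h2.symm

section Action

variable {k : Type u} [Field k] {C : Scheme.{u}} {p : C ⟶ Spec (CommRingCat.of k)}
  (α : GmAction p)

theorem GmAction.natural_sp {B B' : Type u} [CommRing B] [CommRing B'] (ψ : B →+* B') (u : Bˣ)
    (c : Spec (CommRingCat.of B) ⟶ C) :
    sp ψ ≫ α.act (specUnit u) c = α.act (specUnit (Units.map (ψ : B →* B') u)) (sp ψ ≫ c) := by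
  rw [α.natural, specUnit_map]

theorem specUnit_one {B : Type u} [CommRing B] : specUnit (1 : Bˣ) = 1 := by
  simp [specUnit]

theorem specUnit_mul {B : Type u} [CommRing B] (u v : Bˣ) :
    specUnit (u * v) = specUnit u * specUnit v := by
  simp [specUnit]

/-- The locus sent outside the open subscheme is closed in `Spec B`. If it were nonempty it would
contain a maximal ideal, which contains the Jacobson radical, hence `ker ρ`, and so comes from `Spec
B₀`. -/
theorem range_subset_of_thickening {A B B₀ : Type u} [CommRing A] [CommRing B] [CommRing B₀]
    (c : Spec (CommRingCat.of A) ⟶ C) [IsOpenImmersion c]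
    (ρ : B →+* B₀) (hρ : Function.Surjective ρ) (hJ : RingHom.ker ρ ≤ Ideal.jacobson ⊥)
    (x : Spec (CommRingCat.of B) ⟶ C) (hx : Set.range (sp ρ ≫ x) ⊆ Set.range c) :
    Set.range x ⊆ Set.range c := by
  let Z : Set (PrimeSpectrum B) := (x ⁻¹' (Set.range c))ᶜ
  have hcl : IsClosed Z := by
    rw [isClosed_compl_iff]
    exact c.isOpenEmbedding.isOpen_range.preimage x.continuous
  obtain ⟨I, hI⟩ := (PrimeSpectrum.isClosed_iff_zeroLocus_ideal _).mp hcl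
  suffices hIt : I = ⊤ by
    rintro _ ⟨y, rfl⟩
    by_contra hy
    have : (y : PrimeSpectrum B) ∈ Z := hy
    rw [hI, hIt, Submodule.top_coe, PrimeSpectrum.zeroLocus_univ] at this
    exact this
  by_contra hIne
  obtain ⟨m, hm, hIm⟩ := Ideal.exists_le_maximal I hIne
  let q : PrimeSpectrum B := ⟨m, hm.isPrime⟩
  have h1 : q ∈ Z := by
    rw [hI]; exact hIm
  have h2 : q ∈ Set.range (PrimeSpectrum.comap ρ) := by
    rw [range_comap_of_surjective _ _ hρ]
    have : Ideal.jacobson (⊥ : Ideal B) ≤ m := sInf_le ⟨bot_le, hm⟩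
    exact hJ.trans this
  obtain ⟨z, hz⟩ := h2
  have h3 : x (PrimeSpectrum.comap ρ z) ∈ Set.range c := by
    have h4 := hx ⟨(z : Spec (CommRingCat.of B₀)), rfl⟩
    have h5 := Scheme.Hom.comp_apply (sp ρ) x (z : Spec (CommRingCat.of B₀))
    exact h5 ▸ h4
  rw [hz] at h3
  exact h1 h3

/-- A unit which reduces to `1` on the closed subscheme defined by an ideal in the Jacobson radical
moves a point of an affine open subscheme to a point of the same affine open subscheme. -/
theorem GmAction.exists_lift {A B B₀ : Type u} [CommRing A] [CommRing B] [CommRing B₀]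
    (c : Spec (CommRingCat.of A) ⟶ C) [IsOpenImmersion c]
    (ρ : B →+* B₀) (hρ : Function.Surjective ρ) (hJ : RingHom.ker ρ ≤ Ideal.jacobson ⊥)
    (u : Bˣ) (hu : ρ u = 1) (φ : A →+* B) :
    ∃ Φ : A →+* B, sp Φ ≫ c = α.act (specUnit u) (sp φ ≫ c) ∧ ρ.comp Φ = ρ.comp φ := by
  have hu' : Units.map (ρ : B →* B₀) u = 1 := by ext; exact hu
  -- Since `u` reduces to `1`, the moved point and the original one agree on the closed subscheme
  -- `Spec B₀`.
  have key : sp ρ ≫ α.act (specUnit u) (sp φ ≫ c) = sp (ρ.comp φ) ≫ c := by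
    rw [α.natural_sp, hu', specUnit_one, α.one_act, sp_comp, Category.assoc]
  have hr : Set.range (α.act (specUnit u) (sp φ ≫ c)) ⊆ Set.range c := by
    apply range_subset_of_thickening c ρ hρ hJ
    rw [key]
    rintro _ ⟨z, rfl⟩
    rw [Scheme.Hom.comp_apply]
    exact ⟨_, rfl⟩
  let l := IsOpenImmersion.lift c _ hr
  have hl : l ≫ c = _ := IsOpenImmersion.lift_fac c _ hr
  refine ⟨(Spec.preimage l).hom, ?_, ?_⟩
  · rw [← hl]; simp [sp]
  · apply sp_injective
    rw [← cancel_mono c, ← key, sp_comp, Category.assoc, ← hl]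
    simp [sp]

/-- The homomorphism of dual numbers given by a ring homomorphism. -/
def dualMap {A B : Type u} [CommRing A] [CommRing B] (h : A →+* B) : A[ε] →+* B[ε] where
  toFun x := TrivSqZeroExt.inl (h x.fst) + TrivSqZeroExt.inr (h x.snd)
  map_one' := by ext <;> simp
  map_mul' x y := by ext <;> simp
  map_zero' := by ext <;> simp
  map_add' x y := by ext <;> simp

/-- The unit `1 + a ε` of the dual numbers. -/
def dualUnit (A : Type u) [CommRing A] : (A[ε])ˣ where
  val := 1 + DualNumber.eps
  inv := 1 - DualNumber.eps
  val_inv := by ext <;> simp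
  inv_val := by ext <;> simp

/-- The homomorphism `a ↦ a + D(a) ε` is an infinitesimal generator of the action in the affine
open subscheme `c`. -/
def IsGenerator {A : Type u} [CommRing A] [Algebra k A] (c : Spec (CommRingCat.of A) ⟶ C)
    (D : Derivation k A A) : Prop :=
  ∃ Φ : A →+* A[ε], (∀ a, Φ a = TrivSqZeroExt.inl a + TrivSqZeroExt.inr (D a)) ∧
    sp Φ ≫ c = α.act (specUnit (dualUnit A)) (sp (TrivSqZeroExt.inlHom A A) ≫ c)

theorem ker_fst_le_jacobson (A : Type u) [CommRing A] :
    RingHom.ker (TrivSqZeroExt.fstHom A A A).toRingHom ≤ Ideal.jacobson ⊥ := by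
  intro x hx
  have : x.fst = 0 := hx
  have hn : IsNilpotent x := ⟨2, by ext <;> simp [pow_two, this]⟩
  rw [Ideal.mem_jacobson_bot]
  intro y
  exact ((Commute.all x y).isNilpotent_mul_right hn).isUnit_add_one

/-- Let `1 + ε` act on the constant `A[ε]`-point of the chart. The result stays in the chart and
reduces to the identity modulo `ε`, so its `ε`-coefficient is a derivation; it kills `k` because the
action is over `k`. -/
theorem GmAction.exists_generator {A : Type u} [CommRing A] [Algebra k A]
    (c : Spec (CommRingCat.of A) ⟶ C) [IsOpenImmersion c] (hc : c ≫ p = sp (algebraMap k A)) :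
    ∃ D : Derivation k A A, IsGenerator α c D := by
  obtain ⟨Φ, h1, h2⟩ := α.exists_lift c (TrivSqZeroExt.fstHom A A A).toRingHom
    (fun a => ⟨TrivSqZeroExt.inl a, rfl⟩) (ker_fst_le_jacobson A) (dualUnit A)
    (by simp [dualUnit]) (TrivSqZeroExt.inlHom A A)
  have hfst : ∀ a, (Φ a).fst = a := fun a => congrArg (fun f : A →+* A => f a) h2
  have hk : Φ.comp (algebraMap k A) = (TrivSqZeroExt.inlHom A A).comp (algebraMap k A) := by
    apply sp_injective
    rw [sp_comp, sp_comp, ← hc, ← Category.assoc, h1, α.act_over, Category.assoc]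
  have hk' : ∀ a : k, (Φ (algebraMap k A a)).snd = 0 := fun a => by
    have := congrArg (fun f : k →+* A[ε] => (f a).snd) hk
    simpa using this
  refine ⟨Derivation.mk' ⟨⟨fun a => (Φ a).snd, ?_⟩, ?_⟩ ?_, Φ, ?_, h1⟩
  · intro a b; simp
  · intro r a
    simp [Algebra.smul_def, hfst, hk']
  · intro a b
    simp [hfst, mul_comm]
  · intro a
    ext
    · simp [hfst]
    · simp

/-- Naturality of the action along `A[ε] → A'[ε]`, together with the open immersion `c` being a
monomorphism. Used to match the vector fields of the two charts on the overlap. -/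
theorem IsGenerator.comp_eq {A A' : Type u} [CommRing A] [CommRing A'] [Algebra k A]
    [Algebra k A'] {c : Spec (CommRingCat.of A) ⟶ C} [IsOpenImmersion c] (h : A →+* A')
    {c' : Spec (CommRingCat.of A') ⟶ C} (hc : c' = sp h ≫ c)
    {D : Derivation k A A} {D' : Derivation k A' A'} (hD : IsGenerator α c D)
    (hD' : IsGenerator α c' D') (a : A) : D' (h a) = h (D a) := by
  obtain ⟨Φ, h1, h2⟩ := hD
  obtain ⟨Φ', h1', h2'⟩ := hD'
  have hu : Units.map (dualMap h : A[ε] →* A'[ε]) (dualUnit A) = dualUnit A' := by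
    ext <;> simp [dualMap, dualUnit]
  have hi : (dualMap h).comp (TrivSqZeroExt.inlHom A A) = (TrivSqZeroExt.inlHom A' A').comp h := by
    ext <;> simp [dualMap]
  have : (dualMap h).comp Φ = Φ'.comp h := by
    apply sp_injective
    rw [← cancel_mono c, sp_comp, sp_comp, Category.assoc, h2, α.natural_sp, hu,
      Category.assoc, ← hc, h2', hc, ← Category.assoc, ← sp_comp, hi, sp_comp, Category.assoc]
  have h3 := congrArg (fun f : A →+* A'[ε] => (f a).snd) this
  simpa [dualMap, h1, h1'] using h3.symm

/-- If the infinitesimal action is trivial then so is the formal action. -/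
theorem IsGenerator.act_formal {A : Type u} [CommRing A] [Algebra k A] [CharZero k]
    {c : Spec (CommRingCat.of A) ⟶ C} [IsOpenImmersion c]
    (hD : IsGenerator α c (0 : Derivation k A A)) (u : (PowerSeries A)ˣ)
    (hu : (u : PowerSeries A) = 1 + PowerSeries.X) :
    α.act (specUnit u) (sp (PowerSeries.C (R := A)) ≫ c) = sp (PowerSeries.C (R := A)) ≫ c := by
  obtain ⟨Φ₀, h1, h2⟩ := hD
  have hΦ₀ : Φ₀ = TrivSqZeroExt.inlHom A A := by ext <;> simp [h1]
  rw [hΦ₀] at h2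
  have hJ : RingHom.ker (PowerSeries.constantCoeff (R := A)) ≤ Ideal.jacobson ⊥ := by
    intro x hx
    rw [Ideal.mem_jacobson_bot]
    intro y
    rw [PowerSeries.isUnit_iff_constantCoeff]
    have hx' : PowerSeries.constantCoeff x = 0 := hx
    simp [hx']
  obtain ⟨Φ, h3, h4⟩ := α.exists_lift c (PowerSeries.constantCoeff (R := A))
    PowerSeries.constantCoeff_surj hJ u (by simp [hu]) PowerSeries.C
  let S := PowerSeries A
  -- With `u = 1 + X`, this is the infinitesimal multiplication `u ↦ u (1 + ε)`, that is, `X ↦ X +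
  -- (1 + X) ε`.
  let r : S →+* S[ε] :=
    { toFun := fun x => TrivSqZeroExt.inl x +
        TrivSqZeroExt.inr ((1 + PowerSeries.X) * PowerSeries.derivative A x)
      map_one' := by ext <;> simp
      map_mul' := fun x y => by apply TrivSqZeroExt.ext <;> simp; ring
      map_zero' := by ext <;> simp
      map_add' := fun x y => by apply TrivSqZeroExt.ext <;> simp; ring }
  let i : S →+* S[ε] := TrivSqZeroExt.inlHom S S
  have hri : r.comp PowerSeries.C = i.comp PowerSeries.C := by
    refine RingHom.ext fun a => TrivSqZeroExt.ext ?_ ?_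
    · simp [r, i]
    · have : PowerSeries.derivative A (PowerSeries.C a) = 0 := by
        ext; simp
      simp [r, i, this]
  have hru : Units.map (r : S →* S[ε]) u = Units.map (i : S →* S[ε]) u * dualUnit S := by
    refine Units.ext (TrivSqZeroExt.ext ?_ ?_)
    · simp [r, i, hu, dualUnit, ]; ring
    · simp [r, i, hu, dualUnit]; ring
  -- the group law
  have hi2 : (dualMap (PowerSeries.C (R := A))).comp (TrivSqZeroExt.inlHom A A) =
      i.comp PowerSeries.C := by
    ext <;> simp [dualMap, i]
  have hu2 : Units.map (dualMap (PowerSeries.C (R := A)) : A[ε] →* S[ε]) (dualUnit A) =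
      dualUnit S := by
    ext <;> simp [dualMap, dualUnit]
  have htriv : α.act (specUnit (dualUnit S)) (sp (i.comp PowerSeries.C) ≫ c) =
      sp (i.comp PowerSeries.C) ≫ c := by
    rw [← hi2, sp_comp, Category.assoc, ← hu2, ← α.natural_sp, ← h2]
  -- Acting by `u (1 + ε)` is acting by `1 + ε`, which does nothing by hypothesis, and then by `u`.
  -- Hence the formal orbit map `Φ` is invariant under the infinitesimal multiplication.
  have hgrp : r.comp Φ = i.comp Φ := by
    apply sp_injective
    rw [← cancel_mono c, sp_comp, sp_comp, Category.assoc, Category.assoc, h3, α.natural_sp,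
      α.natural_sp, ← Category.assoc, ← Category.assoc, ← sp_comp, ← sp_comp, hri, hru,
      specUnit_mul, α.mul_act, htriv]
  -- Invariance says `(1 + X) Φ(a)' = 0`. In characteristic `0` the series `Φ(a)` is then constant,
  -- and its constant term is `a`.
  have hΦ : Φ = PowerSeries.C := by
    ext a n
    have h5 := congrArg (fun f : A →+* S[ε] => (f a).snd) hgrp
    have h6 : (1 + PowerSeries.X) * PowerSeries.derivative A (Φ a) = 0 := by
      simpa [r, i] using h5
    rw [← hu] at h6
    have h7 : PowerSeries.derivative A (Φ a) = 0 := by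
      rwa [Units.mul_right_eq_zero] at h6
    rcases n with _ | n
    · have := congrArg (fun f : A →+* A => f a) h4
      simpa using this
    · have h8 := congrArg (PowerSeries.coeff n) h7
      rw [PowerSeries.coeff_derivative, map_zero] at h8
      have h9 : ((n + 1 : k)) • PowerSeries.coeff (n + 1) (Φ a) = 0 := by
        rw [Algebra.smul_def, mul_comm]; simpa using h8
      have h10 := (smul_eq_zero_iff_right (M := A)
        (by exact_mod_cast n.succ_ne_zero : (n + 1 : k) ≠ 0)).mp h9
      rw [h10, PowerSeries.coeff_C, if_neg (by omega)]
  rw [← h3, hΦ]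

end Action

/-! ### Separatedness -/

section Separated

open Limits TensorProduct

/-- Over the product of two charts the diagonal restricts to the map from their intersection. On
rings this is `A ⊗ A → O`, so surjectivity makes it a closed immersion. -/
theorem isClosedImmersion_of_isPullback {k A O : Type u} [CommRing k] [CommRing A] [CommRing O]
    [Algebra k A] [Algebra k O] {C : Scheme.{u}} {p : C ⟶ Spec (CommRingCat.of k)}
    {c d : Spec (CommRingCat.of A) ⟶ C}
    (hc : c ≫ p = sp (algebraMap k A)) (hd : d ≫ p = sp (algebraMap k A))
    (a b : A →ₐ[k] O) (h : IsPullback (sp a.toRingHom) (sp b.toRingHom) c d)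
    (hs : Function.Surjective (Algebra.TensorProduct.lift a b fun _ _ => Commute.all _ _)) :
    IsClosedImmersion (pullback.snd (pullback.diagonal p)
      (pullback.map (c ≫ p) (d ≫ p) p p c d (𝟙 _) (Category.comp_id _) (Category.comp_id _))) := by
  refine (MorphismProperty.cancel_left_of_respectsIso (P := @IsClosedImmersion)
    (f := (pullbackDiagonalMapIdIso ..).inv) _).mp ?_
  let e₁ : pullback (c ≫ p) (d ≫ p) ≅ Spec (CommRingCat.of (A ⊗[k] A)) :=
    pullback.congrHom hc hd ≪≫ pullbackSpecIso k A A
  let e₂ : Spec (CommRingCat.of O) ≅ pullback c d := h.isoPullback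
  rw [← MorphismProperty.cancel_right_of_respectsIso (P := @IsClosedImmersion) _ e₁.hom,
    ← MorphismProperty.cancel_left_of_respectsIso (P := @IsClosedImmersion) e₂.hom]
  convert! IsClosedImmersion.spec_of_surjective
    (CommRingCat.ofHom (Algebra.TensorProduct.lift a b fun _ _ => Commute.all _ _).toRingHom) hs
    using 1
  rw [← cancel_mono (pullbackSpecIso ..).inv]
  apply pullback.hom_ext
  · have hf : e₁.hom ≫ (pullbackSpecIso k A A).inv ≫ pullback.fst _ _ = pullback.fst _ _ := by
      simp only [e₁, Iso.trans_hom, Category.assoc, Iso.hom_inv_id_assoc]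
      exact (pullback.lift_fst _ _ _).trans (Category.comp_id _)
    simp only [Category.assoc, hf, e₂]
    rw [pullbackSpecIso_inv_fst, ← Spec.map_comp, pullbackDiagonalMapIdIso_inv_snd_fst, h.isoPullback_hom_fst]
    congr 1
    ext x : 2
    change a x = Algebra.TensorProduct.lift a b (fun _ _ => Commute.all _ _) (x ⊗ₜ 1)
    simp
  · have hf : e₁.hom ≫ (pullbackSpecIso k A A).inv ≫ pullback.snd _ _ = pullback.snd _ _ := by
      simp only [e₁, Iso.trans_hom, Category.assoc, Iso.hom_inv_id_assoc]
      exact (pullback.lift_snd _ _ _).trans (Category.comp_id _)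
    simp only [Category.assoc, hf, e₂]
    rw [pullbackSpecIso_inv_snd, ← Spec.map_comp, pullbackDiagonalMapIdIso_inv_snd_snd, h.isoPullback_hom_snd]
    congr 1
    ext x : 2
    change b x = Algebra.TensorProduct.lift a b (fun _ _ => Commute.all _ _) (1 ⊗ₜ x)
    simp

/-- The cover of a scheme by two open subschemes. -/
def coverOfTwo {C U V : Scheme.{u}} (c : U ⟶ C) (d : V ⟶ C) [IsOpenImmersion c]
    [IsOpenImmersion d] (h : ∀ x : C, x ∈ Set.range c ∨ x ∈ Set.range d) : C.OpenCover :=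
  Scheme.Cover.mkOfCovers Bool (fun i => bif i then U else V)
    (fun i => match i with | true => c | false => d)
    (fun x => by
      rcases h x with ⟨y, hy⟩ | ⟨y, hy⟩
      · exact ⟨true, y, hy⟩
      · exact ⟨false, y, hy⟩)
    (fun i => match i with | true => ‹_› | false => ‹_›)

/-- Closedness of the diagonal is checked on the four products of charts. For a chart with itself
the ring map is the multiplication `A ⊗ A → A`; the mixed products are the hypothesis and its
transpose. -/
theorem isSeparated_of_two_charts {k A O : Type u} [CommRing k] [CommRing A] [CommRing O]
    [Algebra k A] [Algebra k O] {C : Scheme.{u}} {p : C ⟶ Spec (CommRingCat.of k)}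
    {c d : Spec (CommRingCat.of A) ⟶ C} [IsOpenImmersion c] [IsOpenImmersion d]
    (hcov : ∀ x : C, x ∈ Set.range c ∨ x ∈ Set.range d)
    (hc : c ≫ p = sp (algebraMap k A)) (hd : d ≫ p = sp (algebraMap k A))
    (a b : A →ₐ[k] O) (h : IsPullback (sp a.toRingHom) (sp b.toRingHom) c d)
    (hs : Function.Surjective (Algebra.TensorProduct.lift a b fun _ _ => Commute.all _ _)) :
    IsSeparated p := by
  have hs' : Function.Surjective (Algebra.TensorProduct.lift b a fun _ _ => Commute.all _ _) := by
    intro x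
    obtain ⟨y, rfl⟩ := hs x
    refine ⟨Algebra.TensorProduct.comm k A A y, ?_⟩
    have : (Algebra.TensorProduct.lift b a fun _ _ => Commute.all _ _).comp
      (Algebra.TensorProduct.comm k A A).toAlgHom =
        Algebra.TensorProduct.lift a b fun _ _ => Commute.all _ _ := by
      ext <;> simp
    exact congrArg (fun f : A ⊗[k] A →ₐ[k] O => f y) this
  have hid : Function.Surjective (Algebra.TensorProduct.lift (AlgHom.id k A) (AlgHom.id k A)
      fun _ _ => Commute.all _ _) := fun x => ⟨x ⊗ₜ 1, by simp⟩
  have hdiag : ∀ (e : Spec (CommRingCat.of A) ⟶ C) [IsOpenImmersion e],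
      IsPullback (sp (AlgHom.id k A).toRingHom) (sp (AlgHom.id k A).toRingHom) e e := by
    intro e _
    have : sp (AlgHom.id k A).toRingHom = 𝟙 _ := Spec.map_id _
    rw [this]
    exact IsKernelPair.id_of_mono e
  refine ⟨IsZariskiLocalAtTarget.of_openCover (Scheme.Pullback.openCoverOfLeftRight
    (coverOfTwo c d hcov) (coverOfTwo c d hcov) _ _) ?_⟩
  rintro ⟨i, j⟩
  rcases i with _ | _ <;> rcases j with _ | _
  · exact isClosedImmersion_of_isPullback hd hd _ _ (hdiag d) hid
  · exact isClosedImmersion_of_isPullback hd hc _ _ h.flip hs'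
  · exact isClosedImmersion_of_isPullback hc hd _ _ h hs
  · exact isClosedImmersion_of_isPullback hc hc _ _ (hdiag c) hid

theorem appTop_injective_of_comp {X Y Z : Scheme.{u}} (f : X ⟶ Y) (g : Y ⟶ Z)
    (h : Function.Injective (f ≫ g).appTop) : Function.Injective g.appTop := by
  rw [Scheme.Hom.comp_appTop] at h
  intro a b hab
  apply h
  simp [hab]

/-- Morphisms to a separated scheme which agree after a schematically dominant base change. -/
theorem ext_of_injective {k B B' : Type u} [CommRing k] [CommRing B] [CommRing B']
    {C : Scheme.{u}} (p : C ⟶ Spec (CommRingCat.of k)) [IsSeparated p]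
    {x y : Spec (CommRingCat.of B) ⟶ C} (hxy : x ≫ p = y ≫ p)
    (ψ : B →+* B') (hψ : Function.Injective ψ) (h : sp ψ ≫ x = sp ψ ≫ y) : x = y := by
  let X' : Over (Spec (CommRingCat.of k)) := Over.mk (x ≫ p)
  let Y' : Over (Spec (CommRingCat.of k)) := Over.mk p
  let U' : Over (Spec (CommRingCat.of k)) := Over.mk (sp ψ ≫ x ≫ p)
  let f' : X' ⟶ Y' := Over.homMk x
  let g' : X' ⟶ Y' := Over.homMk y
  let ι' : U' ⟶ X' := Over.homMk (sp ψ)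
  have : IsSeparated Y'.hom := ‹_›
  have hl : (equalizer.lift (f := f') (g := g') ι' (by ext1; exact h)).left ≫
      (equalizer.ι f' g').left = sp ψ := by
    rw [← Over.comp_left, equalizer.lift_ι]; rfl
  have hci : IsClosedImmersion (equalizer.ι f' g').left := inferInstance
  have : IsAffine X'.left := inferInstanceAs (IsAffine (Spec (CommRingCat.of B)))
  -- The equalizer is a closed subscheme of an affine scheme through which `sp ψ` factors. No
  -- nonzero function vanishes on it, so it is everything.
  have hiso : IsIso (equalizer.ι f' g').left := by
    apply IsClosedImmersion.isIso_of_injective_of_isAffine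
    have h1 : Function.Injective (sp ψ).appTop := by
      have h2 := Scheme.ΓSpecIso_inv_naturality (CommRingCat.ofHom ψ)
      have h3 : (sp ψ).appTop = (Scheme.ΓSpecIso (CommRingCat.of B)).hom ≫
          CommRingCat.ofHom ψ ≫ (Scheme.ΓSpecIso (CommRingCat.of B')).inv := by
        rw [h2, Iso.hom_inv_id_assoc]
      rw [h3]
      simp only [CommRingCat.hom_comp, RingHom.coe_comp]
      exact ((ConcreteCategory.bijective_of_isIso _).1.comp hψ).comp
        (ConcreteCategory.bijective_of_isIso _).1
    rw [← hl] at h1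
    exact appTop_injective_of_comp _ _ h1
  rw [← cancel_epi (equalizer.ι f' g').left]
  exact congr($(equalizer.condition f' g').left)

end Separated

/-! ### Actions with trivial infinitesimal generator -/

/-- The formal neighbourhood of the identity is schematically dense in `𝔾ₘ`: after clearing a power
of `T`, the map is the translation `T ↦ 1 + X` of polynomials, which is invertible. -/
theorem eval₂_one_add_X_injective (A : Type u) [CommRing A] (u : (PowerSeries A)ˣ)
    (hu : (u : PowerSeries A) = 1 + PowerSeries.X) :
    Function.Injective (LaurentPolynomial.eval₂ (PowerSeries.C (R := A)) u) := by
  rw [injective_iff_map_eq_zero]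
  intro q hq
  obtain ⟨n, q', hq'⟩ := q.exists_T_pow
  have h1 : LaurentPolynomial.eval₂ (PowerSeries.C (R := A)) u (toLaurent q') = 0 := by
    rw [hq', map_mul, hq, zero_mul]
  rw [eval₂_toLaurent, hu] at h1
  have h2 : Polynomial.eval₂ (PowerSeries.C (R := A)) (1 + PowerSeries.X) q' =
      ((q'.comp (1 + X) : A[X]) : PowerSeries A) := by
    rw [Polynomial.comp, ← Polynomial.coeToPowerSeries.ringHom_apply, Polynomial.hom_eval₂]
    congr 1
    · ext; simp
    · simp
  rw [h2, Polynomial.coe_eq_zero_iff] at h1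
  have h3 : q' = 0 := by
    have := congrArg (fun r : A[X] => r.comp (X - 1)) h1
    simpa [Polynomial.comp_assoc] using this
  have h4 : q * T n = 0 := by rw [← hq', h3, map_zero]
  exact (isUnit_T (n : ℤ)).mul_left_eq_zero.mp h4

section Action

variable {k : Type u} [Field k] {C : Scheme.{u}} {p : C ⟶ Spec (CommRingCat.of k)}
  (α : GmAction p)

/-- The unit `T` of the ring of Laurent polynomials. -/
def unitT (A : Type u) [CommRing A] : (A[T;T⁻¹])ˣ where
  val := T 1
  inv := T (-1)
  val_inv := by rw [← T_add]; simp
  inv_val := by rw [← T_add]; simp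

/-- Triviality over the formal neighbourhood of `1` spreads to all of `𝔾ₘ` by density, as `C` is
separated. -/
theorem IsGenerator.act_laurent [CharZero k] [IsSeparated p]
    {A : Type u} [CommRing A] [Algebra k A]
    {c : Spec (CommRingCat.of A) ⟶ C} [IsOpenImmersion c]
    (hD : IsGenerator α c (0 : Derivation k A A)) :
    α.act (specUnit (unitT A)) (sp (LaurentPolynomial.C (R := A)) ≫ c) =
      sp (LaurentPolynomial.C (R := A)) ≫ c := by
  obtain ⟨u, hu⟩ : IsUnit (1 + PowerSeries.X : PowerSeries A) := by
    rw [PowerSeries.isUnit_iff_constantCoeff]; simp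
  refine ext_of_injective p (α.act_over _ _) (LaurentPolynomial.eval₂ (PowerSeries.C (R := A)) u)
    (eval₂_one_add_X_injective A u hu) ?_
  have h1 : (LaurentPolynomial.eval₂ (PowerSeries.C (R := A)) u).comp
      (LaurentPolynomial.C (R := A)) = PowerSeries.C := by ext; simp
  have h2 : Units.map (LaurentPolynomial.eval₂ (PowerSeries.C (R := A)) u : _ →* _) (unitT A) =
      u := by ext; simp [unitT]
  rw [α.natural_sp, h2, ← Category.assoc, ← sp_comp, h1]
  exact hD.act_formal α u hu

theorem eq_toSpecΓ_comp {A : CommRingCat.{u}} {W : Scheme.{u}} (y : W ⟶ Spec A) :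
    W.toSpecΓ ≫ Spec.map ((Scheme.ΓSpecIso A).inv ≫ y.appTop) = y := by
  rw [Spec.map_comp, ← Scheme.toSpecΓ_naturality_assoc, toSpecΓ_SpecMap_ΓSpecIso_inv,
    Category.comp_id]

/-- Every pair of a unit `t` and a point `y` of the chart is pulled back from the universal pair
over `Spec A[T;T⁻¹]`, which `act_laurent` settles. -/
theorem IsGenerator.act_eq [CharZero k] [IsSeparated p]
    {A : Type u} [CommRing A] [Algebra k A]
    {c : Spec (CommRingCat.of A) ⟶ C} [IsOpenImmersion c]
    (hD : IsGenerator α c (0 : Derivation k A A)) {W : Scheme.{u}} (t : (Γ(W, ⊤))ˣ)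
    (y : W ⟶ Spec (CommRingCat.of A)) : α.act t (y ≫ c) = y ≫ c := by
  let φ : A →+* Γ(W, ⊤) := ((Scheme.ΓSpecIso (CommRingCat.of A)).inv ≫ y.appTop).hom
  let θ : A[T;T⁻¹] →+* Γ(W, ⊤) := LaurentPolynomial.eval₂ φ t
  let h : W ⟶ Spec (CommRingCat.of A[T;T⁻¹]) := W.toSpecΓ ≫ Spec.map (CommRingCat.ofHom θ)
  have h1 : h ≫ sp (LaurentPolynomial.C (R := A)) = y := by
    have : θ.comp (LaurentPolynomial.C (R := A)) = φ := by ext; simp [θ]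
    simp only [h, sp, Category.assoc, ← Spec.map_comp, ← CommRingCat.ofHom_comp, this]
    exact eq_toSpecΓ_comp y
  have h2 : Units.map (h.appTop.hom : _ →* _) (specUnit (unitT A)) = t := by
    ext
    have h3 : (Scheme.ΓSpecIso (CommRingCat.of A[T;T⁻¹])).inv ≫ h.appTop = CommRingCat.ofHom θ := by
      simp only [h, Scheme.Hom.comp_appTop, Scheme.toSpecΓ_appTop]
      rw [← Category.assoc, ← Scheme.ΓSpecIso_inv_naturality, Category.assoc, Iso.inv_hom_id,
        Category.comp_id]
    have h4 := congrArg (fun f => f.hom (T 1 : A[T;T⁻¹])) h3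
    have h5 : θ (T 1) = t := by simp [θ]
    exact h4.trans h5
  have h6 := α.natural h (specUnit (unitT A)) (sp (LaurentPolynomial.C (R := A)) ≫ c)
  rw [hD.act_laurent, h2, ← Category.assoc, h1] at h6
  exact h6.symm

theorem GmAction.act_eq_of_generators_eq_zero [CharZero k] [IsSeparated p]
    {A : Type u} [CommRing A] [Algebra k A]
    {c d : Spec (CommRingCat.of A) ⟶ C} [IsOpenImmersion c] [IsOpenImmersion d]
    (hcov : ∀ x : C, x ∈ Set.range c ∨ x ∈ Set.range d)
    (hc : IsGenerator α c (0 : Derivation k A A)) (hd : IsGenerator α d (0 : Derivation k A A))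
    {W : Scheme.{u}} (t : (Γ(W, ⊤))ˣ) (x : W ⟶ C) : α.act t x = x := by
  refine Scheme.Cover.hom_ext ((coverOfTwo c d hcov).pullback₁ x) _ _ fun i => ?_
  have key : ∀ (e : Spec (CommRingCat.of A) ⟶ C) [IsOpenImmersion e]
      (_ : IsGenerator α e (0 : Derivation k A A)),
      Limits.pullback.fst x e ≫ α.act t x = Limits.pullback.fst x e ≫ x := by
    intro e _ he
    rw [α.natural, Limits.pullback.condition]
    exact he.act_eq α _ _
  rcases i with _ | _
  · exact key d hd
  · exact key c hc

end Action

/-! ### The gluing maps and vector fields -/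

section Gluing

variable {k : Type u} [Field k]

theorem chartMap_inl (a : OverlapRing k) (e : k[T;T⁻¹]) (q : k[X]) :
    chartMap k a e (TrivSqZeroExt.inl q) = Polynomial.aeval a q := by
  simp [chartMap]

theorem chartMap_inr (a : OverlapRing k) (e : k[T;T⁻¹]) (q : k[X]) :
    chartMap k a e (TrivSqZeroExt.inr q) =
      TrivSqZeroExt.inr ((Polynomial.aeval a q).fst * e) := by
  simp [chartMap, DualNumber.inr_eq_smul_eps]
  apply TrivSqZeroExt.ext <;> simp [mul_comm]

theorem aeval_T_neg_one (q : k[X]) :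
    Polynomial.aeval (T (-1) : k[T;T⁻¹]) q = invert (toLaurent q) := by
  have h : (Polynomial.aeval (T (-1) : k[T;T⁻¹])) =
      ((invert : k[T;T⁻¹] ≃ₐ[k] k[T;T⁻¹]) : k[T;T⁻¹] →ₐ[k] k[T;T⁻¹]).comp toLaurentAlg := by
    ext; simp
  exact congrArg (fun f : k[X] →ₐ[k] k[T;T⁻¹] => f q) h

theorem aeval_T_one (q : k[X]) :
    Polynomial.aeval (T 1 : k[T;T⁻¹]) q = toLaurent q := by
  have h : (Polynomial.aeval (T 1 : k[T;T⁻¹])) = toLaurentAlg := by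
    ext; simp
  exact congrArg (fun f : k[X] →ₐ[k] k[T;T⁻¹] => f q) h

theorem aeval_inl_add_inr (u w : k[T;T⁻¹]) (q : k[X]) :
    Polynomial.aeval (TrivSqZeroExt.inl u + TrivSqZeroExt.inr w : OverlapRing k) q =
      TrivSqZeroExt.inl (Polynomial.aeval u q) +
        TrivSqZeroExt.inr (Polynomial.aeval u (derivative q) * w) := by
  induction q using Polynomial.induction_on' with
  | add p q hp hq =>
    simp only [map_add, hp, hq, add_mul, TrivSqZeroExt.inl_add, TrivSqZeroExt.inr_add]
    abel
  | monomial n c =>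
    rw [← C_mul_X_pow_eq_monomial, derivative_C_mul_X_pow]
    have hc : (algebraMap k (OverlapRing k) c) = TrivSqZeroExt.inl (LaurentPolynomial.C c) := rfl
    have hc' : (algebraMap k k[T;T⁻¹] c) = LaurentPolynomial.C c := rfl
    apply TrivSqZeroExt.ext
    · simp [TrivSqZeroExt.fst_pow, hc, hc']
    · simp [TrivSqZeroExt.snd_pow, hc, hc']
      ring

theorem resOne_apply (g : ℕ) (f : Fin (g - 2) → k) (s : ChartRing k) :
    resOne g f s = TrivSqZeroExt.inl (invert (toLaurent s.fst)) + TrivSqZeroExt.inr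
      (invert (toLaurent s.snd) * T (-(g : ℤ) - 1) -
        invert (toLaurent (derivative s.fst)) * (T (-2) * tail g f)) := by
  have hX : imageX g f = TrivSqZeroExt.inl (T (-1)) + TrivSqZeroExt.inr (-(T (-2) * tail g f)) := by
    simp [imageX, sub_eq_add_neg]
  conv_lhs => rw [← TrivSqZeroExt.inl_fst_add_inr_snd_eq s]
  rw [resOne, map_add, chartMap_inl, chartMap_inr, hX, aeval_inl_add_inr, aeval_inl_add_inr,
    aeval_T_neg_one, aeval_T_neg_one, aeval_T_neg_one]
  apply TrivSqZeroExt.ext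
  · simp
  · simp; ring

theorem resTwo_apply (s : ChartRing k) :
    resTwo k s = TrivSqZeroExt.inl (toLaurent s.fst) + TrivSqZeroExt.inr (toLaurent s.snd) := by
  have hX : (TrivSqZeroExt.inl (T 1) : OverlapRing k) =
    TrivSqZeroExt.inl (T 1) + TrivSqZeroExt.inr 0 := by simp
  conv_lhs => rw [← TrivSqZeroExt.inl_fst_add_inr_snd_eq s]
  rw [resTwo, map_add, chartMap_inl, chartMap_inr, hX, aeval_inl_add_inr, aeval_inl_add_inr,
    aeval_T_one, aeval_T_one]
  apply TrivSqZeroExt.ext <;> simp [aeval_T_one]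

/-- This gives separatedness of the ribbon. The products of `x^n ε = y^{-n-g-1} η` with polynomials
in `y` give all Laurent multiples of `η`. Subtracting one of these from the image of `x` gives
`y⁻¹`, and with `y` the whole ring. -/
theorem lift_resOne_resTwo_surjective (g : ℕ) (f : Fin (g - 2) → k) :
    Function.Surjective (Algebra.TensorProduct.lift (resOne g f) (resTwo k)
      fun _ _ => Commute.all _ _) := by
  let L : TensorProduct k (ChartRing k) (ChartRing k) →ₐ[k] OverlapRing k :=
    Algebra.TensorProduct.lift (resOne g f) (resTwo k) fun _ _ => Commute.all _ _
  change Function.Surjective L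
  rw [← AlgHom.range_eq_top]
  have h1 : ∀ s, resOne g f s ∈ L.range := fun s =>
    ⟨TensorProduct.tmul k s 1, by simp [L]⟩
  have h2 : ∀ s, resTwo k s ∈ L.range := fun s =>
    ⟨TensorProduct.tmul k 1 s, by simp [L]⟩
  have hinr : ∀ q : k[T;T⁻¹], TrivSqZeroExt.inr q ∈ L.range := by
    intro q
    obtain ⟨n, q', hq'⟩ := q.exists_T_pow
    have h3 := L.range.mul_mem (h1 (TrivSqZeroExt.inr (X ^ n)))
      (h2 (TrivSqZeroExt.inl (X ^ (g + 1) * q')))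
    have h4 : resOne g f (TrivSqZeroExt.inr (X ^ n)) =
        TrivSqZeroExt.inr (T (-(n : ℤ)) * T (-(g : ℤ) - 1)) := by
      rw [resOne_apply, TrivSqZeroExt.fst_inr, TrivSqZeroExt.snd_inr, toLaurent_X_pow, invert_T,
        derivative_zero, map_zero, map_zero, zero_mul, sub_zero, TrivSqZeroExt.inl_zero, zero_add]
    have h5 : resTwo k (TrivSqZeroExt.inl (X ^ (g + 1) * q')) =
        TrivSqZeroExt.inl (T ((g : ℤ) + 1) * (q * T n)) := by
      rw [resTwo_apply, TrivSqZeroExt.fst_inl, TrivSqZeroExt.snd_inl, map_mul, hq', toLaurent_X_pow]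
      simp
    have h6 : (T (-(n : ℤ)) * T (-(g : ℤ) - 1)) * (T ((g : ℤ) + 1) * (q * T n)) = q := by
      rw [show (T (-(n : ℤ)) * T (-(g : ℤ) - 1)) * (T ((g : ℤ) + 1) * (q * T n)) =
        q * ((T (-(n : ℤ)) * T n) * (T (-(g : ℤ) - 1) * T ((g : ℤ) + 1))) by ring, ← T_add,
        ← T_add]
      simp
    rwa [h4, h5, TrivSqZeroExt.inr_mul_inl, op_smul_eq_smul, smul_eq_mul, mul_comm, h6] at h3
  have hT : TrivSqZeroExt.inl (T (-1)) ∈ L.range := by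
    have := L.range.sub_mem (h1 (TrivSqZeroExt.inl X)) (hinr (-(T (-2) * tail g f)))
    convert this using 1
    rw [resOne_apply]
    apply TrivSqZeroExt.ext <;> simp
  rw [eq_top_iff]
  intro x _
  rw [← TrivSqZeroExt.inl_fst_add_inr_snd_eq x]
  refine L.range.add_mem ?_ (hinr _)
  generalize x.fst = q
  obtain ⟨n, q', hq'⟩ := q.exists_T_pow
  have h3 := L.range.mul_mem (h2 (TrivSqZeroExt.inl q')) (L.range.pow_mem hT n)
  have h4 : (q * T n) * T (-1) ^ n = q := by
    rw [T_pow, mul_assoc, ← T_add]; simp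
  have h5 : (TrivSqZeroExt.inl (T (-1)) : OverlapRing k) ^ n = TrivSqZeroExt.inl (T (-1) ^ n) :=
    (map_pow (TrivSqZeroExt.inlHom _ _) _ _).symm
  rwa [resTwo_apply, TrivSqZeroExt.fst_inl, TrivSqZeroExt.snd_inl, hq', map_zero,
    TrivSqZeroExt.inr_zero, add_zero, h5, ← TrivSqZeroExt.inl_mul, h4] at h3

/-- A nontrivial action of `𝔾ₘ` on a ribbon gives a nonzero vector field. -/
theorem exists_vectorField [CharZero k] {g : ℕ} {C : Scheme.{u}}
    {p : C ⟶ Spec (CommRingCat.of k)} (R : Presentation g p) (α : GmAction p)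
    (hα : α.IsNontrivial) :
    ∃ (D₁ D₂ : Derivation k (ChartRing k) (ChartRing k))
      (D : Derivation k (OverlapRing k) (OverlapRing k)),
      (∀ a, D (resOne g R.f a) = resOne g R.f (D₁ a)) ∧
      (∀ a, D (resTwo k a) = resTwo k (D₂ a)) ∧ ¬ (D₁ = 0 ∧ D₂ = 0) := by
  have := R.isOpenImmersion_one
  have := R.isOpenImmersion_two
  have hsep : IsSeparated p := isSeparated_of_two_charts R.cover R.over_one R.over_two _ _
    R.isPullback (lift_resOne_resTwo_surjective g R.f)
  let c := sp (resOne g R.f).toRingHom ≫ R.chartOne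
  have hc : c = sp (resTwo k).toRingHom ≫ R.chartTwo := R.isPullback.w
  have : IsOpenImmersion (sp (resOne g R.f).toRingHom) :=
    MorphismProperty.of_isPullback R.isPullback.flip R.isOpenImmersion_two
  have : IsOpenImmersion c := inferInstance
  have hcp : c ≫ p = sp (algebraMap k (OverlapRing k)) := by
    have h := R.over_one
    simp only [c, Category.assoc]
    rw [h]
    change sp _ ≫ sp _ = _
    rw [← sp_comp]
    congr 1
    exact (resOne g R.f).comp_algebraMap
  obtain ⟨D₁, h1⟩ := α.exists_generator R.chartOne R.over_one
  obtain ⟨D₂, h2⟩ := α.exists_generator R.chartTwo R.over_two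
  obtain ⟨D, h⟩ := α.exists_generator c hcp
  refine ⟨D₁, D₂, D, fun a => h1.comp_eq α (resOne g R.f).toRingHom rfl h a,
    fun a => h2.comp_eq α (resTwo k).toRingHom hc h a, ?_⟩
  rintro ⟨rfl, rfl⟩
  obtain ⟨W, t, x, hx⟩ := hα
  exact hx (α.act_eq_of_generators_eq_zero R.cover h1 h2 t x)

end Gluing

/-! ### The derivative of a Laurent polynomial -/

section Laurent

variable {k : Type u} [Field k]

theorem coeff_C_mul_T (a : k) (m n : ℤ) :
    (LaurentPolynomial.C a * T m : k[T;T⁻¹]).coeff n = if m = n then a else 0 := by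
  rw [← single_eq_C_mul_T]
  exact Finsupp.single_apply

theorem laurentDeriv_coeff (p : k[T;T⁻¹]) (n : ℤ) :
    (laurentDeriv p).coeff n = ((n + 1 : ℤ) : k) * p.coeff (n + 1) := by
  rw [laurentDeriv, AddMonoidAlgebra.coeff_sum, Finsupp.finsetSum_apply]
  simp only [coeff_C_mul_T]
  rw [Finset.sum_eq_single (n + 1)]
  · simp
  · intro b _ hb
    rw [if_neg (by omega)]
  · intro h
    rw [Finsupp.notMem_support_iff] at h
    simp [h]

theorem laurentDeriv_add (p q : k[T;T⁻¹]) :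
    laurentDeriv (p + q) = laurentDeriv p + laurentDeriv q := by
  ext n; simp [laurentDeriv_coeff, mul_add]

theorem laurentDeriv_smul (c : k) (p : k[T;T⁻¹]) :
    laurentDeriv (c • p) = c • laurentDeriv p := by
  ext n; simp [laurentDeriv_coeff, mul_left_comm]

theorem laurentDeriv_C_mul_T (a : k) (m : ℤ) :
    laurentDeriv (LaurentPolynomial.C a * T m : k[T;T⁻¹]) =
      LaurentPolynomial.C ((m : k) * a) * T (m - 1) := by
  ext n
  rw [laurentDeriv_coeff, coeff_C_mul_T, coeff_C_mul_T]
  split_ifs with h1 h2 h2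
  · rw [h1]
  · omega
  · omega
  · simp

theorem laurentDeriv_mul (p q : k[T;T⁻¹]) :
    laurentDeriv (p * q) = p * laurentDeriv q + q * laurentDeriv p := by
  induction p using LaurentPolynomial.induction_on' with
  | add p₁ p₂ h₁ h₂ => rw [add_mul, laurentDeriv_add, h₁, h₂, laurentDeriv_add]; ring
  | C_mul_T m a =>
    induction q using LaurentPolynomial.induction_on' with
    | add p₁ p₂ h₁ h₂ => rw [mul_add, laurentDeriv_add, h₁, h₂, laurentDeriv_add]; ring
    | C_mul_T n b =>
      have h : (LaurentPolynomial.C a * T m) * (LaurentPolynomial.C b * T n) =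
        (LaurentPolynomial.C (a * b) * T (m + n) : k[T;T⁻¹]) := by
        rw [map_mul, T_add]; ring
      rw [h, laurentDeriv_C_mul_T, laurentDeriv_C_mul_T, laurentDeriv_C_mul_T,
        show m + n - 1 = m + n + -1 by ring, show m - 1 = m + -1 by ring,
        show n - 1 = n + -1 by ring, T_add, T_add, T_add, T_add]
      simp only [Int.cast_add, add_mul, map_add, map_mul]
      ring

/-- The derivation `d/dT` of the Laurent polynomials. -/
def LD : Derivation k k[T;T⁻¹] k[T;T⁻¹] :=
  Derivation.mk' ⟨⟨laurentDeriv, laurentDeriv_add⟩, laurentDeriv_smul⟩ fun p q => by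
    simpa using laurentDeriv_mul p q

theorem laurentDeriv_eq_LD (p : k[T;T⁻¹]) : laurentDeriv p = LD p := rfl

theorem LD_T (n : ℤ) : LD (T n : k[T;T⁻¹]) = LaurentPolynomial.C (n : k) * T (n - 1) := by
  have := laurentDeriv_C_mul_T (1 : k) n
  rwa [map_one, one_mul, mul_one] at this

theorem LD_toLaurent (q : k[X]) : LD (toLaurent q) = toLaurent (derivative q) := by
  induction q using Polynomial.induction_on' with
  | add p q hp hq => simp [hp, hq]
  | monomial n c =>
    rw [derivative_monomial, ← C_mul_X_pow_eq_monomial, ← C_mul_X_pow_eq_monomial,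
      toLaurent_C_mul_X_pow, toLaurent_C_mul_X_pow, ← laurentDeriv_eq_LD, laurentDeriv_C_mul_T]
    rcases n with _ | n
    · simp
    · rw [show ((n + 1 : ℕ) : ℤ) - 1 = n by push_cast; ring, Int.cast_natCast, mul_comm c,
        Nat.add_sub_cancel]

theorem LD_invert (q : k[T;T⁻¹]) : LD (invert q) = -(T (-2) * invert (LD q)) := by
  induction q using LaurentPolynomial.induction_on' with
  | add p q hp hq => simp only [map_add, hp, hq]; ring
  | C_mul_T m a =>
    simp only [map_mul, invert_C, invert_T, ← laurentDeriv_eq_LD, laurentDeriv_C_mul_T]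
    rw [mul_left_comm, ← T_add, show (-m - 1 : ℤ) = -2 + -(m - 1) by ring]
    simp

/-! ### Sections of the canonical bundle and its powers -/

theorem jacobian_eq (g : ℕ) (f : Fin (g - 2) → k) :
    jacobian g f = TrivSqZeroExt.inl (-T ((g : ℤ) - 1)) + TrivSqZeroExt.inr
      (-T ((g : ℤ) - 1) * (LD (tail g f) + LaurentPolynomial.C ((g : k) - 1) * T (-1) * tail g f)) := by
  have h1 : (imageX g f).fst = T (-1) := by simp [imageX]
  have h2 : (imageX g f).snd = -(T (-2) * tail g f) := by simp [imageX]
  have e1 : (T ((g : ℤ) - 1) : k[T;T⁻¹]) = T g * T (-1) := by rw [← T_add]; rfl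
  have e2 : (T (2 * (g : ℤ) + 2) : k[T;T⁻¹]) = T g ^ 2 * T 1 ^ 2 := by
    rw [T_pow, T_pow, ← T_add]; congr 1
  have e3 : (T (-(g : ℤ) - 1) : k[T;T⁻¹]) = T (-g) * T (-1) := by rw [← T_add]; rfl
  have e4 : (T (-2) : k[T;T⁻¹]) = T (-1) ^ 2 := by rw [T_pow]; rfl
  have e5 : (T (-2 - 1) : k[T;T⁻¹]) = T (-1) ^ 3 := by rw [T_pow]; rfl
  have e6 : (T (-1 - 1) : k[T;T⁻¹]) = T (-1) ^ 2 := by rw [T_pow]; rfl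
  have e7 : (T (-(g : ℤ) - 1 - 1) : k[T;T⁻¹]) = T (-g) * T (-1) ^ 2 := by
    rw [T_pow, ← T_add]; congr 1; ring
  have m1 : (T 1 * T (-1) : k[T;T⁻¹]) = 1 := by rw [← T_add]; simp
  have m2 : (T g * T (-g) : k[T;T⁻¹]) = 1 := by rw [← T_add]; simp
  apply TrivSqZeroExt.ext
  · simp only [jacobian, partialY, partialEta, imageEps, h1, h2, laurentDeriv_eq_LD,
      TrivSqZeroExt.fst_mul, TrivSqZeroExt.fst_sub, TrivSqZeroExt.fst_add, TrivSqZeroExt.fst_inl,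
      TrivSqZeroExt.fst_inr, TrivSqZeroExt.snd_inr, LD_T, map_zero, e1, e2, e3, e6]
    push_cast
    simp only [map_neg, map_one]
    linear_combination (-(T (-1) : k[T;T⁻¹])^3 * T g * T 1 ^ 2) * m2 -
      T g * (T (-1)) * (T 1 * T (-1) + 1) * m1
  · simp only [jacobian, partialY, partialEta, imageEps, h1, h2, laurentDeriv_eq_LD,
      TrivSqZeroExt.snd_mul, TrivSqZeroExt.snd_sub, TrivSqZeroExt.snd_add, TrivSqZeroExt.fst_mul,
      TrivSqZeroExt.fst_sub, TrivSqZeroExt.fst_add, TrivSqZeroExt.fst_inl,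
      TrivSqZeroExt.fst_inr, TrivSqZeroExt.snd_inr, TrivSqZeroExt.snd_inl, LD_T, map_zero,
      Derivation.leibniz, map_neg, smul_eq_mul, op_smul_eq_smul]
    rw [e1, e2, e3, e4, e5, e6, e7]
    push_cast
    simp only [map_neg, map_one, map_sub, map_natCast, map_ofNat]
    generalize LD (tail g f) = f'
    generalize tail g f = f
    linear_combination ((T (-1) : k[T;T⁻¹]) * T g * f' + T (-1) ^ 2 * f * T g * ((g : k[T;T⁻¹]) - 1)) *
      (-(T (-1) ^ 2 * T 1 ^ 2) * m2 - (T 1 * T (-1) + 1) * m1)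

/-- The leading term `-y^{g-1}` of the transition function of the canonical bundle. -/
def jacobianLead (k : Type u) [Field k] (g : ℕ) : k[T;T⁻¹] := -T ((g : ℤ) - 1)

theorem jacobian_pow (g : ℕ) (f : Fin (g - 2) → k) (m : ℕ) :
    jacobian g f ^ m = TrivSqZeroExt.inl (jacobianLead k g ^ m) + TrivSqZeroExt.inr
      (jacobianLead k g ^ m *
        ((m : k[T;T⁻¹]) * (LD (tail g f) + LaurentPolynomial.C ((g : k) - 1) * T (-1) * tail g f))) := by
  have h := jacobian_eq g f
  rw [← jacobianLead] at h
  generalize LD (tail g f) + LaurentPolynomial.C ((g : k) - 1) * T (-1) * tail g f = W at *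
  generalize jacobianLead k g = E at *
  induction m with
  | zero => apply TrivSqZeroExt.ext <;> simp
  | succ n ih =>
    rw [pow_succ, ih, h]
    apply TrivSqZeroExt.ext
    · simp [pow_succ]
    · simp [pow_succ]; ring

theorem LD_jacobianLead_pow (g m : ℕ) :
    LD (jacobianLead k g ^ m) =
      (m : k[T;T⁻¹]) * jacobianLead k g ^ m * (LaurentPolynomial.C ((g : k) - 1) * T (-1)) := by
  have h : LD (jacobianLead k g) =
      jacobianLead k g * (LaurentPolynomial.C ((g : k) - 1) * T (-1)) := by
    rw [jacobianLead, map_neg, LD_T, show (g : ℤ) - 1 - 1 = (g - 1) + -1 by ring, T_add]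
    push_cast
    ring
  induction m with
  | zero => simp
  | succ n ih =>
    rw [pow_succ, Derivation.leibniz, ih, h, smul_eq_mul, smul_eq_mul]
    push_cast
    ring

/-- Write `p + q η` for `s₂`. The derivative of `x` under gluing and the `η`-part of the Jacobian
contribute separate terms, which Leibniz's rule applied to `p = J^m a(y⁻¹)`, `J = -y^{g-1}`,
combines into `f p' + m f' p`. Thus the first chart only asks that `p` and `q - (f p' + m f' p)`
have bounded order at infinity. -/
theorem mem_canonicalSections_iff (g : ℕ) (f : Fin (g - 2) → k) (m : ℕ)
    (s : ChartRing k × ChartRing k) :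
    s ∈ canonicalSections g f m ↔
      toLaurent s.2.fst = jacobianLead k g ^ m * invert (toLaurent s.1.fst) ∧
      toLaurent s.2.snd = jacobianLead k g ^ m * T (-(g : ℤ) - 1) * invert (toLaurent s.1.snd) +
        (tail g f * LD (toLaurent s.2.fst) + (m : k[T;T⁻¹]) * LD (tail g f) * toLaurent s.2.fst) := by
  change resOne g f s.1 * jacobian g f ^ m = resTwo k s.2 ↔ _
  rw [resOne_apply, resTwo_apply, jacobian_pow, TrivSqZeroExt.ext_iff]
  simp only [TrivSqZeroExt.fst_mul, TrivSqZeroExt.fst_add, TrivSqZeroExt.fst_inl,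
    TrivSqZeroExt.fst_inr, add_zero, TrivSqZeroExt.snd_mul, TrivSqZeroExt.snd_add,
    TrivSqZeroExt.snd_inr, TrivSqZeroExt.snd_inl, zero_add, op_smul_eq_smul, smul_eq_mul]
  rw [eq_comm (a := invert (toLaurent s.1.fst) * _), mul_comm (invert (toLaurent s.1.fst))]
  refine and_congr_right fun h => ?_
  rw [h, Derivation.leibniz, LD_invert, LD_toLaurent, LD_jacobianLead_pow, eq_comm]
  simp only [smul_eq_mul]
  constructor
  · intro h2; rw [h2]; ring
  · intro h2; rw [h2]; ring

end Laurent

/-! ### The equation satisfied by the gluing function of a ribbon with a vector field -/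

section VectorField

variable {k : Type u} [Field k]

theorem coeff_T_mul (m n : ℤ) (p : k[T;T⁻¹]) : (T m * p).coeff n = p.coeff (n - m) := by
  induction p using LaurentPolynomial.induction_on' with
  | add p q hp hq => rw [mul_add]; simp only [AddMonoidAlgebra.coeff_add, Finsupp.add_apply, hp, hq]
  | C_mul_T l a =>
    rw [mul_left_comm, ← T_add, coeff_C_mul_T, coeff_C_mul_T]
    congr 1
    apply propext; constructor <;> intro h <;> omega

theorem coeff_toLaurent_nat (q : k[X]) (n : ℕ) : (toLaurent q).coeff (n : ℤ) = q.coeff n := by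
  induction q using Polynomial.induction_on' with
  | add p q hp hq =>
    rw [map_add]
    simp only [AddMonoidAlgebra.coeff_add, Finsupp.add_apply, hp, hq, Polynomial.coeff_add]
  | monomial m c =>
    rw [← C_mul_X_pow_eq_monomial, toLaurent_C_mul_X_pow, coeff_C_mul_T, coeff_C_mul_X_pow]
    congr 1
    apply propext; constructor <;> intro h <;> omega

theorem coeff_toLaurent_neg (q : k[X]) (n : ℤ) (hn : n < 0) : (toLaurent q).coeff n = 0 := by
  induction q using Polynomial.induction_on' with
  | add p q hp hq =>
    rw [map_add]
    simp only [AddMonoidAlgebra.coeff_add, Finsupp.add_apply, hp, hq, add_zero]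
  | monomial m c =>
    rw [← C_mul_X_pow_eq_monomial, toLaurent_C_mul_X_pow, coeff_C_mul_T, if_neg (by omega)]

/-- The polynomial `f₁ X^{g-3} + ⋯ + f_{g-2}`. -/
def tailPoly (g : ℕ) (f : Fin (g - 2) → k) : k[X] :=
  ∑ i : Fin (g - 2), Polynomial.C (f i) * X ^ (g - 2 - 1 - (i : ℕ))

theorem tail_eq (g : ℕ) (f : Fin (g - 2) → k) :
    tail g f = T (-((g - 2 : ℕ) : ℤ)) * toLaurent (tailPoly g f) := by
  rw [tail, tailPoly, map_sum, Finset.mul_sum]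
  refine Finset.sum_congr rfl fun i _ => ?_
  rw [toLaurent_C_mul_X_pow, mul_left_comm, ← T_add]
  congr 2
  have := i.2
  omega

theorem tailPoly_degree (g : ℕ) (f : Fin (g - 2) → k) :
    (tailPoly g f).degree < ((g - 2 : ℕ) : WithBot ℕ) := by
  rw [tailPoly]
  refine (Polynomial.degree_sum_le _ _).trans_lt ?_
  rw [Finset.sup_lt_iff (by exact WithBot.bot_lt_coe _)]
  intro i _
  refine (degree_C_mul_X_pow_le _ _).trans_lt ?_
  have := i.2
  exact_mod_cast (by omega : g - 2 - 1 - (i : ℕ) < g - 2)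

theorem tailPoly_coeff (g : ℕ) (f : Fin (g - 2) → k) (i : Fin (g - 2)) :
    (tailPoly g f).coeff (g - 2 - 1 - i) = f i := by
  rw [tailPoly, finsetSum_coeff, Finset.sum_eq_single i]
  · simp
  · intro j _ hj
    rw [coeff_C_mul_X_pow, if_neg]
    intro h
    apply hj
    ext
    have := i.2
    have := j.2
    omega
  · simp

theorem tailPoly_eq_zero_iff (g : ℕ) (f : Fin (g - 2) → k) : tailPoly g f = 0 ↔ f = 0 := by
  constructor
  · intro h
    ext i
    rw [← tailPoly_coeff g f i, h]; simp
  · rintro rfl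
    simp [tailPoly]

/-- The vector field `α ∂_y` on the projective line lifts to the ribbon with gluing function
`y^{-n} F(y)`. -/
def IsInvariant (n : ℕ) (F α : k[X]) (γ₀ : k) : Prop :=
  ∀ e < n, (X * F * derivative α - (X * derivative F - (n : k[X]) * F) * α -
    (Polynomial.C γ₀ + Polynomial.C ((n + 3) * α.coeff 2) * X) * X * F).coeff (e + 1) = 0

theorem derivation_inl (D : Derivation k (OverlapRing k) (OverlapRing k)) (q : k[T;T⁻¹]) :
    D (TrivSqZeroExt.inl q) = TrivSqZeroExt.inl (LD q) * D (TrivSqZeroExt.inl (T 1)) := by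
  let i : k[T;T⁻¹] →ₐ[k] OverlapRing k := TrivSqZeroExt.inlAlgHom k _ _
  change D (i q) = i (LD q) * D (i (T 1))
  have hpow : ∀ n : ℕ, D (i (T n)) = i (LD (T n)) * D (i (T 1)) := by
    intro n
    rw [LD_T]
    have h1 : (T n : k[T;T⁻¹]) = T 1 ^ n := by rw [T_pow]; simp
    rw [h1, map_pow, Derivation.leibniz_pow]
    rcases n with _ | n
    · simp
    · rw [show ((n + 1 : ℕ) : ℤ) - 1 = n by push_cast; ring, Nat.add_sub_cancel]
      have h2 : (T n : k[T;T⁻¹]) = T 1 ^ n := by rw [T_pow]; simp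
      rw [h2, map_mul, map_pow, smul_eq_mul, nsmul_eq_mul, Int.cast_natCast, map_natCast,
        map_natCast, mul_assoc]
  have hinv : ∀ n : ℕ, D (i (T (-n))) = i (LD (T (-n))) * D (i (T 1)) := by
    intro n
    have h1 : (T (-n) * T n : k[T;T⁻¹]) = 1 := by rw [← T_add]; simp
    have h2 : i (T (-n)) * i (T n) = 1 := by rw [← map_mul, h1, map_one]
    rw [Derivation.leibniz_of_mul_eq_one D h2, Derivation.leibniz_of_mul_eq_one LD h1, hpow]
    simp only [smul_eq_mul, map_mul, map_neg, map_pow]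
    ring
  induction q using LaurentPolynomial.induction_on' with
  | add p q hp hq => simp only [map_add, hp, hq, add_mul]
  | C_mul_T m a =>
    have h : (LaurentPolynomial.C a * T m : k[T;T⁻¹]) = a • T m := by
      rw [LaurentPolynomial.smul_eq_C_mul]
    rw [h, map_smul i, Derivation.map_smul, Derivation.map_smul, map_smul i, smul_mul_assoc]
    congr 1
    obtain ⟨n, rfl | rfl⟩ := m.eq_nat_or_neg
    · exact hpow n
    · exact hinv n

/-- From `η² = 0` follows `2 η D(η) = 0`, so `D(η)` is a multiple of `η`. -/
theorem derivation_inr_one_fst [CharZero k] {S : Type u} [CommRing S] [Algebra k S]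
    (D : Derivation k S[ε] S[ε]) : (D (TrivSqZeroExt.inr 1)).fst = 0 := by
  have h : (TrivSqZeroExt.inr 1 : S[ε]) * TrivSqZeroExt.inr 1 = 0 :=
    TrivSqZeroExt.inr_mul_inr _ _ _
  have h1 := congrArg D h
  rw [Derivation.leibniz, map_zero] at h1
  have h2 := congrArg TrivSqZeroExt.snd h1
  simp only [smul_eq_mul, TrivSqZeroExt.snd_add, TrivSqZeroExt.snd_mul, TrivSqZeroExt.fst_inr,
    TrivSqZeroExt.snd_inr, op_smul_eq_smul, TrivSqZeroExt.snd_zero,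
    mul_one] at h2
  have h3 : (2 : k) • (D (TrivSqZeroExt.inr 1)).fst = 0 := by
    rw [two_smul]; simpa using h2
  exact (smul_eq_zero_iff_right two_ne_zero).mp h3

theorem derivation_overlap [CharZero k] (D : Derivation k (OverlapRing k) (OverlapRing k))
    (s : OverlapRing k) :
    D s = TrivSqZeroExt.inl ((D (TrivSqZeroExt.inl (T 1))).fst * LD s.fst) +
      TrivSqZeroExt.inr ((D (TrivSqZeroExt.inl (T 1))).snd * LD s.fst +
        (D (TrivSqZeroExt.inr 1)).snd * s.snd + (D (TrivSqZeroExt.inl (T 1))).fst * LD s.snd) := by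
  have h : s = TrivSqZeroExt.inl s.fst + TrivSqZeroExt.inl s.snd * TrivSqZeroExt.inr 1 := by
    apply TrivSqZeroExt.ext <;> simp
  have h0 := derivation_inr_one_fst D
  conv_lhs => rw [h]
  rw [map_add, Derivation.leibniz, derivation_inl D s.fst, derivation_inl D s.snd]
  generalize D (TrivSqZeroExt.inr 1) = x at *
  apply TrivSqZeroExt.ext
  · simp [h0, mul_comm]
  · simp [mul_comm]; ring

theorem derivation_chart_eq_zero (D : Derivation k (ChartRing k) (ChartRing k))
    (h1 : D (TrivSqZeroExt.inl X) = 0) (h2 : D (TrivSqZeroExt.inr 1) = 0) : D = 0 := by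
  have h3 : ∀ q : k[X], D (TrivSqZeroExt.inl q) = 0 := by
    intro q
    let i : k[X] →ₐ[k] ChartRing k := TrivSqZeroExt.inlAlgHom k _ _
    change D (i q) = 0
    have h1' : D (i X) = 0 := h1
    induction q using Polynomial.induction_on' with
    | add p q hp hq => rw [map_add, map_add, hp, hq, add_zero]
    | monomial n c =>
      rw [← C_mul_X_pow_eq_monomial, ← Polynomial.smul_eq_C_mul, map_smul i, Derivation.map_smul,
        map_pow,
        Derivation.leibniz_pow, h1', smul_zero, smul_zero, smul_zero]
  ext s
  · have h : s = TrivSqZeroExt.inl s.fst + TrivSqZeroExt.inl s.snd * TrivSqZeroExt.inr 1 := by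
      apply TrivSqZeroExt.ext <;> simp
    rw [h, map_add, Derivation.leibniz, h3, h3, h2]; simp
  · have h : s = TrivSqZeroExt.inl s.fst + TrivSqZeroExt.inl s.snd * TrivSqZeroExt.inr 1 := by
      apply TrivSqZeroExt.ext <;> simp
    rw [h, map_add, Derivation.leibniz, h3, h3, h2]; simp

/-- The vector field of a ribbon, written in the two charts. -/
theorem exists_vectorField_eqs [CharZero k] (g : ℕ) (f : Fin (g - 2) → k)
    (D₁ D₂ : Derivation k (ChartRing k) (ChartRing k))
    (D : Derivation k (OverlapRing k) (OverlapRing k))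
    (h1 : ∀ a, D (resOne g f a) = resOne g f (D₁ a)) (h2 : ∀ a, D (resTwo k a) = resTwo k (D₂ a)) :
    ∃ α β γ a b c : k[X], D₂ (TrivSqZeroExt.inl X) = TrivSqZeroExt.inl α + TrivSqZeroExt.inr β ∧
      D₂ (TrivSqZeroExt.inr 1) = TrivSqZeroExt.inr γ ∧
      D₁ (TrivSqZeroExt.inl X) = TrivSqZeroExt.inl a + TrivSqZeroExt.inr b ∧
      D₁ (TrivSqZeroExt.inr 1) = TrivSqZeroExt.inr c ∧
      -(T (-2) * toLaurent α) = invert (toLaurent a) ∧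
      toLaurent γ - ((g : k[T;T⁻¹]) + 1) * T (-1) * toLaurent α = invert (toLaurent c) ∧
      tail g f * LD (toLaurent α) - LD (tail g f) * toLaurent α - toLaurent γ * tail g f =
        toLaurent β + invert (toLaurent b) * T (1 - (g : ℤ)) := by
  have e1 := derivation_inr_one_fst D₁
  have e2 := derivation_inr_one_fst D₂
  have y1 : resTwo k (TrivSqZeroExt.inl X) = TrivSqZeroExt.inl (T 1) := by
    rw [resTwo_apply, TrivSqZeroExt.fst_inl, TrivSqZeroExt.snd_inl, toLaurent_X, map_zero,
      TrivSqZeroExt.inr_zero, add_zero]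
  have y2 : resTwo k (TrivSqZeroExt.inr 1) = TrivSqZeroExt.inr 1 := by
    rw [resTwo_apply, TrivSqZeroExt.fst_inr, TrivSqZeroExt.snd_inr, map_zero, map_one,
      TrivSqZeroExt.inl_zero, zero_add]
  have x1 : resOne g f (TrivSqZeroExt.inl X) =
      TrivSqZeroExt.inl (T (-1)) + TrivSqZeroExt.inr (-(T (-2) * tail g f)) := by
    rw [resOne_apply, TrivSqZeroExt.fst_inl, TrivSqZeroExt.snd_inl, toLaurent_X, map_zero,
      map_zero, derivative_X, map_one, map_one, invert_T, zero_mul, zero_sub, one_mul]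
  have x2 : resOne g f (TrivSqZeroExt.inr 1) = TrivSqZeroExt.inr (T (-(g : ℤ) - 1)) := by
    rw [resOne_apply, TrivSqZeroExt.fst_inr, TrivSqZeroExt.snd_inr, derivative_zero, map_zero,
      map_zero, map_one, map_one, TrivSqZeroExt.inl_zero, zero_add, one_mul, zero_mul, sub_zero]
  have hy1 := h2 (TrivSqZeroExt.inl X)
  have hy2 := h2 (TrivSqZeroExt.inr 1)
  have hx1 := h1 (TrivSqZeroExt.inl X)
  have hx2 := h1 (TrivSqZeroExt.inr 1)
  rw [y1, resTwo_apply] at hy1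
  rw [y2, resTwo_apply] at hy2
  rw [x1, derivation_overlap, hy1, hy2, resOne_apply] at hx1
  rw [x2, derivation_overlap, hy1, hy2, resOne_apply] at hx2
  have hx1f := congrArg TrivSqZeroExt.fst hx1
  have hx1s := congrArg TrivSqZeroExt.snd hx1
  have hx2s := congrArg TrivSqZeroExt.snd hx2
  rw [e1] at hx2s
  refine ⟨(D₂ (TrivSqZeroExt.inl X)).fst, (D₂ (TrivSqZeroExt.inl X)).snd,
    (D₂ (TrivSqZeroExt.inr 1)).snd, (D₁ (TrivSqZeroExt.inl X)).fst,
    (D₁ (TrivSqZeroExt.inl X)).snd, (D₁ (TrivSqZeroExt.inr 1)).snd,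
    (TrivSqZeroExt.inl_fst_add_inr_snd_eq _).symm, ?_,
    (TrivSqZeroExt.inl_fst_add_inr_snd_eq _).symm, ?_, ?_⟩
  · exact TrivSqZeroExt.ext (by rw [e2, TrivSqZeroExt.fst_inr]) (by rw [TrivSqZeroExt.snd_inr])
  · exact TrivSqZeroExt.ext (by rw [e1, TrivSqZeroExt.fst_inr]) (by rw [TrivSqZeroExt.snd_inr])
  generalize (D₂ (TrivSqZeroExt.inl X)).fst = α at *
  generalize (D₂ (TrivSqZeroExt.inl X)).snd = β at *
  generalize (D₂ (TrivSqZeroExt.inr 1)).snd = γ at *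
  generalize (D₁ (TrivSqZeroExt.inl X)).fst = a at *
  generalize (D₁ (TrivSqZeroExt.inl X)).snd = b at *
  generalize (D₁ (TrivSqZeroExt.inr 1)).snd = c at *
  simp only [TrivSqZeroExt.fst_add, TrivSqZeroExt.snd_add, TrivSqZeroExt.fst_inl,
    TrivSqZeroExt.snd_inl, TrivSqZeroExt.fst_inr, TrivSqZeroExt.snd_inr, add_zero, zero_add,
    map_zero, zero_mul, mul_zero, sub_zero, LD_T, map_neg, Derivation.leibniz,
    smul_eq_mul] at hx1f hx1s hx2s
  have t1 : (T (-1 - 1) : k[T;T⁻¹]) = T (-1) ^ 2 := by rw [T_pow]; rfl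
  have t2 : (T (-2) : k[T;T⁻¹]) = T (-1) ^ 2 := by rw [T_pow]; rfl
  have t3 : (T (-2 - 1) : k[T;T⁻¹]) = T (-1) ^ 3 := by rw [T_pow]; rfl
  have t4 : (T (-(g : ℤ) - 1 - 1) : k[T;T⁻¹]) = T (-(g : ℤ) - 1) * T (-1) := by
    rw [← T_add]; rfl
  have t5 : (T (1 - (g : ℤ)) : k[T;T⁻¹]) = T (-(g : ℤ) - 1) * T 1 ^ 2 := by
    rw [T_pow, ← T_add]; congr 1; ring
  have m1 : (T 1 * T (-1) : k[T;T⁻¹]) = 1 := by rw [← T_add]; simp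
  have m2 : (T (-(g : ℤ) - 1) * T ((g : ℤ) + 1) : k[T;T⁻¹]) = 1 := by
    rw [← T_add]; ring_nf; simp
  rw [t1] at hx1f hx1s
  rw [t2, t3] at hx1s
  rw [t4] at hx2s
  push_cast at hx1f hx1s hx2s
  simp only [map_neg, map_one, map_sub, map_natCast, map_ofNat] at hx1f hx1s hx2s
  have ha : -(T (-1) ^ 2 * toLaurent α) = invert (toLaurent a) := by
    rw [← hx1f]; ring
  -- The `η`-part of the equation for `x` contains `a'(y⁻¹)`, through the gluing of `D₁ x`.
  -- Differentiating the relation between `a` and `α` eliminates it.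
  have ha' := congrArg LD ha
  rw [LD_invert, LD_toLaurent a, map_neg, Derivation.leibniz, ← t2, LD_T, t2, t3, smul_eq_mul,
    smul_eq_mul] at ha'
  push_cast at ha'
  simp only [map_neg, map_ofNat] at ha'
  refine ⟨by rw [t2]; exact ha, ?_, ?_⟩
  · linear_combination (T ((g : ℤ) + 1)) * hx2s - (toLaurent γ - invert (toLaurent c) -
      ((g : k[T;T⁻¹]) + 1) * T (-1) * toLaurent α) * m2
  · rw [t5]
    linear_combination (T 1 ^ 2) * hx1s - tail g f * T 1 ^ 2 * ha' - (T 1 * T (-1) + 1) *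
      (tail g f * LD (toLaurent α) - tail g f * toLaurent γ - LD (tail g f) * toLaurent α -
        toLaurent β) * m1

end VectorField

section Equations

variable {k : Type u} [Field k]

theorem eq_zero_of_invert_toLaurent (q : k[X]) (h : invert (toLaurent q) = 0) : q = 0 := by
  rw [map_eq_zero_iff _ (invert (R := k)).injective] at h
  exact toLaurent_injective (by rw [h, map_zero])

/-- Comparing powers of `y`: regularity of the field at infinity bounds `deg α` by `2` and makes `γ`
linear with top coefficient `(g + 1) α₂`. In the third equation the terms `β` and `b` come from
changes of coordinates in the two charts; after multiplication by `y^{n+1}`, `n = g - 2`, they miss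
the degrees `1, …, n`, and the vanishing there is `IsInvariant`. -/
theorem exists_isInvariant [CharZero k] (g : ℕ) (f : Fin (g - 2) → k) (hf : f ≠ 0)
    (D₁ D₂ : Derivation k (ChartRing k) (ChartRing k))
    (D : Derivation k (OverlapRing k) (OverlapRing k))
    (h1 : ∀ a, D (resOne g f a) = resOne g f (D₁ a)) (h2 : ∀ a, D (resTwo k a) = resTwo k (D₂ a))
    (h0 : ¬ (D₁ = 0 ∧ D₂ = 0)) :
    ∃ (α : k[X]) (γ₀ : k), α ≠ 0 ∧ α.natDegree ≤ 2 ∧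
      IsInvariant (g - 2) (tailPoly g f) α γ₀ := by
  obtain ⟨α, β, γ, a, b, c, hα, hγ, ha, hc, e1, e2, e3⟩ := exists_vectorField_eqs g f D₁ D₂ D h1 h2
  have hg : g = (g - 2) + 2 := by
    by_contra hg
    apply hf
    ext i
    have := i.2
    omega
  have hF0 : tailPoly g f ≠ 0 := fun h => hf ((tailPoly_eq_zero_iff g f).mp h)
  have hFd := tailPoly_degree g f
  have hft := tail_eq g f
  generalize tailPoly g f = F at *
  generalize tail g f = φ at *
  clear h1 h2 hf f
  generalize g - 2 = n at *
  subst hg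
  have hα2 : ∀ i, 3 ≤ i → α.coeff i = 0 := by
    intro i hi
    have h := congrArg (fun p : k[T;T⁻¹] => p.coeff ((i : ℤ) - 2)) e1
    simp only [AddMonoidAlgebra.coeff_neg, Finsupp.neg_apply, coeff_T_mul, invert_apply] at h
    rw [coeff_toLaurent_neg a _ (by omega), show (i : ℤ) - 2 - -2 = i by ring,
      coeff_toLaurent_nat, neg_eq_zero] at h
    exact h
  have hγi : ∀ i, 1 ≤ i → γ.coeff i = (n + 3) * α.coeff (i + 1) := by
    intro i hi
    have h := congrArg (fun p : k[T;T⁻¹] => p.coeff (i : ℤ)) e2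
    have h3 : (((n + 2 : ℕ) : k[T;T⁻¹]) + 1) * T (-1) * toLaurent α =
        ((n : k) + 3) • (T (-1) * toLaurent α) := by
      rw [LaurentPolynomial.smul_eq_C_mul]
      push_cast
      simp only [map_add, map_natCast, map_ofNat]
      ring
    rw [h3] at h
    simp only [AddMonoidAlgebra.coeff_sub, Finsupp.sub_apply, AddMonoidAlgebra.coeff_smul,
      Finsupp.smul_apply, coeff_T_mul, invert_apply, smul_eq_mul] at h
    rw [coeff_toLaurent_neg c _ (by omega), show (i : ℤ) - -1 = ((i + 1 : ℕ) : ℤ) by push_cast; ring,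
      coeff_toLaurent_nat, coeff_toLaurent_nat] at h
    exact sub_eq_zero.mp h
  have hγeq : γ = Polynomial.C (γ.coeff 0) + Polynomial.C ((n + 3) * α.coeff 2) * X := by
    ext i
    rcases i with _ | _ | i
    · simp
    · simp [hγi 1 le_rfl]
    · rw [hγi _ (by omega), hα2 _ (by omega)]
      simp
  have hQ : toLaurent (X * F * derivative α - (X * derivative F - (n : k[X]) * F) * α -
      γ * X * F) = T ((n : ℤ) + 1) * toLaurent β + invert (toLaurent b) := by
    simp only [map_sub, map_mul, toLaurent_X, map_natCast]
    rw [hft, Derivation.leibniz, LD_T, LD_toLaurent, LD_toLaurent] at e3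
    have t1 : (T (1 - ((n + 2 : ℕ) : ℤ)) : k[T;T⁻¹]) = T (-(n : ℤ)) * T (-1) := by
      rw [← T_add]; congr 1; push_cast; ring
    have t2 : (T (-(n : ℤ) - 1) : k[T;T⁻¹]) = T (-(n : ℤ)) * T (-1) := by
      rw [← T_add]; rfl
    have t3 : (T ((n : ℤ) + 1) : k[T;T⁻¹]) = T n * T 1 := T_add _ _
    have m1 : (T 1 * T (-1) : k[T;T⁻¹]) = 1 := by rw [← T_add]; simp
    have m2 : (T n * T (-(n : ℤ)) : k[T;T⁻¹]) = 1 := by rw [← T_add]; simp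
    rw [t1, t2] at e3
    rw [t3]
    push_cast at e3
    simp only [map_neg, map_natCast, smul_eq_mul] at e3
    generalize toLaurent F = F' at *
    generalize toLaurent (derivative F) = F'' at *
    generalize toLaurent α = α' at *
    generalize toLaurent (derivative α) = α'' at *
    generalize toLaurent β = β' at *
    generalize toLaurent γ = γ' at *
    generalize invert (toLaurent b) = b' at *
    linear_combination (T n * T 1) * e3 -
      (T 1 * F' * α'' - T 1 * F'' * α' - γ' * T 1 * F' + n * T (-1) * T 1 * F' * α' -
        b' * T (-1) * T 1) * m2 - (n * F' * α' - b') * m1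
  have hinv : IsInvariant n F α (γ.coeff 0) := by
    intro e he
    rw [← hγeq, ← coeff_toLaurent_nat, hQ]
    simp only [AddMonoidAlgebra.coeff_add, Finsupp.add_apply, coeff_T_mul, invert_apply]
    rw [coeff_toLaurent_neg β _ (by push_cast; omega), coeff_toLaurent_neg b _ (by push_cast; omega),
      add_zero]
  refine ⟨α, γ.coeff 0, ?_, ?_, hinv⟩
  -- A vertical field has `α = 0` and `γ = γ₀`, so the equation reads `γ₀ F = 0`. As `F ≠ 0`, `γ₀ =
  -- 0`; then `β`, `a`, `b` and `c` vanish by comparison of degrees, and so do both derivations.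
  · rintro rfl
    have hγ0 : γ.coeff 0 = 0 := by
      by_contra hne
      apply hF0
      ext e
      by_cases he : e < n
      · have := hinv e he
        simp only [map_zero, mul_zero, sub_zero, coeff_zero, zero_mul, add_zero, zero_sub,
          coeff_neg, neg_eq_zero, mul_assoc, coeff_C_mul, coeff_X_mul] at this
        simpa [hne] using this
      · rw [coeff_zero]
        exact coeff_eq_zero_of_degree_lt (hFd.trans_le (by exact_mod_cast not_lt.mp he))
    have hγ00 : γ = 0 := by rw [hγeq, hγ0]; simp
    rw [hγ00] at hQ e2 hγ
    simp only [map_zero, mul_zero, sub_zero, zero_mul] at hQ e1 e2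
    have hβ : β = 0 := by
      ext i
      have h := congrArg (fun p : k[T;T⁻¹] => p.coeff ((n : ℤ) + 1 + i)) hQ
      simp only [AddMonoidAlgebra.coeff_add, Finsupp.add_apply, coeff_T_mul, invert_apply] at h
      rw [coeff_toLaurent_neg b _ (by omega), show (n : ℤ) + 1 + i - (n + 1) = i by ring,
        coeff_toLaurent_nat, add_zero] at h
      exact h.symm
    rw [hβ, map_zero, mul_zero, zero_add] at hQ
    rw [neg_zero] at e1
    have ha0 := eq_zero_of_invert_toLaurent a e1.symm
    have hb0 := eq_zero_of_invert_toLaurent b hQ.symm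
    have hc0 := eq_zero_of_invert_toLaurent c e2.symm
    apply h0
    constructor
    · apply derivation_chart_eq_zero
      · rw [ha, ha0, hb0]; simp
      · rw [hc, hc0]; simp
    · apply derivation_chart_eq_zero
      · rw [hα, hβ]; simp
      · rw [hγ]; simp
  · rw [natDegree_le_iff_coeff_eq_zero]
    intro i hi
    exact hα2 i hi

end Equations

/-! ### A criterion for instability -/

section Criterion

variable {k : Type u} [Field k]

/-- A destabilizing symmetry of the graded piece `Sₘ` of the algebra generated by a linear system
`S₁`: compatible endomorphisms of `S₁` and of `Sₘ = S₁^m`, the first of determinant `1`, the second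
with a determinant which is not a root of unity. -/
def IsDestabilized {B : Type u} [CommRing B] [Algebra k B] (m : ℕ) (S₁ Sₘ : Submodule k B) :
    Prop :=
  Module.Finite k Sₘ ∧ S₁ ^ m = Sₘ ∧ ∃ (Θ₁ : S₁ →ₗ[k] S₁) (Θₘ : Sₘ →ₗ[k] Sₘ),
    LinearMap.det Θ₁ = 1 ∧ (∀ d, 0 < d → LinearMap.det Θₘ ^ d ≠ 1) ∧
    ∀ (v : Fin m → S₁) (s : Sₘ), (s : B) = ∏ i, (v i : B) → (Θₘ s : B) = ∏ i, (Θ₁ (v i) : B)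

theorem prod_mem_submodule_pow {B : Type u} [CommRing B] [Algebra k B] (S : Submodule k B) {m : ℕ}
    (v : Fin m → S) : ∏ i, (v i : B) ∈ S ^ m := by
  rw [← List.prod_ofFn]
  exact Submodule.pow_subset_pow S (Set.mem_pow.mpr ⟨v, rfl⟩)

/-- Conjugation by the isomorphisms onto the images preserves determinants. The inclusion `S₁ ^ m ≤
Sₘ` places the products where `φ` is injective, so that multiplicative relations can be pulled back.
-/
theorem isDestabilized_map_iff {B B' : Type u} [CommRing B] [Algebra k B] [CommRing B']
    [Algebra k B'] (φ : B →ₐ[k] B') (m : ℕ) (S₁ Sₘ : Submodule k B)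
    (h₁ : Set.InjOn φ S₁) (hₘ : Set.InjOn φ Sₘ) (hle : S₁ ^ m ≤ Sₘ) :
    IsDestabilized m S₁ Sₘ ↔
      IsDestabilized m (S₁.map φ.toLinearMap) (Sₘ.map φ.toLinearMap) := by
  have key : ∀ S : Submodule k B, Set.InjOn φ S →
      ∃ e : S ≃ₗ[k] S.map φ.toLinearMap, ∀ x, (e x : B') = φ x := by
    intro S hS
    refine ⟨LinearEquiv.ofBijective (φ.toLinearMap.restrict (p := S) (q := S.map φ.toLinearMap)
      fun x hx => ⟨x, hx, rfl⟩) ⟨?_, ?_⟩, fun x => rfl⟩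
    · intro x y hxy
      exact Subtype.ext (hS x.2 y.2 (congrArg Subtype.val hxy))
    · rintro ⟨_, x, hx, rfl⟩
      exact ⟨⟨x, hx⟩, rfl⟩
  obtain ⟨e₁, he₁⟩ := key S₁ h₁
  obtain ⟨eₘ, heₘ⟩ := key Sₘ hₘ
  have hprod : ∀ v : Fin m → S₁, ∏ i, (v i : B) ∈ Sₘ := fun v =>
    hle (prod_mem_submodule_pow S₁ v)
  constructor
  · rintro ⟨hf, hpow, Θ₁, Θₘ, h1, h2, h3⟩
    refine ⟨Module.Finite.equiv eₘ, ?_, e₁.conj Θ₁, eₘ.conj Θₘ, ?_, ?_, ?_⟩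
    · rw [← hpow, Submodule.map_pow]
    · rw [LinearEquiv.conj_apply]; rw [LinearMap.comp_assoc, LinearMap.det_conj, h1]
    · intro d hd
      rw [LinearEquiv.conj_apply, LinearMap.comp_assoc, LinearMap.det_conj]
      exact h2 d hd
    · intro v s hs
      have := h3 (fun i => e₁.symm (v i)) (eₘ.symm s) (by
        apply hₘ (eₘ.symm s).2 (hprod _)
        rw [← heₘ, LinearEquiv.apply_symm_apply, hs, map_prod]
        refine Finset.prod_congr rfl fun i _ => ?_
        rw [← he₁, LinearEquiv.apply_symm_apply])
      rw [LinearEquiv.conj_apply_apply, heₘ, this, map_prod]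
      refine Finset.prod_congr rfl fun i _ => ?_
      rw [LinearEquiv.conj_apply_apply, he₁]
  · rintro ⟨hf, hpow, Θ₁, Θₘ, h1, h2, h3⟩
    refine ⟨Module.Finite.equiv eₘ.symm, ?_, e₁.symm.conj Θ₁, eₘ.symm.conj Θₘ, ?_, ?_, ?_⟩
    · refine le_antisymm hle fun x hx => ?_
      have : φ x ∈ (S₁ ^ m).map φ.toLinearMap := by
        rw [Submodule.map_pow, hpow]; exact ⟨x, hx, rfl⟩
      obtain ⟨y, hy, hxy⟩ := this
      rwa [← hₘ (hle hy) hx hxy]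
    · rw [LinearEquiv.conj_apply]; rw [LinearMap.comp_assoc, LinearMap.det_conj, h1]
    · intro d hd
      rw [LinearEquiv.conj_apply, LinearMap.comp_assoc, LinearMap.det_conj]
      exact h2 d hd
    · intro v s hs
      have := h3 (fun i => e₁ (v i)) (eₘ s) (by
        rw [heₘ, hs, map_prod]
        exact Finset.prod_congr rfl fun i _ => (he₁ _).symm)
      apply hₘ (Subtype.coe_prop _) (hprod _)
      rw [LinearEquiv.conj_apply_apply, ← heₘ, LinearEquiv.apply_symm_apply,
        LinearEquiv.symm_symm, this, map_prod]
      refine Finset.prod_congr rfl fun i _ => ?_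
      rw [LinearEquiv.conj_apply_apply, ← he₁, LinearEquiv.apply_symm_apply, LinearEquiv.symm_symm]

theorem eval_smul_of_isHomogeneous {σ : Type*} {P : MvPolynomial σ k} {d : ℕ}
    (hP : P.IsHomogeneous d) (c : k) (x : σ → k) :
    MvPolynomial.eval (fun i => c * x i) P = c ^ d * MvPolynomial.eval x P := by
  rw [MvPolynomial.eval_eq, MvPolynomial.eval_eq, Finset.mul_sum]
  refine Finset.sum_congr rfl fun e he => ?_
  have hd : e.degree = d := by
    have := hP (MvPolynomial.mem_support_iff.mp he)
    rwa [Finsupp.degree_eq_weight_one]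
  rw [← hd, Finsupp.degree_apply, ← Finset.prod_pow_eq_pow_sum]
  simp only [mul_pow, Finset.prod_mul_distrib]
  ring

theorem restriction_surjective (g : ℕ) (f : Fin (g - 2) → k) (m : ℕ)
    (b : Module.Basis (Fin g) k (canonicalSections g f 1))
    (h : canonicalSections g f 1 ^ m = canonicalSections g f m) :
    Function.Surjective (restriction g f m b) := by
  have hspan : canonicalSections g f 1 =
      Submodule.span k (Set.range fun i => (b i : ChartRing k × ChartRing k)) := by
    have := congrArg (Submodule.map (canonicalSections g f 1).subtype) b.span_eq
    rw [Submodule.map_span, ← Set.range_comp, Submodule.map_top, Submodule.range_subtype] at this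
    exact this.symm
  intro s
  have hs : (s : ChartRing k × ChartRing k) ∈ canonicalSections g f 1 ^ m := by rw [h]; exact s.2
  rw [hspan, Submodule.span_pow] at hs
  have hr : (s : ChartRing k × ChartRing k) ∈ (MvPolynomial.homogeneousSubmodule (Fin g) k m).map
      (MvPolynomial.aeval fun i => (b i : ChartRing k × ChartRing k)).toLinearMap := by
    refine Submodule.span_le.mpr ?_ hs
    intro x hx
    obtain ⟨w, rfl⟩ := Set.mem_pow.mp hx
    choose j hj using fun i => (w i).2
    refine ⟨∏ i : Fin m, MvPolynomial.X (j i), ?_, ?_⟩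
    · have := MvPolynomial.IsHomogeneous.prod (Finset.univ : Finset (Fin m))
        (fun i => (MvPolynomial.X (j i) : MvPolynomial (Fin g) k)) (fun _ => 1)
        fun i _ => MvPolynomial.isHomogeneous_X k _
      simpa using this
    · rw [AlgHom.toLinearMap_apply, map_prod, List.prod_ofFn]
      refine Finset.prod_congr rfl fun i _ => ?_
      rw [MvPolynomial.aeval_X]
      exact hj i
  obtain ⟨F, hF, hFs⟩ := hr
  exact ⟨⟨F, hF⟩, Subtype.ext hFs⟩

/-- The matrix of `Θ₁` is an element of `SL_g` under which the Hilbert point is an eigenvector with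
eigenvalue `det Θₘ`. An invariant of degree `d` that did not vanish there would force `det Θₘ ^ d =
1`. -/
theorem IsDestabilized.isHilbertUnstableAt {g : ℕ} {f : Fin (g - 2) → k} {m : ℕ}
    (h : IsDestabilized m (canonicalSections g f 1) (canonicalSections g f m))
    (b : Module.Basis (Fin g) k (canonicalSections g f 1)) :
    IsHilbertUnstableAt g f b m := by
  obtain ⟨hfin, hpow, Θ₁, Θₘ, h1, h2, h3⟩ := h
  refine ⟨restriction_surjective g f m b hpow, Module.finrank k _, Module.finBasis k _, ?_⟩
  set e := Module.finBasis k (canonicalSections g f m)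
  intro d hd P hP hinv
  let A : Matrix.SpecialLinearGroup (Fin g) k :=
    ⟨LinearMap.toMatrix b b Θ₁, by rw [LinearMap.det_toMatrix, h1]⟩
  have hA : ∀ j, (Θ₁ (b j) : ChartRing k × ChartRing k) =
      ∑ i, A.1 i j • (b i : ChartRing k × ChartRing k) := by
    intro j
    have := congrArg Subtype.val (b.sum_repr (Θ₁ (b j)))
    rw [← this, Submodule.coe_sum]
    simp only [A, LinearMap.toMatrix_apply, Submodule.coe_smul]
  -- the restriction map is equivariant
  have heq : ∀ F : Forms k g m, restriction g f m b (subst m A F) = Θₘ (restriction g f m b F) := by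
    have hmon : ∀ w : Fin m → Fin g, ∀ hw,
        restriction g f m b (subst m A ⟨∏ i, MvPolynomial.X (w i), hw⟩) =
        Θₘ (restriction g f m b ⟨∏ i, MvPolynomial.X (w i), hw⟩) := by
      intro w hw
      apply Subtype.ext
      rw [h3 (fun i => b (w i))]
      · change MvPolynomial.aeval (fun i => (b i : ChartRing k × ChartRing k))
          (MvPolynomial.aeval (fun j => ∑ i, MvPolynomial.C (A.1 i j) *
            (MvPolynomial.X i : MvPolynomial (Fin g) k)) (∏ i, MvPolynomial.X (w i))) = _
        rw [map_prod, map_prod]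
        refine Finset.prod_congr rfl fun i _ => ?_
        rw [MvPolynomial.aeval_X, map_sum, hA]
        refine Finset.sum_congr rfl fun j _ => ?_
        rw [map_mul, MvPolynomial.aeval_X, MvPolynomial.aeval_C, Algebra.smul_def]
      · change MvPolynomial.aeval (fun i => (b i : ChartRing k × ChartRing k))
          (∏ i, MvPolynomial.X (w i)) = _
        rw [map_prod]
        exact Finset.prod_congr rfl fun i _ => MvPolynomial.aeval_X _ _
    have hlin : ∀ F (hF : F ∈ MvPolynomial.homogeneousSubmodule (Fin g) k m),
        restriction g f m b (subst m A ⟨F, hF⟩) = Θₘ (restriction g f m b ⟨F, hF⟩) := by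
      -- Equivariance is linear in `F`, and products of `m` variables span the forms of degree `m`.
      let W := (LinearMap.eqLocus ((restriction g f m b).comp (subst m A))
        (Θₘ.comp (restriction g f m b))).map (MvPolynomial.homogeneousSubmodule (Fin g) k m).subtype
      have hW : MvPolynomial.homogeneousSubmodule (Fin g) k m ≤ W := by
        rw [← MvPolynomial.homogeneousSubmodule_one_pow, MvPolynomial.homogeneousSubmodule_one_eq_span_X,
          Submodule.span_pow, Submodule.span_le]
        intro x hx
        obtain ⟨w, rfl⟩ := Set.mem_pow.mp hx
        choose j hj using fun i => (w i).2
        have hh : ∏ i : Fin m, (MvPolynomial.X (j i) : MvPolynomial (Fin g) k) ∈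
            MvPolynomial.homogeneousSubmodule (Fin g) k m := by
          have := MvPolynomial.IsHomogeneous.prod (Finset.univ : Finset (Fin m))
            (fun i => (MvPolynomial.X (j i) : MvPolynomial (Fin g) k)) (fun _ => 1)
            fun i _ => MvPolynomial.isHomogeneous_X k _
          simpa using this
        refine ⟨⟨_, hh⟩, hmon j hh, ?_⟩
        rw [List.prod_ofFn]
        change ∏ i, MvPolynomial.X (j i) = _
        exact Finset.prod_congr rfl fun i _ => hj i
      intro F hF
      obtain ⟨F', hF', rfl⟩ := hW hF
      exact hF'
    exact fun F => hlin F.1 F.2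
  have hact : (e.det.compLinearMap (restriction g f m b)).compLinearMap (subst m A) =
      LinearMap.det Θₘ • e.det.compLinearMap (restriction g f m b) := by
    ext v
    have : (fun i => restriction g f m b (subst m A (v i))) =
      Θₘ ∘ fun i => restriction g f m b (v i) := funext fun i => heq (v i)
    simp only [AlternatingMap.compLinearMap_apply, AlternatingMap.smul_apply, smul_eq_mul]
    exact (congrArg e.det this).trans (e.det_comp Θₘ _)
  have hP1 := hinv A (e.det.compLinearMap (restriction g f m b))
  beta_reduce at hP1
  rw [hact] at hP1
  simp only [map_smul, smul_eq_mul] at hP1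
  rw [eval_smul_of_isHomogeneous hP] at hP1
  by_contra hne
  exact h2 d hd (mul_right_cancel₀ hne (by rw [hP1, one_mul]))

end Criterion

/-! ### Sections of powers of the canonical bundle in one chart -/

section Bracket

variable {k : Type u} [Field k]

/-- The numerator, over `K²`, of `(H / K) p' + c (H / K)' p`. -/
def bracket (c : k) (H K p : k[X]) : k[X] :=
  H * K * derivative p + Polynomial.C c * (derivative H * K - H * derivative K) * p

theorem coeff_X_mul_derivative (p : k[X]) (d : ℕ) :
    (X * derivative p).coeff d = (d : k) * p.coeff d := by
  rcases d with _ | d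
  · simp
  · rw [coeff_X_mul, coeff_derivative]; push_cast; ring

theorem natDegree_X_mul_derivative_le {p : k[X]} {d : ℕ} (hp : p.natDegree ≤ d) :
    (X * derivative p).natDegree ≤ d := by
  rw [natDegree_le_iff_coeff_eq_zero]
  intro N hN
  rw [coeff_X_mul_derivative, coeff_eq_zero_of_natDegree_lt (hp.trans_lt hN), mul_zero]

theorem X_mul_bracket (c : k) (H K p : k[X]) :
    X * bracket c H K p = H * K * (X * derivative p) +
      Polynomial.C c * ((X * derivative H) * K * p - H * (X * derivative K) * p) := by
  rw [bracket]; ring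

theorem natDegree_X_mul_bracket_le (c : k) {H K p : k[X]} {a b d : ℕ} (hH : H.natDegree ≤ a)
    (hK : K.natDegree ≤ b) (hp : p.natDegree ≤ d) :
    (X * bracket c H K p).natDegree ≤ a + b + d := by
  have hH' := natDegree_X_mul_derivative_le hH
  have hK' := natDegree_X_mul_derivative_le hK
  have hp' := natDegree_X_mul_derivative_le hp
  rw [X_mul_bracket]
  have := natDegree_mul_le_of_le (natDegree_mul_le_of_le hH hK) hp'
  have := natDegree_mul_le_of_le (natDegree_mul_le_of_le hH' hK) hp
  have := natDegree_mul_le_of_le (natDegree_mul_le_of_le hH hK') hp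
  refine natDegree_add_le_of_degree_le (by assumption) ((natDegree_C_mul_le _ _).trans ?_)
  exact (natDegree_sub_le_of_le (by assumption) (by assumption)).trans_eq (max_self _)

/-- The Euler operator `X d/dX` multiplies leading terms by their degrees. The factor `d + c (a -
b)` vanishes in exactly the situations that make the later constructions independent of coordinates.
-/
theorem coeff_X_mul_bracket (c : k) {H K p : k[X]} {a b d : ℕ} (hH : H.natDegree ≤ a)
    (hK : K.natDegree ≤ b) (hp : p.natDegree ≤ d) :
    (X * bracket c H K p).coeff (a + b + d) =
      H.coeff a * K.coeff b * p.coeff d * (d + c * (a - b)) := by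
  have hH' := natDegree_X_mul_derivative_le hH
  have hK' := natDegree_X_mul_derivative_le hK
  have hp' := natDegree_X_mul_derivative_le hp
  rw [X_mul_bracket, Polynomial.coeff_add, coeff_C_mul, Polynomial.coeff_sub,
    coeff_mul_add_eq_of_natDegree_le (natDegree_mul_le_of_le hH hK) hp',
    coeff_mul_add_eq_of_natDegree_le (natDegree_mul_le_of_le hH' hK) hp,
    coeff_mul_add_eq_of_natDegree_le (natDegree_mul_le_of_le hH hK') hp,
    coeff_mul_add_eq_of_natDegree_le hH hK, coeff_mul_add_eq_of_natDegree_le hH' hK,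
    coeff_mul_add_eq_of_natDegree_le hH hK', coeff_X_mul_derivative, coeff_X_mul_derivative,
    coeff_X_mul_derivative]
  ring

theorem degree_lt_of_natDegree_le {P : k[X]} {N : ℕ} (h : P.natDegree ≤ N) (hc : P.coeff N = 0) :
    P.degree < N := by
  rw [degree_lt_iff_coeff_zero]
  intro m hm
  rcases hm.eq_or_lt with rfl | hm
  · exact hc
  · exact coeff_eq_zero_of_natDegree_lt (h.trans_lt hm)

theorem degree_mul_lt_of_natDegree_le {p q : k[X]} {a b : ℕ} (hp : p.natDegree ≤ a)
    (hq : q.degree < b) : (p * q).degree < ((a + b : ℕ) : WithBot ℕ) := by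
  rcases eq_or_ne (p * q) 0 with h0 | h0
  · rw [h0, Polynomial.degree_zero]
    exact WithBot.bot_lt_coe _
  · have hq0 : q ≠ 0 := right_ne_zero_of_mul h0
    rw [← natDegree_lt_iff_degree_lt hq0] at hq
    rw [← natDegree_lt_iff_degree_lt h0, natDegree_mul (left_ne_zero_of_mul h0) hq0]
    omega

theorem degree_mul_monic_lt_iff {P G : k[X]} (hG : G.Monic) (N : ℕ) :
    (P * G).degree < ((N + G.natDegree : ℕ) : WithBot ℕ) ↔ P.degree < N := by
  rcases eq_or_ne P 0 with rfl | h0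
  · simp
  · rw [← natDegree_lt_iff_degree_lt h0,
      ← natDegree_lt_iff_degree_lt (mul_ne_zero h0 hG.ne_zero), natDegree_mul h0 hG.ne_zero]
    omega

/-- Linearity of `f p' + c f' p` in `f`, with denominators cleared: `F₁/G₁ - F₂/G₂ = (F₁G₂ -
F₂G₁)/(G₁G₂)`. -/
theorem bracket_sub_bracket (c : k) (F₁ G₁ F₂ G₂ p : k[X]) :
    bracket c F₁ G₁ p * G₂ ^ 2 - bracket c F₂ G₂ p * G₁ ^ 2 =
      bracket c (F₁ * G₂ - F₂ * G₁) (G₁ * G₂) p := by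
  simp only [bracket, derivative_sub, derivative_mul]
  ring

theorem derivative_taylor (r : k) (p : k[X]) :
    derivative (taylor r p) = taylor r (derivative p) := by
  simp [taylor_apply, derivative_comp]

theorem taylor_bracket (c r : k) (H K p : k[X]) :
    taylor r (bracket c H K p) = bracket c (taylor r H) (taylor r K) (taylor r p) := by
  simp only [bracket, map_add, map_sub, taylor_mul, derivative_taylor, taylor_C]

theorem degree_X_mul_taylor (r : k) (p : k[X]) :
    (X * taylor r p).degree = (X * p).degree := by
  rw [Polynomial.degree_mul, Polynomial.degree_mul, degree_taylor]

/-- In the second chart, the sections of the `m`-th power of the canonical bundle of the ribbon of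
genus `h + 3` with gluing function `F / G`. -/
def sectionsOf (h m : ℕ) (F G : k[X]) : Submodule k (ChartRing k) where
  -- For `deg G = h + 1` the second condition says that `q - (f p' + m f' p)` has order at most
  -- `m(h+2) - (h+4)` at infinity. The extra factor `X` replaces the bound `m(h+2) + h - 1` by a
  -- strict inequality without subtraction in `ℕ`.
  carrier := {s | s.fst.natDegree ≤ m * (h + 2) ∧
    (X * (s.snd * G ^ 2 - bracket (m : k) F G s.fst)).degree <
      ((m * (h + 2) + h : ℕ) : WithBot ℕ)}
  add_mem' {s t} hs ht := by
    refine ⟨natDegree_add_le_of_degree_le hs.1 ht.1, ?_⟩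
    have : X * ((s + t).snd * G ^ 2 - bracket (m : k) F G (s + t).fst) =
        X * (s.snd * G ^ 2 - bracket (m : k) F G s.fst) +
          X * (t.snd * G ^ 2 - bracket (m : k) F G t.fst) := by
      simp only [bracket, TrivSqZeroExt.fst_add, TrivSqZeroExt.snd_add, derivative_add]
      ring
    rw [this]
    exact (degree_add_le _ _).trans_lt (max_lt hs.2 ht.2)
  zero_mem' := ⟨by simp, by simp [bracket]; exact_mod_cast WithBot.bot_lt_coe _⟩
  smul_mem' c s hs := by
    refine ⟨(natDegree_smul_le _ _).trans hs.1, ?_⟩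
    have : X * ((c • s).snd * G ^ 2 - bracket (m : k) F G (c • s).fst) =
        c • (X * (s.snd * G ^ 2 - bracket (m : k) F G s.fst)) := by
      simp only [bracket, TrivSqZeroExt.fst_smul, TrivSqZeroExt.snd_smul, Polynomial.smul_eq_C_mul,
        derivative_C_mul]
      ring
    rw [this]
    exact (degree_smul_le _ _).trans_lt hs.2

theorem mem_sectionsOf {h m : ℕ} {F G : k[X]} {s : ChartRing k} : s ∈ sectionsOf h m F G ↔
    s.fst.natDegree ≤ m * (h + 2) ∧ (X * (s.snd * G ^ 2 - bracket (m : k) F G s.fst)).degree <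
      ((m * (h + 2) + h : ℕ) : WithBot ℕ) := Iff.rfl

/-- The defect `q - (f p' + m f' p)` obeys Leibniz's rule when the weights `m` add. -/
theorem sectionsOf_mul_le (h a b : ℕ) (F G : k[X]) :
    sectionsOf h a F G * sectionsOf h b F G ≤ sectionsOf h (a + b) F G := by
  rw [Submodule.mul_le]
  intro s hs t ht
  refine ⟨?_, ?_⟩
  · rw [TrivSqZeroExt.fst_mul, add_mul]
    exact natDegree_mul_le_of_le hs.1 ht.1
  · have : X * ((s * t).snd * G ^ 2 - bracket ((a + b : ℕ) : k) F G (s * t).fst) =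
        s.fst * (X * (t.snd * G ^ 2 - bracket (b : k) F G t.fst)) +
          t.fst * (X * (s.snd * G ^ 2 - bracket (a : k) F G s.fst)) := by
      simp only [bracket, DualNumber.snd_mul, TrivSqZeroExt.fst_mul, derivative_mul,
        Nat.cast_add, map_add]
      ring
    rw [this]
    refine (degree_add_le _ _).trans_lt (max_lt ?_ ?_)
    · exact (degree_mul_lt_of_natDegree_le hs.1 ht.2).trans_eq (by congr 1; ring)
    · exact (degree_mul_lt_of_natDegree_le ht.1 hs.2).trans_eq (by congr 1; ring)

theorem sectionsOf_one_pow_le (h m : ℕ) (F G : k[X]) :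
    sectionsOf h 1 F G ^ m ≤ sectionsOf h m F G := by
  induction m with
  | zero =>
    rw [Submodule.pow_zero, Submodule.one_le]
    refine ⟨by simp, ?_⟩
    simp [bracket]
  | succ m ih =>
    rw [Submodule.pow_succ]
    exact (mul_le_mul' ih le_rfl).trans (sectionsOf_mul_le h m 1 F G)

/-- The gluing function matters only up to order `y^{-h-2}` at infinity. Such a change alters the
defect in degree one beyond what is allowed, but there the coefficient is proportional to `m(h+2) +
m(h - 2(h+1)) = 0`. -/
theorem sectionsOf_le_of_degree_lt (h m : ℕ) {F₁ G₁ F₂ G₂ : k[X]} (hG₁ : G₁.Monic)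
    (hG₂ : G₂.Monic) (h₁ : G₁.natDegree = h + 1) (h₂ : G₂.natDegree = h + 1)
    (hB : (F₁ * G₂ - F₂ * G₁).natDegree ≤ h) :
    sectionsOf h m F₁ G₁ ≤ sectionsOf h m F₂ G₂ := by
  intro s hs
  refine ⟨hs.1, ?_⟩
  rw [← degree_mul_monic_lt_iff (hG₁.pow 2)]
  have e : X * (s.snd * G₂ ^ 2 - bracket (m : k) F₂ G₂ s.fst) * G₁ ^ 2 =
      X * (s.snd * G₁ ^ 2 - bracket (m : k) F₁ G₁ s.fst) * G₂ ^ 2 +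
        X * bracket (m : k) (F₁ * G₂ - F₂ * G₁) (G₁ * G₂) s.fst := by
    rw [← bracket_sub_bracket]; ring
  have hn₁ : (G₁ ^ 2).natDegree = 2 * (h + 1) := by rw [hG₁.natDegree_pow, h₁]
  have hn₂ : (G₂ ^ 2).natDegree = 2 * (h + 1) := by rw [hG₂.natDegree_pow, h₂]
  have hK : (G₁ * G₂).natDegree ≤ 2 * (h + 1) := natDegree_mul_le.trans (by omega)
  rw [e, hn₁]
  refine (degree_add_le _ _).trans_lt (max_lt ?_ ?_)
  · rw [← hn₂, degree_mul_monic_lt_iff (hG₂.pow 2)]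
    exact hs.2
  · rw [show m * (h + 2) + h + 2 * (h + 1) = h + 2 * (h + 1) + m * (h + 2) by ring]
    refine degree_lt_of_natDegree_le (natDegree_X_mul_bracket_le _ hB hK hs.1) ?_
    rw [coeff_X_mul_bracket _ hB hK hs.1]
    push_cast
    ring

theorem sectionsOf_congr (h m : ℕ) {F₁ G₁ F₂ G₂ : k[X]} (hG₁ : G₁.Monic)
    (hG₂ : G₂.Monic) (h₁ : G₁.natDegree = h + 1) (h₂ : G₂.natDegree = h + 1)
    (hB : (F₁ * G₂ - F₂ * G₁).natDegree ≤ h) :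
    sectionsOf h m F₁ G₁ = sectionsOf h m F₂ G₂ :=
  le_antisymm (sectionsOf_le_of_degree_lt h m hG₁ hG₂ h₁ h₂ hB)
    (sectionsOf_le_of_degree_lt h m hG₂ hG₁ h₂ h₁ (by rwa [← natDegree_neg, neg_sub]))

/-- The homomorphism of algebras of dual numbers which is `φ` on coefficients and maps `ε` to
`c • ε`. -/
def dualAlgHom {B B' : Type u} [CommRing B] [Algebra k B] [CommRing B'] [Algebra k B']
    (φ : B →ₐ[k] B') (c : B') : B[ε] →ₐ[k] B'[ε] :=
  DualNumber.lift ⟨((TrivSqZeroExt.inlAlgHom k B' B').comp φ, TrivSqZeroExt.inr c),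
    TrivSqZeroExt.inr_mul_inr _ _ _, fun _ => Commute.all _ _⟩

@[simp] theorem fst_dualAlgHom {B B' : Type u} [CommRing B] [Algebra k B] [CommRing B']
    [Algebra k B'] (φ : B →ₐ[k] B') (c : B') (s : B[ε]) :
    (dualAlgHom φ c s).fst = φ s.fst := by
  simp [dualAlgHom, DualNumber.lift_apply_apply]

@[simp] theorem snd_dualAlgHom {B B' : Type u} [CommRing B] [Algebra k B] [CommRing B']
    [Algebra k B'] (φ : B →ₐ[k] B') (c : B') (s : B[ε]) :
    (dualAlgHom φ c s).snd = φ s.snd * c := by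
  simp [dualAlgHom, DualNumber.lift_apply_apply, mul_comm]

theorem mem_sectionsOf_taylor (h m : ℕ) (F G : k[X]) (r : k) (s : ChartRing k) :
    dualAlgHom (taylorAlgHom r) 1 s ∈ sectionsOf h m (taylor r F) (taylor r G) ↔
      s ∈ sectionsOf h m F G := by
  have e : (dualAlgHom (taylorAlgHom r) 1 s).snd * taylor r G ^ 2 -
      bracket (m : k) (taylor r F) (taylor r G) (dualAlgHom (taylorAlgHom r) 1 s).fst =
      taylor r (s.snd * G ^ 2 - bracket (m : k) F G s.fst) := by
    rw [map_sub, taylor_mul, taylor_pow, taylor_bracket, fst_dualAlgHom, snd_dualAlgHom, mul_one]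
    rfl
  rw [mem_sectionsOf, mem_sectionsOf, e, degree_X_mul_taylor, fst_dualAlgHom]
  exact and_congr_left' (by rw [show taylorAlgHom r s.fst = taylor r s.fst from rfl,
    natDegree_taylor])

theorem map_sectionsOf_taylor (h m : ℕ) (F G : k[X]) (r : k) :
    (sectionsOf h m F G).map (dualAlgHom (taylorAlgHom r) 1).toLinearMap =
      sectionsOf h m (taylor r F) (taylor r G) := by
  have e : ∀ s : ChartRing k, dualAlgHom (taylorAlgHom r) 1
      (dualAlgHom (taylorAlgHom (-r)) 1 s) = s := by
    intro s
    ext : 1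
    · rw [fst_dualAlgHom, fst_dualAlgHom]
      exact (taylor_taylor _ _ _).trans (by rw [add_neg_cancel, taylor_zero])
    · rw [snd_dualAlgHom, snd_dualAlgHom, mul_one, mul_one]
      exact (taylor_taylor _ _ _).trans (by rw [add_neg_cancel, taylor_zero])
  ext s
  constructor
  · rintro ⟨s, hs, rfl⟩
    exact (mem_sectionsOf_taylor h m F G r s).mpr hs
  · intro hs
    refine ⟨_, ?_, e s⟩
    rw [SetLike.mem_coe, ← mem_sectionsOf_taylor h m F G r, e]
    exact hs

theorem dualAlgHom_taylor_injective (r : k) :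
    Function.Injective (dualAlgHom (taylorAlgHom r) (1 : k[X])) := by
  intro s t hst
  have h1 := congrArg TrivSqZeroExt.fst hst
  have h2 := congrArg TrivSqZeroExt.snd hst
  rw [fst_dualAlgHom, fst_dualAlgHom] at h1
  rw [snd_dualAlgHom, snd_dualAlgHom, mul_one, mul_one] at h2
  exact TrivSqZeroExt.ext (taylor_injective r h1) (taylor_injective r h2)

/-- The polynomial part of the quotient, by `(X + r) ^ (h + 1)`, of the translate by `r`
of `X ^ (h + 1) * F`. -/
def translate (h : ℕ) (r : k) (F : k[X]) : k[X] :=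
  (taylor r F * X ^ (h + 1)) /ₘ (X + Polynomial.C r) ^ (h + 1)

theorem natDegree_translate_sub_le (h : ℕ) (r : k) (F : k[X]) :
    (taylor r F * X ^ (h + 1) - translate h r F * (X + Polynomial.C r) ^ (h + 1)).natDegree ≤ h := by
  have hm : ((X + Polynomial.C r) ^ (h + 1)).Monic := (monic_X_add_C r).pow _
  have h1 := modByMonic_add_div (taylor r F * X ^ (h + 1)) ((X + Polynomial.C r) ^ (h + 1))
  have h2 := natDegree_modByMonic_lt (taylor r F * X ^ (h + 1)) hm (by
    intro h1
    have := congrArg natDegree h1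
    rw [natDegree_pow, natDegree_X_add_C] at this
    simp at this)
  rw [natDegree_pow, natDegree_X_add_C, mul_one] at h2
  rw [translate, show taylor r F * X ^ (h + 1) - (taylor r F * X ^ (h + 1)) /ₘ
    (X + Polynomial.C r) ^ (h + 1) * (X + Polynomial.C r) ^ (h + 1) =
    (taylor r F * X ^ (h + 1)) %ₘ (X + Polynomial.C r) ^ (h + 1) by linear_combination -h1]
  omega

theorem natDegree_translate_le (h : ℕ) (r : k) {F : k[X]} (hF : F.natDegree ≤ h) :
    (translate h r F).natDegree ≤ h := by
  rw [translate, natDegree_divByMonic _ ((monic_X_add_C r).pow _), natDegree_pow,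
    natDegree_X_add_C]
  have := natDegree_mul_le_of_le (natDegree_taylor F r).le (natDegree_X_pow_le (R := k) (h + 1))
  omega

theorem translate_ne_zero (h : ℕ) (r : k) {F : k[X]} (hF : F ≠ 0) : translate h r F ≠ 0 := by
  intro h0
  have := natDegree_translate_sub_le h r F
  rw [h0, zero_mul, sub_zero, natDegree_mul ((taylor_eq_zero r F).not.mpr hF) (by simp),
    natDegree_X_pow] at this
  omega

/-- The sections of the powers of the canonical bundle of the ribbon of genus `h + 3` with gluing
function `F / X ^ (h + 1)` have a destabilizing symmetry. -/
def IsGood (h : ℕ) (F : k[X]) : Prop :=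
  ∀ m, 2 ≤ m → IsDestabilized m (sectionsOf h 1 F (X ^ (h + 1))) (sectionsOf h m F (X ^ (h + 1)))

/-- The substitution `y ↦ y + r` turns `F / X^(h+1)` into a fraction with denominator `(X +
r)^(h+1)`. Division with remainder rewrites it over `X^(h+1)` with an error of order `y^{-h-2}`,
invisible to the sections by `sectionsOf_congr`. -/
theorem isGood_of_translate {h : ℕ} {r : k} {F : k[X]} (hF : IsGood h (translate h r F)) :
    IsGood h F := by
  intro m hm
  have e : ∀ m, sectionsOf h m (translate h r F) (X ^ (h + 1)) =
      (sectionsOf h m F (X ^ (h + 1))).map (dualAlgHom (taylorAlgHom r) 1).toLinearMap := by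
    intro m
    rw [map_sectionsOf_taylor]
    refine (sectionsOf_congr h m ((monic_X.pow _).comp (monic_X_add_C r) (by simp))
      (monic_X_pow _) ?_ (by simp) ?_).symm
    · rw [← taylor_apply, natDegree_taylor, natDegree_X_pow]
    · rw [← taylor_apply, taylor_X_pow]
      exact natDegree_translate_sub_le h r F
  rw [isDestabilized_map_iff (dualAlgHom (taylorAlgHom r) 1) m _ _
    (dualAlgHom_taylor_injective r).injOn (dualAlgHom_taylor_injective r).injOn
    (sectionsOf_one_pow_le h m _ _), ← e, ← e]
  exact hF m hm

end Bracket

/-! ### Normal form of a vector field -/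

section NormalForm

variable {k : Type u} [Field k]

/-- The polynomial `a + b X + c X²`. -/
def quadratic (a b c : k) : k[X] :=
  Polynomial.C a + Polynomial.C b * X + Polynomial.C c * X ^ 2

theorem natDegree_quadratic_le (a b c : k) : (quadratic a b c).natDegree ≤ 2 := by
  rw [quadratic]; compute_degree

theorem quadratic_coeff_two (a b c : k) : (quadratic a b c).coeff 2 = c := by
  simp [quadratic]

theorem derivative_quadratic (a b c : k) :
    derivative (quadratic a b c) = Polynomial.C b + Polynomial.C (2 * c) * X := by
  simp [quadratic]
  rw [Polynomial.C_ofNat]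
  ring

theorem taylor_quadratic (a b c r : k) : taylor r (quadratic a b c) =
    quadratic (a + b * r + c * r ^ 2) (b + 2 * c * r) c := by
  simp [quadratic, taylor_apply]
  rw [Polynomial.C_ofNat]
  ring

/-- The equation of `IsInvariant` for the ribbon with gluing function `F / G`. -/
theorem isInvariant_iff_exists {h : ℕ} {F : k[X]} (hF : F.natDegree ≤ h) (a b c γ : k) :
    IsInvariant (h + 1) F (quadratic a b c) γ ↔ ∃ β : k,
      (X * (bracket (-1) F (X ^ (h + 1)) (quadratic a b c) -
        (Polynomial.C γ + Polynomial.C ((h + 4) * c) * X) * F * X ^ (h + 1) -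
        Polynomial.C β * (X ^ (h + 1)) ^ 2)).degree < ((h + 2 : ℕ) : WithBot ℕ) := by
  have hα := natDegree_quadratic_le a b c
  rw [IsInvariant, quadratic_coeff_two]
  generalize quadratic a b c = α at *
  have e4 : (((h + 1 : ℕ) : k) + 3) = h + 4 := by push_cast; ring
  rw [e4]
  set Q := X * F * derivative α - (X * derivative F - ((h + 1 : ℕ) : k[X]) * F) * α -
    (Polynomial.C γ + Polynomial.C ((h + 4) * c) * X) * X * F with hQ
  have e : ∀ β : k, X * (bracket (-1) F (X ^ (h + 1)) α -
        (Polynomial.C γ + Polynomial.C ((h + 4) * c) * X) * F * X ^ (h + 1) -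
        Polynomial.C β * (X ^ (h + 1)) ^ 2) =
      (Q - Polynomial.C β * X ^ (h + 2)) * X ^ (h + 1) := by
    intro β
    rw [hQ, bracket, derivative_X_pow]
    simp only [map_neg, map_one, map_natCast, Nat.add_sub_cancel]
    ring
  have hQd : Q.natDegree ≤ h + 2 := by
    have h1 : (derivative α).natDegree ≤ 1 := (natDegree_derivative_le α).trans (by omega)
    have h2 := natDegree_X_mul_derivative_le hF
    have h3 : (X * F).natDegree ≤ h + 1 := (natDegree_mul_le_of_le natDegree_X_le hF).trans
      (by omega)
    have h4 : (((h + 1 : ℕ) : k[X]) * F).natDegree ≤ h := by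
      rw [← map_natCast Polynomial.C]
      exact (natDegree_C_mul_le _ _).trans hF
    have h5 : ((Polynomial.C γ + Polynomial.C ((h + 4) * c) * X) * X : k[X]).natDegree ≤ 2 := by
      compute_degree
    refine (natDegree_sub_le_of_le (natDegree_sub_le_of_le (natDegree_mul_le_of_le h3 h1)
      (natDegree_mul_le_of_le (natDegree_sub_le_of_le h2 h4) hα))
      (natDegree_mul_le_of_le h5 hF)).trans ?_
    simp only [max_self, max_le_iff]
    omega
  have hX : (X ^ (h + 1) : k[X]).natDegree = h + 1 := natDegree_X_pow _
  have hd : ∀ P : k[X], (P * X ^ (h + 1)).degree < ((h + 2 : ℕ) : WithBot ℕ) ↔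
      P.degree < ((1 : ℕ) : WithBot ℕ) := by
    intro P
    rw [← degree_mul_monic_lt_iff (monic_X_pow (h + 1)) 1, hX, show 1 + (h + 1) = h + 2 by ring]
  simp only [e, hd, degree_lt_iff_coeff_zero, Polynomial.coeff_sub, coeff_C_mul_X_pow]
  constructor
  · intro hI
    -- As `deg Q ≤ h + 2`, the only coefficient beyond the window of `IsInvariant` is this one, and
    -- the free constant `β` absorbs it.
    refine ⟨Q.coeff (h + 2), fun j hj => ?_⟩
    rcases lt_trichotomy j (h + 2) with h1 | rfl | h1
    · obtain ⟨i, rfl⟩ : ∃ i, j = i + 1 := ⟨j - 1, by omega⟩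
      rw [hI i (by omega), if_neg (by omega), sub_zero]
    · simp
    · rw [coeff_eq_zero_of_natDegree_lt (by omega), if_neg (by omega), sub_zero]
  · rintro ⟨β, hβ⟩ i hi
    have := hβ (i + 1) (by omega)
    rwa [if_neg (by omega), sub_zero] at this

/-- Translate the whole equation, then replace the fraction `F₁/G₁` by its truncation `F₂/G₂`. The
error could matter only in its top degree, where its coefficient is proportional to `c (2 - (h -
2(h+1)) - (h+4)) = 0`. -/
theorem IsInvariant.translate {h : ℕ} {F : k[X]} (hF : F.natDegree ≤ h) {a b c γ : k}
    (hI : IsInvariant (h + 1) F (quadratic a b c) γ) (r : k) :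
    IsInvariant (h + 1) (translate h r F) (quadratic (a + b * r + c * r ^ 2) (b + 2 * c * r) c)
      (γ + (h + 4) * c * r) := by
  rw [isInvariant_iff_exists hF] at hI
  rw [isInvariant_iff_exists (natDegree_translate_le h r hF), ← taylor_quadratic]
  obtain ⟨β, hβ⟩ := hI
  refine ⟨β, ?_⟩
  rw [← degree_X_mul_taylor r] at hβ
  simp only [map_sub, map_add, taylor_mul, taylor_bracket, taylor_C, taylor_X, taylor_pow] at hβ
  have hα : (taylor r (quadratic a b c)).natDegree ≤ 2 := by
    rw [natDegree_taylor]; exact natDegree_quadratic_le a b c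
  have hα2 : (taylor r (quadratic a b c)).coeff 2 = c := by
    rw [taylor_quadratic, quadratic_coeff_two]
  generalize taylor r (quadratic a b c) = α at *
  have hB := natDegree_translate_sub_le h r F
  generalize taylor r F = F₁ at *
  generalize Ribbon.translate h r F = F₂ at *
  have hG₁ : ((X + Polynomial.C r) ^ (h + 1)).Monic := (monic_X_add_C r).pow _
  have hn₁ : ((X + Polynomial.C r) ^ (h + 1)).natDegree = h + 1 := by
    rw [natDegree_pow, natDegree_X_add_C, mul_one]
  have hG₂ : (X ^ (h + 1) : k[X]).Monic := monic_X_pow _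
  have hn₂ : (X ^ (h + 1) : k[X]).natDegree = h + 1 := natDegree_X_pow _
  generalize (X + Polynomial.C r) ^ (h + 1) = G₁ at *
  generalize (X ^ (h + 1) : k[X]) = G₂ at *
  have hn₁' : (G₁ ^ 2).natDegree = 2 * (h + 1) := by rw [hG₁.natDegree_pow, hn₁]
  have hn₂' : (G₂ ^ 2).natDegree = 2 * (h + 1) := by rw [hG₂.natDegree_pow, hn₂]
  have hK : (G₁ * G₂).natDegree ≤ 2 * (h + 1) := natDegree_mul_le.trans (by omega)
  rw [← degree_mul_monic_lt_iff (hG₁.pow 2)]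
  set L : k[X] := Polynomial.C (γ + (h + 4) * c * r) + Polynomial.C ((h + 4) * c) * X with hL
  have hL' : Polynomial.C γ + Polynomial.C ((h + 4) * c) * (X + Polynomial.C r) = L := by
    rw [hL]
    simp only [map_add, map_mul]
    ring
  rw [hL'] at hβ
  have hLd : (X * L).natDegree ≤ 2 := by rw [hL]; compute_degree
  have hLc : (X * L).coeff 2 = (h + 4) * c := by
    rw [coeff_X_mul, hL]
    simp [-map_mul, -map_add, Polynomial.coeff_C]
  have e : X * (bracket (-1) F₂ G₂ α - L * F₂ * G₂ - Polynomial.C β * G₂ ^ 2) * G₁ ^ 2 =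
      X * (bracket (-1) F₁ G₁ α - L * F₁ * G₁ - Polynomial.C β * G₁ ^ 2) * G₂ ^ 2 -
      (X * bracket (-1) (F₁ * G₂ - F₂ * G₁) (G₁ * G₂) α -
        (F₁ * G₂ - F₂ * G₁) * (G₁ * G₂) * (X * L)) := by
    rw [← bracket_sub_bracket]; ring
  rw [e, hn₁']
  refine (degree_sub_le _ _).trans_lt (max_lt ?_ ?_)
  · rw [← hn₂', degree_mul_monic_lt_iff (hG₂.pow 2)]
    exact hβ
  · rw [show h + 2 + 2 * (h + 1) = h + 2 * (h + 1) + 2 by ring]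
    refine degree_lt_of_natDegree_le ((natDegree_sub_le_of_le
      (natDegree_X_mul_bracket_le _ hB hK hα)
      (natDegree_mul_le_of_le (natDegree_mul_le_of_le hB hK) hLd)).trans_eq (max_self _)) ?_
    rw [Polynomial.coeff_sub, coeff_X_mul_bracket _ hB hK hα,
      coeff_mul_add_eq_of_natDegree_le (natDegree_mul_le_of_le hB hK) hLd,
      coeff_mul_add_eq_of_natDegree_le hB hK, hα2, hLc]
    push_cast
    ring

/-- Up to a scalar shift, this is the `sl₂`-action on the `h + 1` coefficients of `F`: `a` shifts
indices one way, `c` the other way, and `b` is diagonal. Hence invariance is an eigenvector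
equation. Writing `(X * F).coeff e` for the coefficient of index `e - 1` gives `0` at `e = 0`. -/
theorem isInvariant_quadratic_iff (h : ℕ) (F : k[X]) (a b c γ : k) :
    IsInvariant (h + 1) F (quadratic a b c) γ ↔ ∀ e : ℕ, e ≤ h →
      a * (h - e) * F.coeff (e + 1) + ((h - e + 2) * b - γ) * F.coeff e -
        c * e * (X * F).coeff e = 0 := by
  rw [IsInvariant, quadratic_coeff_two, derivative_quadratic, quadratic]
  have e0 : ∀ e : ℕ, (X * F * (Polynomial.C b + Polynomial.C (2 * c) * X) -
      (X * derivative F - ((h + 1 : ℕ) : k[X]) * F) *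
        (Polynomial.C a + Polynomial.C b * X + Polynomial.C c * X ^ 2) -
      (Polynomial.C γ + Polynomial.C ((((h + 1 : ℕ) : k) + 3) * c) * X) * X * F).coeff (e + 1) =
      a * (h - e) * F.coeff (e + 1) + ((h - e + 2) * b - γ) * F.coeff e -
        c * e * (X * F).coeff e := by
    intro e
    set W := X * derivative F - ((h + 1 : ℕ) : k[X]) * F with hW
    have hWc : ∀ j : ℕ, W.coeff j = ((j : k) - (h + 1)) * F.coeff j := by
      intro j
      rw [hW, Polynomial.coeff_sub, coeff_X_mul_derivative, ← map_natCast Polynomial.C,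
        coeff_C_mul]
      push_cast
      ring
    have hXW : (X * W).coeff e = ((e : k) - 1 - (h + 1)) * (X * F).coeff e := by
      rcases e with _ | e
      · simp
      · rw [coeff_X_mul, coeff_X_mul, hWc]; push_cast; ring
    rw [show X * F * (Polynomial.C b + Polynomial.C (2 * c) * X) -
      W * (Polynomial.C a + Polynomial.C b * X + Polynomial.C c * X ^ 2) -
      (Polynomial.C γ + Polynomial.C ((((h + 1 : ℕ) : k) + 3) * c) * X) * X * F =
      Polynomial.C b * (X * F) + Polynomial.C (2 * c) * (X * (X * F)) - (Polynomial.C a * W +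
        Polynomial.C b * (X * W) + Polynomial.C c * (X * (X * W))) - (Polynomial.C γ * (X * F) +
        Polynomial.C ((((h + 1 : ℕ) : k) + 3) * c) * (X * (X * F))) by ring]
    simp only [Polynomial.coeff_sub, Polynomial.coeff_add, coeff_C_mul, coeff_X_mul, hXW, hWc]
    push_cast
    ring
  simp only [e0, Nat.lt_succ_iff]

/-- The inversion `y ↦ y⁻¹` sends `∂_y`, `y ∂_y`, `y² ∂_y` to minus `y² ∂_y`, `y ∂_y`, `∂_y`, and
exchanges the indices `e` and `h - e`. The shift of `γ` balances `(h - e + 2) b + (e + 2) b = (h +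
4) b`. -/
theorem IsInvariant.reflect {h : ℕ} {F : k[X]} (hF : F.natDegree ≤ h) {a b c γ : k}
    (hI : IsInvariant (h + 1) F (quadratic a b c) γ) :
    IsInvariant (h + 1) (reflect h F) (quadratic (-c) (-b) (-a)) (γ - (h + 4) * b) := by
  rw [isInvariant_quadratic_iff] at hI ⊢
  intro e he
  obtain ⟨d, rfl⟩ := Nat.exists_eq_add_of_le he
  have h1 := hI d (by omega)
  have c0 : (Polynomial.reflect (e + d) F).coeff e = F.coeff d := by
    rw [coeff_reflect, revAt_le (by omega), Nat.add_sub_cancel_left]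
  have c1 : (d : k) * (Polynomial.reflect (e + d) F).coeff (e + 1) = d * (X * F).coeff d := by
    rcases d with _ | d
    · simp
    · rw [coeff_reflect, revAt_le (by omega), coeff_X_mul,
        show e + (d + 1) - (e + 1) = d by omega]
  have c2 : (e : k) * (X * Polynomial.reflect (e + d) F).coeff e = e * F.coeff (d + 1) := by
    rcases e with _ | e
    · simp
    · rw [coeff_X_mul, coeff_reflect, revAt_le (by omega),
        show e + 1 + d - e = d + 1 by omega]
  rw [c0]
  push_cast at h1 ⊢
  linear_combination h1 - c * c1 + a * c2

theorem natDegree_reflect_le {h : ℕ} {F : k[X]} (hF : F.natDegree ≤ h) :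
    (Polynomial.reflect h F).natDegree ≤ h := by
  rw [natDegree_le_iff_coeff_eq_zero]
  intro j hj
  rw [coeff_reflect, revAt_eq_self_of_lt hj]
  exact coeff_eq_zero_of_natDegree_lt (by omega)

theorem eq_C_mul_X_pow {F : k[X]} {j : ℕ} (hF : ∀ i ≠ j, F.coeff i = 0) :
    F = Polynomial.C (F.coeff j) * X ^ j := by
  ext i
  rw [coeff_C_mul_X_pow]
  split_ifs with h
  · rw [h]
  · exact hF i h

/-- If the ribbon with gluing function `F / X ^ (h + 1)` has a nonzero vector field, a change of
coordinates makes `F` a monomial. -/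
theorem isGood_of_isInvariant [IsAlgClosed k] [CharZero k] {h : ℕ}
    (hmono : ∀ (c : k) (j : ℕ), c ≠ 0 → j ≤ h → IsGood h (Polynomial.C c * X ^ j))
    (hswap : ∀ F : k[X], F.natDegree ≤ h → IsGood h (Polynomial.reflect h F) → IsGood h F)
    {F : k[X]} (hF : F.natDegree ≤ h) (hF0 : F ≠ 0) {a b c γ : k}
    (h0 : ¬(a = 0 ∧ b = 0 ∧ c = 0)) (hI : IsInvariant (h + 1) F (quadratic a b c) γ) :
    IsGood h F := by
  have mono : ∀ (F : k[X]) (j : ℕ), F.natDegree ≤ h → F ≠ 0 → (∀ i ≤ h, i ≠ j → F.coeff i = 0) →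
      IsGood h F := by
    intro F j hF hF0 hc
    have hc' : ∀ i ≠ j, F.coeff i = 0 := by
      intro i hi
      by_cases hih : i ≤ h
      · exact hc i hih hi
      · exact coeff_eq_zero_of_natDegree_lt (by omega)
    have e := eq_C_mul_X_pow hc'
    have hj : F.coeff j ≠ 0 := fun h1 => hF0 (by rw [e, h1]; simp)
    rw [e]
    exact hmono _ _ hj ((le_natDegree_of_ne_zero hj).trans hF)
  -- the diagonal case
  have case1 : ∀ (F : k[X]) (b γ : k), F.natDegree ≤ h → F ≠ 0 → b ≠ 0 →
      IsInvariant (h + 1) F (quadratic 0 b 0) γ → IsGood h F := by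
    intro F b γ hF hF0 hb hI
    rw [isInvariant_quadratic_iff] at hI
    obtain ⟨j, hj⟩ : ∃ j, F.coeff j ≠ 0 := by
      by_contra! hc
      exact hF0 (Polynomial.ext hc)
    have hjh : j ≤ h := (le_natDegree_of_ne_zero hj).trans hF
    refine mono F j hF hF0 fun i hi hij => ?_
    by_contra hi0
    have h1 := hI i hi
    have h2 := hI j hjh
    simp only [zero_mul, zero_add, sub_zero, mul_eq_zero, hi0, hj, or_false] at h1 h2
    -- Two nonzero coefficients would give `(h - i + 2) b = γ = (h - j + 2) b`.
    have h3 : ((i : k) - j) * b = 0 := by linear_combination h2 - h1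
    rw [mul_eq_zero, or_iff_left hb, sub_eq_zero, Nat.cast_inj] at h3
    exact hij h3
  -- A field `(a + b y) ∂_y` with `b ≠ 0` becomes diagonal once its zero `-a/b` is moved to the
  -- origin.
  have case3 : ∀ (F : k[X]) (a b γ : k), F.natDegree ≤ h → F ≠ 0 → b ≠ 0 →
      IsInvariant (h + 1) F (quadratic a b 0) γ → IsGood h F := by
    intro F a b γ hF hF0 hb hI
    refine isGood_of_translate (r := -a / b) (case1 _ b (γ + (h + 4) * 0 * (-a / b))
      (natDegree_translate_le h _ hF)
      (translate_ne_zero h _ hF0) hb ?_)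
    have := hI.translate hF (-a / b)
    rwa [mul_div_cancel₀ _ hb, show a + -a + 0 * (-a / b) ^ 2 = 0 by ring,
      show b + 2 * 0 * (-a / b) = b by ring] at this
  -- For a multiple of `∂_y`, the equation at the top degree of `F` gives `γ = 0`, and the others
  -- then kill every coefficient except the constant one.
  have case5 : ∀ (F : k[X]) (a γ : k), F.natDegree ≤ h → F ≠ 0 → a ≠ 0 →
      IsInvariant (h + 1) F (quadratic a 0 0) γ → IsGood h F := by
    intro F a γ hF hF0 ha hI
    rw [isInvariant_quadratic_iff] at hI
    have hd : F.coeff F.natDegree ≠ 0 := by rwa [coeff_natDegree, leadingCoeff_ne_zero]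
    have hγ : γ = 0 := by
      have := hI _ hF
      rw [coeff_eq_zero_of_natDegree_lt (Nat.lt_succ_self _)] at this
      simpa [hF0] using this
    refine mono F 0 hF hF0 fun i hi hi0 => ?_
    obtain ⟨j, rfl⟩ := Nat.exists_eq_succ_of_ne_zero hi0
    have h1 := hI j (by omega)
    have h2 : (h : k) - j ≠ 0 := by
      rw [sub_ne_zero, Ne, Nat.cast_inj]
      omega
    simpa [hγ, ha, h2] using h1
  have swap : ∀ (F : k[X]), F ≠ 0 → Polynomial.reflect h F ≠ 0 := fun F hF0 => by
    rwa [Ne, reflect_eq_zero_iff]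
  -- A field vanishing at `y = 0` has no quadratic term after the exchange of charts, so the
  -- previous cases apply.
  have case4 : ∀ (F : k[X]) (b c γ : k), F.natDegree ≤ h → F ≠ 0 → ¬(b = 0 ∧ c = 0) →
      IsInvariant (h + 1) F (quadratic 0 b c) γ → IsGood h F := by
    intro F b c γ hF hF0 hbc hI
    refine hswap F hF ?_
    have hI' := hI.reflect hF
    rw [neg_zero] at hI'
    rcases eq_or_ne b 0 with rfl | hb
    · rw [neg_zero] at hI'
      exact case5 _ _ _ (natDegree_reflect_le hF) (swap F hF0) (neg_ne_zero.mpr (by tauto)) hI'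
    · exact case3 _ _ _ _ (natDegree_reflect_le hF) (swap F hF0) (neg_ne_zero.mpr hb) hI'
  rcases eq_or_ne c 0 with rfl | hc
  · rcases eq_or_ne b 0 with rfl | hb
    · exact case5 F a γ hF hF0 (by tauto) hI
    · exact case3 F a b γ hF hF0 hb hI
  -- The remaining fields have a zero in the second chart, as `k` is algebraically closed; it is
  -- moved to the origin.
  · obtain ⟨r, hr⟩ := IsAlgClosed.exists_root (quadratic a b c) (by
      rw [quadratic, show Polynomial.C a + Polynomial.C b * X + Polynomial.C c * X ^ 2 =
        Polynomial.C c * X ^ 2 + Polynomial.C b * X + Polynomial.C a by ring, degree_quadratic hc]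
      decide)
    have hr' : a + b * r + c * r ^ 2 = 0 := by
      simpa [quadratic, IsRoot] using hr
    have := hI.translate hF r
    rw [hr'] at this
    exact isGood_of_translate (case4 _ _ _ _ (natDegree_translate_le h _ hF)
      (translate_ne_zero h _ hF0) (by tauto) this)

end NormalForm

/-! ### Restriction of sections to the second chart, and exchange of the charts -/

section Charts

variable {k : Type u} [Field k]

theorem exists_toLaurent_eq {L : k[T;T⁻¹]} (hL : ∀ n < 0, L.coeff n = 0) :
    ∃ p : k[X], toLaurent p = L := by
  obtain ⟨n, q, hq⟩ := L.exists_T_pow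
  have hdvd : X ^ n ∣ q := by
    rw [X_pow_dvd_iff]
    intro d hd
    rw [← coeff_toLaurent_nat, hq, mul_comm, coeff_T_mul]
    exact hL _ (by omega)
  obtain ⟨p, rfl⟩ := hdvd
  refine ⟨p, ?_⟩
  rw [map_mul, toLaurent_X_pow, mul_comm] at hq
  exact (isUnit_T (n : ℤ)).mul_right_cancel hq

theorem forall_coeff_toLaurent_eq_zero_iff (P : k[X]) (N : ℕ) (c : ℤ) (hc : c + 1 = N) :
    (∀ i : ℤ, c < i → (toLaurent P).coeff i = 0) ↔ ∀ j : ℕ, N ≤ j → P.coeff j = 0 := by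
  constructor
  · intro h j hj
    rw [← coeff_toLaurent_nat]
    exact h _ (by omega)
  · intro h i hi
    obtain ⟨j, rfl⟩ := Int.eq_ofNat_of_zero_le (a := i) (by omega)
    rw [coeff_toLaurent_nat]
    exact h _ (by omega)

theorem exists_eq_T_mul_invert_iff (L : k[T;T⁻¹]) (N : ℤ) :
    (∃ a : k[X], L = T N * invert (toLaurent a)) ↔ ∀ i, N < i → L.coeff i = 0 := by
  constructor
  · rintro ⟨a, rfl⟩ i hi
    rw [coeff_T_mul, invert_apply]
    exact coeff_toLaurent_neg a _ (by omega)
  · intro hL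
    obtain ⟨a, ha⟩ := exists_toLaurent_eq (L := invert (T (-N) * L)) (fun n hn => by
      rw [invert_apply, coeff_T_mul]
      exact hL _ (by omega))
    refine ⟨a, ?_⟩
    rw [ha, involutive_invert, ← mul_assoc, ← T_add, add_neg_cancel, T_zero, one_mul]

theorem jacobianLead_pow (g m : ℕ) : jacobianLead k g ^ m =
    LaurentPolynomial.C ((-1) ^ m) * T (m * ((g : ℤ) - 1)) := by
  rw [jacobianLead, neg_pow, T_pow, map_pow, map_neg, map_one]

theorem isUnit_jacobianLead_pow (g m : ℕ) : IsUnit (jacobianLead k g ^ m) :=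
  ((isUnit_T ((g : ℤ) - 1) : IsUnit (T ((g : ℤ) - 1) : k[T;T⁻¹])).neg).pow m

theorem exists_eq_jacobianLead_mul_iff (g m : ℕ) (j : ℤ) (L : k[T;T⁻¹]) :
    (∃ a : k[X], L = jacobianLead k g ^ m * T j * invert (toLaurent a)) ↔
      ∀ i, m * ((g : ℤ) - 1) + j < i → L.coeff i = 0 := by
  rw [← exists_eq_T_mul_invert_iff]
  have hs : (LaurentPolynomial.C ((-1) ^ m) * LaurentPolynomial.C ((-1) ^ m) : k[T;T⁻¹]) = 1 := by
    rw [← map_mul, ← mul_pow]; simp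
  have e : ∀ a : k[X], jacobianLead k g ^ m * T j *
      invert (toLaurent (Polynomial.C ((-1) ^ m) * a)) =
      T (m * ((g : ℤ) - 1) + j) * invert (toLaurent a) := by
    intro a
    rw [jacobianLead_pow, map_mul, map_mul, Polynomial.toLaurent_C, invert_C, T_add]
    linear_combination (T (m * ((g : ℤ) - 1)) * T j * invert (toLaurent a)) * hs
  constructor
  · rintro ⟨a, rfl⟩
    refine ⟨Polynomial.C ((-1) ^ m) * a, ?_⟩
    rw [← e, ← mul_assoc, ← map_mul, ← mul_pow]
    simp
  · rintro ⟨a, rfl⟩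
    exact ⟨_, (e a).symm⟩

/-- For `G = X^(h+1)` the factor `X G²` of `sectionsOf` is the unit `y^{2h+3}`, so its degree bound
is a bound on the order of the defect at infinity. -/
theorem toLaurent_X_mul_sub_bracket (h m : ℕ) (f : Fin (h + 3 - 2) → k) (p q : k[X]) :
    toLaurent (X * (q * (X ^ (h + 1)) ^ 2 - bracket (m : k) (tailPoly (h + 3) f) (X ^ (h + 1)) p)) =
      (T (2 * (h : ℤ) + 3) : k[T;T⁻¹]) * (toLaurent q - (tail (h + 3) f * LD (toLaurent p) +
        (m : k[T;T⁻¹]) * LD (tail (h + 3) f) * toLaurent p)) := by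
  have e1 : LD (tail (h + 3) f) =
      T (-((h : ℤ) + 1)) * toLaurent (derivative (tailPoly (h + 3) f)) -
      ((h : k[T;T⁻¹]) + 1) * T (-((h : ℤ) + 1)) * T (-1) * toLaurent (tailPoly (h + 3) f) := by
    rw [tail_eq, Derivation.leibniz, LD_toLaurent, LD_T,
      show ((h + 3 - 2 : ℕ) : ℤ) = h + 1 by omega, sub_eq_add_neg (-((h : ℤ) + 1)) 1, T_add]
    push_cast
    simp only [smul_eq_mul, map_neg, map_add, map_natCast, map_one]
    ring
  have e2 : tail (h + 3) f = T (-((h : ℤ) + 1)) * toLaurent (tailPoly (h + 3) f) := by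
    rw [tail_eq, show ((h + 3 - 2 : ℕ) : ℤ) = h + 1 by omega]
  rw [e1, e2, LD_toLaurent, bracket, derivative_X_pow]
  simp only [map_mul, map_sub, map_add, map_pow, toLaurent_X, map_natCast,
    Nat.add_sub_cancel]
  have h1 : (T 1 * T (-1) : k[T;T⁻¹]) = 1 := by rw [← T_add]; simp
  have h2 : (T (-((h : ℤ) + 1)) : k[T;T⁻¹]) = T (-1) ^ (h + 1) := by rw [T_pow]; push_cast; ring_nf
  have h3 : (T (2 * (h : ℤ) + 3) : k[T;T⁻¹]) = T 1 ^ (2 * h + 3) := by rw [T_pow]; push_cast; ring_nf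
  have h4 : (T 1 ^ (h + 1) * T (-1) ^ (h + 1) : k[T;T⁻¹]) = 1 := by rw [← mul_pow, h1, one_pow]
  have h5 : (T 1 ^ (2 * h + 3) : k[T;T⁻¹]) = T 1 ^ (h + 1) * T 1 ^ (h + 1) * T 1 := by ring
  have h6 : (T 1 ^ (h + 1) : k[T;T⁻¹]) = T 1 ^ h * T 1 := by ring
  rw [h2, h3, h5]
  push_cast
  generalize hu : (T 1 ^ (h + 1) : k[T;T⁻¹]) = u at *
  generalize (T (-1) ^ (h + 1) : k[T;T⁻¹]) = v at *
  generalize (T 1 ^ h : k[T;T⁻¹]) = w at *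
  generalize (T 1 : k[T;T⁻¹]) = y at *
  generalize (T (-1) : k[T;T⁻¹]) = z at *
  generalize toLaurent (tailPoly (h + 3) f) = F at *
  generalize toLaurent (derivative (tailPoly (h + 3) f)) = F' at *
  generalize toLaurent (derivative p) = p' at *
  generalize toLaurent p = p at *
  linear_combination (u * y * F * p' + m * u * y * F' * p - m * (h + 1) * u * y * z * F * p) * h4 -
    (m * (h + 1) * F * p * w * y) * h1 - (m * (h + 1) * F * p * y * z) * h6

/-- A component in the second chart extends to a global section exactly when the `a` and `b`
demanded by the first chart are polynomials in `y⁻¹`, which amounts to the two degree bounds. -/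
theorem map_snd_canonicalSections (h m : ℕ) (f : Fin (h + 3 - 2) → k) :
    (canonicalSections (h + 3) f m).map (AlgHom.snd k (ChartRing k) (ChartRing k)).toLinearMap =
      sectionsOf h m (tailPoly (h + 3) f) (X ^ (h + 1)) := by
  have key : ∀ s : ChartRing k, s ∈ sectionsOf h m (tailPoly (h + 3) f) (X ^ (h + 1)) ↔
      ∃ a b : k[X], toLaurent s.fst = jacobianLead k (h + 3) ^ m * invert (toLaurent a) ∧
        toLaurent s.snd = jacobianLead k (h + 3) ^ m * T (-((h + 3 : ℕ) : ℤ) - 1) *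
          invert (toLaurent b) + (tail (h + 3) f * LD (toLaurent s.fst) +
            (m : k[T;T⁻¹]) * LD (tail (h + 3) f) * toLaurent s.fst) := by
    intro s
    have k1 := exists_eq_jacobianLead_mul_iff (h + 3) m 0 (toLaurent s.fst)
    have k2 := exists_eq_jacobianLead_mul_iff (h + 3) m (-((h + 3 : ℕ) : ℤ) - 1)
      (toLaurent s.snd - (tail (h + 3) f * LD (toLaurent s.fst) +
            (m : k[T;T⁻¹]) * LD (tail (h + 3) f) * toLaurent s.fst))
    simp only [sub_eq_iff_eq_add] at k2
    rw [T_zero, mul_one] at k1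
    simp only [exists_and_left, exists_and_right]
    rw [k1, k2, mem_sectionsOf]
    refine and_congr ?_ ?_
    · rw [natDegree_le_iff_coeff_eq_zero,
        forall_coeff_toLaurent_eq_zero_iff _ (m * (h + 2) + 1) _ (by push_cast; ring)]
      rfl
    · rw [degree_lt_iff_coeff_zero]
      have e := toLaurent_X_mul_sub_bracket h m f s.fst s.snd
      generalize toLaurent s.snd - (tail (h + 3) f * LD (toLaurent s.fst) +
            (m : k[T;T⁻¹]) * LD (tail (h + 3) f) * toLaurent s.fst) = L at *
      generalize X * (s.snd * (X ^ (h + 1)) ^ 2 - bracket (m : k)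
          (tailPoly (h + 3) f) (X ^ (h + 1)) s.fst) = P at *
      rw [← forall_coeff_toLaurent_eq_zero_iff P (m * (h + 2) + h) (m * (h + 2) + h - 1)
        (by push_cast; ring), e]
      simp only [coeff_T_mul]
      constructor
      · intro hL i hi
        have := hL (i + (2 * h + 3)) (by push_cast at hi; linarith)
        rwa [add_sub_cancel_right] at this
      · intro hL i hi
        exact hL _ (by push_cast; linarith)
  ext s
  rw [key]
  constructor
  · rintro ⟨⟨s₁, s₂⟩, hs, rfl⟩
    rw [SetLike.mem_coe, mem_canonicalSections_iff] at hs
    exact ⟨_, _, hs⟩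
  · rintro ⟨a, b, hs⟩
    refine ⟨(TrivSqZeroExt.inl a + TrivSqZeroExt.inr b, s), ?_, rfl⟩
    rw [SetLike.mem_coe, mem_canonicalSections_iff]
    simpa using hs

theorem canonicalSections_snd_injOn (g m : ℕ) (f : Fin (g - 2) → k) :
    Set.InjOn (AlgHom.snd k (ChartRing k) (ChartRing k)) (canonicalSections g f m) := by
  rintro ⟨s₁, s₂⟩ hs ⟨t₁, t₂⟩ ht (rfl : s₂ = t₂)
  rw [SetLike.mem_coe, mem_canonicalSections_iff] at hs ht
  have h1 := (isUnit_jacobianLead_pow g m).mul_left_cancel (hs.1.symm.trans ht.1)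
  have h2 := ((isUnit_jacobianLead_pow g m).mul (isUnit_T _)).mul_left_cancel
    (add_right_cancel (hs.2.symm.trans ht.2))
  rw [Prod.mk.injEq]
  exact ⟨TrivSqZeroExt.ext (toLaurent_injective (invert.injective h1))
    (toLaurent_injective (invert.injective h2)), rfl⟩

theorem canonicalSections_mul_le (g a b : ℕ) (f : Fin (g - 2) → k) :
    canonicalSections g f a * canonicalSections g f b ≤ canonicalSections g f (a + b) := by
  rw [Submodule.mul_le]
  intro s hs t ht
  change resOne g f (s.1 * t.1) * _ = resTwo k (s.2 * t.2)
  have hs' : resOne g f s.1 * jacobian g f ^ a = resTwo k s.2 := hs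
  have ht' : resOne g f t.1 * jacobian g f ^ b = resTwo k t.2 := ht
  rw [map_mul, map_mul, ← hs', ← ht', pow_add]
  ring

theorem canonicalSections_one_pow_le (g m : ℕ) (f : Fin (g - 2) → k) :
    canonicalSections g f 1 ^ m ≤ canonicalSections g f m := by
  induction m with
  | zero =>
    rw [Submodule.pow_zero, Submodule.one_le]
    change resOne g f 1 * jacobian g f ^ 0 = resTwo k 1
    simp
  | succ m ih =>
    rw [Submodule.pow_succ]
    exact (mul_le_mul' ih le_rfl).trans (canonicalSections_mul_le g m 1 f)

theorem isGood_tailPoly_iff (h : ℕ) (f : Fin (h + 3 - 2) → k) :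
    IsGood h (tailPoly (h + 3) f) ↔ ∀ m, 2 ≤ m → IsDestabilized m
      (canonicalSections (h + 3) f 1) (canonicalSections (h + 3) f m) := by
  refine forall₂_congr fun m _ => ?_
  rw [isDestabilized_map_iff (AlgHom.snd k (ChartRing k) (ChartRing k)) m _ _
    (canonicalSections_snd_injOn _ _ f) (canonicalSections_snd_injOn _ _ f)
    (canonicalSections_one_pow_le _ _ f), map_snd_canonicalSections, map_snd_canonicalSections]

theorem tail_comp_rev (g : ℕ) (f : Fin (g - 2) → k) :
    tail g (f ∘ Fin.rev) = T (1 - (g : ℤ)) * invert (tail g f) := by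
  rw [tail, tail, map_sum, Finset.mul_sum, ← Equiv.sum_comp Fin.revPerm]
  refine Finset.sum_congr rfl fun i _ => ?_
  simp only [Fin.revPerm_apply, Function.comp_apply, Fin.rev_rev, map_mul, invert_C, invert_T]
  rw [mul_left_comm, ← T_add, Fin.val_rev]
  congr 2
  have := i.2
  omega

/-- Solving the gluing for `y` and `η` gives the same form with the coefficients `f_i` in reverse
order. -/
theorem swap_mem_canonicalSections (g m : ℕ) (f : Fin (g - 2) → k) {s : ChartRing k × ChartRing k}
    (hs : s ∈ canonicalSections g f m) : s.swap ∈ canonicalSections g (f ∘ Fin.rev) m := by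
  rw [mem_canonicalSections_iff] at hs ⊢
  obtain ⟨h1, h2⟩ := hs
  have hJ : (jacobianLead k g ^ m * invert (jacobianLead k g ^ m) : k[T;T⁻¹]) = 1 := by
    rw [map_pow, ← mul_pow, jacobianLead, map_neg, invert_T, neg_mul_neg, ← T_add, add_neg_cancel,
      T_zero, one_pow]
  have hii : ∀ L : k[T;T⁻¹], invert (invert L) = L := fun L => involutive_invert L
  have a1 : toLaurent s.1.fst = jacobianLead k g ^ m * invert (toLaurent s.2.fst) := by
    rw [h1, map_mul, hii, ← mul_assoc, hJ, one_mul]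
  refine ⟨a1, ?_⟩
  simp only [Prod.fst_swap, Prod.snd_swap]
  rw [tail_comp_rev, a1, h2]
  simp only [map_add, map_mul, hii, Derivation.leibniz, LD_jacobianLead_pow, LD_invert, LD_T,
    smul_eq_mul, invert_T, map_natCast]
  rw [show (1 - (g : ℤ) - 1) = (1 - g) + (-1) by ring,
    show (-(g : ℤ) - 1) = (1 - g) + (-1) + (-1) by ring,
    show -((1 - (g : ℤ)) + (-1) + (-1)) = ((g : ℤ) - 1) + 1 + 1 by ring, T_add, T_add, T_add, T_add,
    show (-2 : ℤ) = -1 + -1 by norm_num, T_add]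
  have h3 : (T 1 * T (-1) : k[T;T⁻¹]) = 1 := by rw [← T_add]; simp
  have h4 : (T (1 - g) * T (g - 1) : k[T;T⁻¹]) = 1 := by rw [← T_add]; simp
  push_cast
  simp only [map_sub, map_one, map_natCast]
  generalize invert (jacobianLead k g ^ m) = J' at *
  generalize jacobianLead k g ^ m = J at *
  generalize (T (1 - (g : ℤ)) : k[T;T⁻¹]) = u at *
  generalize (T ((g : ℤ) - 1) : k[T;T⁻¹]) = u' at *
  generalize (T 1 : k[T;T⁻¹]) = y at *
  generalize (T (-1) : k[T;T⁻¹]) = z at *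
  linear_combination -(toLaurent s.1.snd * u * u' * z ^ 2 * y ^ 2) * hJ -
    (toLaurent s.1.snd * z ^ 2 * y ^ 2) * h4 - (toLaurent s.1.snd * (y * z + 1)) * h3

theorem map_swap_canonicalSections (g m : ℕ) (f : Fin (g - 2) → k) :
    (canonicalSections g f m).map ((AlgHom.snd k (ChartRing k) (ChartRing k)).prod
      (AlgHom.fst k (ChartRing k) (ChartRing k))).toLinearMap =
      canonicalSections g (f ∘ Fin.rev) m := by
  ext s
  constructor
  · rintro ⟨s, hs, rfl⟩
    exact swap_mem_canonicalSections g m f hs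
  · intro hs
    refine ⟨s.swap, ?_, rfl⟩
    have := swap_mem_canonicalSections g m _ hs
    rwa [Function.comp_assoc, Fin.rev_involutive.comp_self] at this

theorem coeff_tailPoly (h : ℕ) (f : Fin (h + 3 - 2) → k) (e : ℕ) (he : e ≤ h) :
    (tailPoly (h + 3) f).coeff e = f ⟨h - e, by omega⟩ := by
  rw [← tailPoly_coeff (h + 3) f]
  congr 1
  simp only
  omega

theorem natDegree_tailPoly_le (h : ℕ) (f : Fin (h + 3 - 2) → k) :
    (tailPoly (h + 3) f).natDegree ≤ h := by
  rw [natDegree_le_iff_coeff_eq_zero]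
  intro j hj
  exact coeff_eq_zero_of_degree_lt ((tailPoly_degree _ f).trans_le (by exact_mod_cast (by omega)))

theorem tailPoly_comp_rev (h : ℕ) (f : Fin (h + 3 - 2) → k) :
    tailPoly (h + 3) (f ∘ Fin.rev) = Polynomial.reflect h (tailPoly (h + 3) f) := by
  ext e
  rw [coeff_reflect]
  rcases le_or_gt e h with he | he
  · rw [revAt_le he, coeff_tailPoly _ _ _ he, coeff_tailPoly _ _ _ (by omega)]
    simp only [Function.comp_apply]
    congr 1
    ext
    simp only [Fin.val_rev]
    omega
  · rw [revAt_eq_self_of_lt he, coeff_eq_zero_of_natDegree_lt ((natDegree_tailPoly_le _ _).trans_lt he),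
      coeff_eq_zero_of_natDegree_lt ((natDegree_tailPoly_le _ _).trans_lt he)]

/-- Any `F` of degree at most `h` is the `tailPoly` of a ribbon of genus `h + 3`. Exchanging its
charts reflects `F` and carries sections isomorphically, compatibly with products. -/
theorem isGood_of_reflect {h : ℕ} {F : k[X]} (hF : F.natDegree ≤ h)
    (hG : IsGood h (Polynomial.reflect h F)) : IsGood h F := by
  obtain ⟨f, rfl⟩ : ∃ f : Fin (h + 3 - 2) → k, tailPoly (h + 3) f = F := by
    refine ⟨fun i => F.coeff (h - i), ?_⟩
    ext e
    rcases le_or_gt e h with he | he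
    · rw [coeff_tailPoly _ _ _ he]
      simp only
      congr 1
      omega
    · rw [coeff_eq_zero_of_natDegree_lt ((natDegree_tailPoly_le _ _).trans_lt he),
        coeff_eq_zero_of_natDegree_lt (hF.trans_lt he)]
  rw [← tailPoly_comp_rev, isGood_tailPoly_iff] at hG
  rw [isGood_tailPoly_iff]
  intro m hm
  have hinj : Function.Injective ((AlgHom.snd k (ChartRing k) (ChartRing k)).prod
      (AlgHom.fst k (ChartRing k) (ChartRing k))) := fun s t hst => Prod.swap_injective hst
  rw [isDestabilized_map_iff _ m _ _ hinj.injOn hinj.injOn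
    (canonicalSections_one_pow_le _ _ f), map_swap_canonicalSections, map_swap_canonicalSections]
  exact hG m hm

end Charts

/-! ### Ribbons whose gluing function is a monomial -/

section Monomial

variable {k : Type u} [Field k]

theorem X_mul_derivative_X_pow (j : ℕ) :
    X * derivative (X ^ j : k[X]) = Polynomial.C (j : k) * X ^ j := by
  rcases j with _ | j
  · simp
  · rw [derivative_X_pow, Nat.add_sub_cancel]; ring

/-- Here `f = c y^{-l}`, so `f p' + m f' p` sends `y^a` to `c (a - m l) y^{a-l-1}`. The coefficients
of `q` from degree `m(h+2) - (h+3)` on are forced by `p`, and the lower ones are free. -/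
theorem mem_sectionsOf_monomial {h m j l : ℕ} (hm : 1 ≤ m) (hj : j + l = h + 1) (c : k)
    (s : ChartRing k) :
    s ∈ sectionsOf h m (Polynomial.C c * X ^ j) (X ^ (h + 1)) ↔ s.fst.natDegree ≤ m * (h + 2) ∧
      ∀ i : ℕ, m * (h + 2) ≤ i + (h + 3) →
        s.snd.coeff i = c * (i + l + 1 - m * l) * s.fst.coeff (i + l + 1) := by
  have hM : h + 2 ≤ m * (h + 2) := Nat.le_mul_of_pos_left _ hm
  rw [mem_sectionsOf]
  refine and_congr_right fun _ => ?_
  set W := X * derivative s.fst - Polynomial.C ((m : k) * l) * s.fst with hW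
  have hWc : ∀ i : ℕ, W.coeff i = ((i : k) - m * l) * s.fst.coeff i := by
    intro i
    rw [hW, Polynomial.coeff_sub, coeff_X_mul_derivative, coeff_C_mul]
    ring
  have hjk : (j : k) = h + 1 - l := by
    have := congrArg (Nat.cast : ℕ → k) hj
    push_cast at this
    linear_combination this
  have e : X * (s.snd * (X ^ (h + 1)) ^ 2 -
      bracket (m : k) (Polynomial.C c * X ^ j) (X ^ (h + 1)) s.fst) =
      (s.snd * X ^ (h + 2) - Polynomial.C c * (W * X ^ j)) * X ^ (h + 1) := by
    have e1 : X * derivative (Polynomial.C c * X ^ j) =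
        Polynomial.C c * (Polynomial.C ((h : k) + 1 - l) * X ^ j) := by
      rw [derivative_C_mul, mul_left_comm, X_mul_derivative_X_pow, hjk]
    have e2 := X_mul_derivative_X_pow (k := k) (h + 1)
    rw [mul_sub, X_mul_bracket, e1, e2, hW]
    push_cast
    simp only [map_sub, map_add, map_mul, map_one, map_natCast]
    ring
  have hn : (X ^ (h + 1) : k[X]).natDegree = h + 1 := natDegree_X_pow _
  rw [e, show m * (h + 2) + h = m * (h + 2) - 1 + (X ^ (h + 1) : k[X]).natDegree by omega,
    degree_mul_monic_lt_iff (monic_X_pow _), degree_lt_iff_coeff_zero]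
  simp only [Polynomial.coeff_sub, coeff_C_mul, coeff_mul_X_pow', hWc]
  constructor
  · intro H i hi
    have := H (i + (h + 2)) (by omega)
    rw [if_pos (by omega), if_pos (by omega), Nat.add_sub_cancel,
      show i + (h + 2) - j = i + l + 1 by omega, sub_eq_zero] at this
    rw [this]
    push_cast
    ring
  · intro H i hi
    rcases Nat.lt_or_ge i (h + 2) with h1 | h1
    · obtain rfl : i = h + 1 := by omega
      have hm1 : m = 1 := by
        by_contra hne
        have : 2 * (h + 2) ≤ m * (h + 2) := Nat.mul_le_mul_right _ (by omega)
        omega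
      rw [if_neg (by omega), if_pos (by omega), show h + 1 - j = l by omega, hm1]
      push_cast
      ring
    · obtain ⟨i, rfl⟩ := Nat.exists_eq_add_of_le' h1
      rw [if_pos (by omega), if_pos (by omega), Nat.add_sub_cancel,
        show i + (h + 2) - j = i + l + 1 by omega, H i (by omega)]
      push_cast
      ring

/-- The section of the canonical bundle which restricts to `y ^ a` on the reduced curve. -/
def monomialSection (c : k) (l a : ℕ) : ChartRing k :=
  TrivSqZeroExt.inl (X ^ a) +
    -- The truncated subtraction is intended: for `a ≤ l` the term `c (a - l) y^{a-l-1} η` is zero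
    -- or has a pole at `y = 0`, and it is left out.
    TrivSqZeroExt.inr (Polynomial.C (c * ((a - l : ℕ) : k)) * X ^ (a - l - 1))

@[simp] theorem fst_monomialSection (c : k) (l a : ℕ) : (monomialSection c l a).fst = X ^ a := by
  simp [monomialSection]

@[simp] theorem snd_monomialSection (c : k) (l a : ℕ) : (monomialSection c l a).snd =
    Polynomial.C (c * ((a - l : ℕ) : k)) * X ^ (a - l - 1) := by
  simp [monomialSection]

theorem monomialSection_mem {h j l : ℕ} (hj : j + l = h + 1) (c : k) {a : ℕ} (ha : a ≤ h + 2) :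
    monomialSection c l a ∈ sectionsOf h 1 (Polynomial.C c * X ^ j) (X ^ (h + 1)) := by
  rw [mem_sectionsOf_monomial le_rfl hj, fst_monomialSection, snd_monomialSection]
  refine ⟨by rw [natDegree_X_pow, one_mul]; exact ha, fun i _ => ?_⟩
  rw [coeff_C_mul_X_pow, coeff_X_pow]
  rcases Nat.lt_or_ge l a with h1 | h1
  · obtain ⟨b, rfl⟩ := Nat.exists_eq_add_of_lt h1
    rw [show l + b + 1 - l = b + 1 by omega, Nat.add_sub_cancel]
    rcases eq_or_ne i b with rfl | h2
    · rw [if_pos rfl, if_pos (by omega)]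
      push_cast
      ring
    · rw [if_neg h2, if_neg (by omega), mul_zero]
  · rw [Nat.sub_eq_zero_of_le h1, if_neg (by omega : ¬ i + l + 1 = a)]
    simp

/-- The element `y ^ i η`. -/
def nilpotentSection (k : Type u) [Field k] (i : ℕ) : ChartRing k := TrivSqZeroExt.inr (X ^ i)

theorem nilpotentSection_mul (i a : ℕ) (c : k) (l : ℕ) :
    nilpotentSection k i * monomialSection c l a = nilpotentSection k (i + a) := by
  ext : 1
  · simp [nilpotentSection]
  · simp [nilpotentSection, pow_add, mul_comm]

/-- Both products lift `y^{i+l+d+1}`. As `i + 1 ≤ l`, only the second factors have an `η`-part, with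
coefficients `c (d + 1)` and `c d`, so the difference is `c y^{i+d} η`. -/
theorem monomialSection_mul_sub {c : k} {l i d : ℕ} (hi : i + 1 ≤ l) :
    monomialSection c l i * monomialSection c l (l + d + 1) -
      monomialSection c l (i + 1) * monomialSection c l (l + d) = c • nilpotentSection k (i + d) := by
  have h1 : i - l = 0 := by omega
  have h2 : i + 1 - l = 0 := by omega
  ext : 1
  · simp only [TrivSqZeroExt.fst_sub, TrivSqZeroExt.fst_mul, fst_monomialSection,
      nilpotentSection, TrivSqZeroExt.fst_smul, TrivSqZeroExt.fst_inr, smul_zero]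
    ring
  · simp only [TrivSqZeroExt.snd_sub, DualNumber.snd_mul, fst_monomialSection,
      snd_monomialSection, nilpotentSection, TrivSqZeroExt.snd_smul, TrivSqZeroExt.snd_inr, h1, h2]
    rw [show l + d + 1 - l = d + 1 by omega, show l + d - l = d by omega,
      Polynomial.smul_eq_C_mul]
    rcases d with _ | d
    · simp
    · simp
      ring

/-- For two factors, any `i ≤ h` splits as `a + d` with `a ≤ l - 1` and `d ≤ h + 1 - l`, and
`monomialSection_mul_sub` applies. Further factors multiply `y^i η` by powers of `y`. -/
theorem nilpotentSection_mem {h j l : ℕ} (hl : 1 ≤ l) (hj : j + l = h + 1) {c : k} (hc : c ≠ 0)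
    (m : ℕ) : ∀ i, i + (h + 3) < (m + 2) * (h + 2) → nilpotentSection k i ∈
      sectionsOf h 1 (Polynomial.C c * X ^ j) (X ^ (h + 1)) ^ (m + 2) := by
  induction m with
  | zero =>
    intro i hi
    obtain ⟨a, d, ha, hd, rfl⟩ : ∃ a d, a + 1 ≤ l ∧ l + d + 1 ≤ h + 2 ∧ i = a + d := by
      rcases Nat.lt_or_ge i l with h1 | h1
      · exact ⟨i, 0, by omega, by omega, by omega⟩
      · exact ⟨l - 1, i - (l - 1), by omega, by omega, by omega⟩
    have h1 := monomialSection_mul_sub (c := c) (d := d) ha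
    have h2 : nilpotentSection k (a + d) = c⁻¹ • (c • nilpotentSection k (a + d)) := by
      rw [smul_smul, inv_mul_cancel₀ hc, one_smul]
    rw [h2, ← h1, zero_add, show 2 = 1 + 1 from rfl, Submodule.pow_succ, Submodule.pow_one]
    refine Submodule.smul_mem _ _ (Submodule.sub_mem _ ?_ ?_) <;>
    exact Submodule.mul_mem_mul (monomialSection_mem hj c (by omega))
      (monomialSection_mem hj c (by omega))
  | succ m ih =>
    intro i hi
    obtain ⟨a, b, ha, hb, rfl⟩ : ∃ a b, a + (h + 3) < (m + 2) * (h + 2) ∧ b ≤ h + 2 ∧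
        i = a + b := by
      have h1 : (m + 1 + 2) * (h + 2) = (m + 2) * (h + 2) + (h + 2) := by ring
      have h2 : 2 * (h + 2) ≤ (m + 2) * (h + 2) := Nat.mul_le_mul_right _ (by omega)
      rcases Nat.lt_or_ge i (h + 2) with h3 | h3
      · exact ⟨0, i, by omega, by omega, by omega⟩
      · exact ⟨i - (h + 2), h + 2, by omega, by omega, by omega⟩
    rw [show m + 1 + 2 = (m + 2) + 1 by ring, Submodule.pow_succ, ← nilpotentSection_mul a b c l]
    exact Submodule.mul_mem_mul (ih a ha) (monomialSection_mem hj c hb)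

theorem exists_mem_pow_fst_eq_X_pow {h j l : ℕ} (hj : j + l = h + 1) (c : k) (m : ℕ) :
    ∀ a, a ≤ m * (h + 2) → ∃ w ∈ sectionsOf h 1 (Polynomial.C c * X ^ j) (X ^ (h + 1)) ^ m,
      w.fst = X ^ a := by
  induction m with
  | zero =>
    intro a ha
    obtain rfl : a = 0 := by omega
    exact ⟨1, by rw [Submodule.pow_zero]; exact Submodule.one_le.mp le_rfl, by simp⟩
  | succ m ih =>
    intro a ha₀
    obtain ⟨a, b, ha, hb, rfl⟩ : ∃ a' b, a' ≤ m * (h + 2) ∧ b ≤ h + 2 ∧ a = a' + b := by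
      have h1 : (m + 1) * (h + 2) = m * (h + 2) + (h + 2) := by ring
      rcases Nat.lt_or_ge a (h + 2) with h3 | h3
      · exact ⟨0, a, by omega, by omega, by omega⟩
      · exact ⟨a - (h + 2), h + 2, by omega, by omega, by omega⟩
    obtain ⟨w, hw, hwa⟩ := ih a ha
    refine ⟨w * monomialSection c l b, ?_, ?_⟩
    · rw [Submodule.pow_succ]
      exact Submodule.mul_mem_mul hw (monomialSection_mem hj c hb)
    · rw [TrivSqZeroExt.fst_mul, hwa, fst_monomialSection, pow_add]

/-- This is the surjectivity that makes the Hilbert point defined. Products of the lifts of `y^a`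
reach every section modulo `η`. The difference is a combination of the free `y^i η`, which are
reached because `c ≠ 0` and `l ≥ 1`. -/
theorem sectionsOf_monomial_pow {h j l m : ℕ} (hm : 2 ≤ m) (hl : 1 ≤ l) (hj : j + l = h + 1)
    {c : k} (hc : c ≠ 0) : sectionsOf h 1 (Polynomial.C c * X ^ j) (X ^ (h + 1)) ^ m =
      sectionsOf h m (Polynomial.C c * X ^ j) (X ^ (h + 1)) := by
  refine le_antisymm (sectionsOf_one_pow_le _ _ _ _) fun s hs => ?_
  obtain ⟨w, hw, hws⟩ : ∃ w ∈ sectionsOf h 1 (Polynomial.C c * X ^ j) (X ^ (h + 1)) ^ m,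
      w.fst = s.fst := by
    choose! w hw hwa using exists_mem_pow_fst_eq_X_pow hj c m
    refine ⟨∑ a ∈ Finset.range (m * (h + 2) + 1), s.fst.coeff a • w a,
      Submodule.sum_mem _ fun a ha => Submodule.smul_mem _ _ (hw a ?_), ?_⟩
    · rw [Finset.mem_range] at ha; omega
    · rw [TrivSqZeroExt.fst_sum, s.fst.as_sum_range' (m * (h + 2) + 1)
        (Nat.lt_succ_of_le ((mem_sectionsOf.mp hs).1))]
      refine Finset.sum_congr rfl fun a ha => ?_
      rw [Finset.mem_range] at ha
      rw [← s.fst.as_sum_range' (m * (h + 2) + 1)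
        (Nat.lt_succ_of_le ((mem_sectionsOf.mp hs).1)), TrivSqZeroExt.fst_smul, hwa a (by omega),
        Polynomial.smul_eq_C_mul, C_mul_X_pow_eq_monomial]
  have hd : s - w ∈ sectionsOf h m (Polynomial.C c * X ^ j) (X ^ (h + 1)) :=
    Submodule.sub_mem _ hs (sectionsOf_one_pow_le _ _ _ _ hw)
  rw [mem_sectionsOf_monomial (by omega) hj, TrivSqZeroExt.fst_sub, hws, sub_self] at hd
  have hM : 2 * (h + 2) ≤ m * (h + 2) := Nat.mul_le_mul_right _ hm
  have e : s - w = ∑ i ∈ Finset.range (m * (h + 2) - (h + 3)),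
      (s - w).snd.coeff i • nilpotentSection k i := by
    ext : 1
    · rw [TrivSqZeroExt.fst_sub, hws, sub_self, TrivSqZeroExt.fst_sum]
      simp [nilpotentSection]
    · rw [TrivSqZeroExt.snd_sum]
      simp only [nilpotentSection, TrivSqZeroExt.snd_smul, TrivSqZeroExt.snd_inr]
      ext i
      rw [finsetSum_coeff]
      simp only [Polynomial.coeff_smul, coeff_X_pow, smul_eq_mul, mul_ite, mul_one, mul_zero,
        Finset.sum_ite_eq, Finset.mem_range]
      split_ifs with hi
      · rfl
      · rw [hd.2 i (by omega)]; simp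
  have hsw : s - w ∈ sectionsOf h 1 (Polynomial.C c * X ^ j) (X ^ (h + 1)) ^ m := by
    rw [e]
    refine Submodule.sum_mem _ fun i hi => Submodule.smul_mem _ _ ?_
    rw [Finset.mem_range] at hi
    obtain ⟨m, rfl⟩ := Nat.exists_eq_add_of_le' hm
    exact nilpotentSection_mem hl hj hc m i (by omega)
  rw [← sub_add_cancel s w]
  exact Submodule.add_mem _ hsw hw

end Monomial

/-! ### The torus acting on a monomial ribbon and its determinants -/

section Torus

variable {k : Type u} [Field k]

theorem exists_polynomial_coeff_eq (v : ℕ → k) (N : ℕ) :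
    ∃ p : k[X], ∀ i, p.coeff i = if i < N then v i else 0 := by
  refine ⟨∑ i ∈ Finset.range N, Polynomial.C (v i) * X ^ i, fun i => ?_⟩
  simp only [finsetSum_coeff, coeff_C_mul_X_pow, Finset.sum_ite_eq, Finset.mem_range]

/-- Coordinates on the space of sections of the `m`-th power of the canonical bundle of a ribbon
whose gluing function is a monomial: the coefficients of `y ^ a` and the first coefficients of
`y ^ i η`. -/
theorem exists_equiv_sectionsOf_monomial {h m j l : ℕ} (hm : 1 ≤ m) (hj : j + l = h + 1) (c : k) :
    ∃ E : sectionsOf h m (Polynomial.C c * X ^ j) (X ^ (h + 1)) ≃ₗ[k]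
      (Fin (m * (h + 2) + 1) ⊕ Fin (m * (h + 2) - (h + 3)) → k), ∀ s,
      (∀ a, E s (Sum.inl a) = (s : ChartRing k).fst.coeff a) ∧
      (∀ i, E s (Sum.inr i) = (s : ChartRing k).snd.coeff i) := by
  let E : sectionsOf h m (Polynomial.C c * X ^ j) (X ^ (h + 1)) →ₗ[k]
      (Fin (m * (h + 2) + 1) ⊕ Fin (m * (h + 2) - (h + 3)) → k) :=
    { toFun := fun s => Sum.elim (fun a => (s : ChartRing k).fst.coeff a)
        (fun i => (s : ChartRing k).snd.coeff i)
      map_add' := fun s t => by ext (a | i) <;> simp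
      map_smul' := fun r s => by ext (a | i) <;> simp }
  refine ⟨LinearEquiv.ofBijective E ⟨?_, ?_⟩, fun s => ⟨fun a => rfl, fun i => rfl⟩⟩
  · rw [← LinearMap.ker_eq_bot, LinearMap.ker_eq_bot']
    rintro ⟨s, hs⟩ h0
    rw [mem_sectionsOf_monomial hm hj] at hs
    have hfst : s.fst = 0 := by
      ext a
      rcases Nat.lt_or_ge a (m * (h + 2) + 1) with ha | ha
      · exact congrFun h0 (Sum.inl ⟨a, ha⟩)
      · rw [coeff_eq_zero_of_natDegree_lt (by omega), Polynomial.coeff_zero]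
    refine Subtype.ext (TrivSqZeroExt.ext hfst ?_)
    ext i
    rcases Nat.lt_or_ge i (m * (h + 2) - (h + 3)) with hi | hi
    · exact congrFun h0 (Sum.inr ⟨i, hi⟩)
    · rw [hs.2 i (by omega), hfst]
      simp
  · intro x
    obtain ⟨p, hp⟩ := exists_polynomial_coeff_eq
      (fun a => if ha : a < m * (h + 2) + 1 then x (Sum.inl ⟨a, ha⟩) else 0) (m * (h + 2) + 1)
    obtain ⟨q, hq⟩ := exists_polynomial_coeff_eq
      (fun i => if hi : i < m * (h + 2) - (h + 3) then x (Sum.inr ⟨i, hi⟩) else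
        -- Beyond the free range the coefficients of `q` must take the values forced by `p`.
        c * (i + l + 1 - m * l) * p.coeff (i + l + 1)) (m * (h + 2) + 1)
    refine ⟨⟨TrivSqZeroExt.inl p + TrivSqZeroExt.inr q, ?_⟩, ?_⟩
    · rw [mem_sectionsOf_monomial hm hj]
      simp only [TrivSqZeroExt.fst_add, TrivSqZeroExt.fst_inl, TrivSqZeroExt.fst_inr, add_zero,
        TrivSqZeroExt.snd_add, TrivSqZeroExt.snd_inl, TrivSqZeroExt.snd_inr, zero_add]
      constructor
      · rw [natDegree_le_iff_coeff_eq_zero]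
        intro a ha
        rw [hp, if_neg (by omega)]
      · intro i hi
        have hM : h + 2 ≤ m * (h + 2) := Nat.le_mul_of_pos_left _ hm
        rw [hq]
        split_ifs with h1 h2
        · omega
        · rfl
        · rw [hp, if_neg (by omega), mul_zero]
    · ext (a | i)
      · change (TrivSqZeroExt.fst (TrivSqZeroExt.inl p + TrivSqZeroExt.inr q)).coeff a = _
        have := a.2
        rw [TrivSqZeroExt.fst_add, TrivSqZeroExt.fst_inl, TrivSqZeroExt.fst_inr, add_zero, hp,
          if_pos this, dif_pos this]
      · change (TrivSqZeroExt.snd (TrivSqZeroExt.inl p + TrivSqZeroExt.inr q)).coeff i = _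
        have := i.2
        rw [TrivSqZeroExt.snd_add, TrivSqZeroExt.snd_inl, TrivSqZeroExt.snd_inr, zero_add, hq,
          if_pos (by omega), dif_pos this]

theorem det_eq_prod_of_equiv {V ι : Type*} [AddCommGroup V] [Module k V] [Fintype ι]
    [DecidableEq ι] (E : V ≃ₗ[k] (ι → k)) (Θ : V →ₗ[k] V) (w : ι → k)
    (hΘ : ∀ v x, E (Θ v) x = w x * E v x) : LinearMap.det Θ = ∏ x, w x := by
  have : Θ = (E.symm : (ι → k) →ₗ[k] V) ∘ₗ (Matrix.toLin' (Matrix.diagonal w)) ∘ₗ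
      (E.symm.symm : V →ₗ[k] (ι → k)) := by
    ext v
    apply E.injective
    ext x
    simp [hΘ, Matrix.toLin'_apply, Matrix.mulVec_diagonal]
  rw [this, LinearMap.det_conj, LinearMap.det_toLin', Matrix.det_diagonal]

theorem prod_zpow_range {t : k} (ht : t ≠ 0) (b : ℤ) (K : ℕ) :
    ∏ a ∈ Finset.range K, t ^ (2 * (a : ℤ) + b) = t ^ ((K : ℤ) * (K - 1 + b)) := by
  induction K with
  | zero => simp
  | succ K ih =>
    rw [Finset.prod_range_succ, ih, ← zpow_add₀ ht]
    congr 1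
    push_cast
    ring

/-- The automorphism `y ↦ t² y`, `η ↦ t ^ (2 l + 2) η`. -/
def torusMap (l : ℕ) (t : k) : ChartRing k →ₐ[k] ChartRing k :=
  dualAlgHom (Polynomial.aeval (Polynomial.C (t ^ 2) * X)) (Polynomial.C (t ^ (2 * l + 2)))

theorem coeff_fst_torusMap (l : ℕ) (t : k) (s : ChartRing k) (a : ℕ) :
    (torusMap l t s).fst.coeff a = t ^ (2 * a) * s.fst.coeff a := by
  rw [torusMap, fst_dualAlgHom, ← Polynomial.comp_eq_aeval, comp_C_mul_X_coeff, ← pow_mul,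
    mul_comm]

theorem coeff_snd_torusMap (l : ℕ) (t : k) (s : ChartRing k) (i : ℕ) :
    (torusMap l t s).snd.coeff i = t ^ (2 * (i + l + 1)) * s.snd.coeff i := by
  rw [torusMap, snd_dualAlgHom, ← Polynomial.comp_eq_aeval, coeff_mul_C, comp_C_mul_X_coeff,
    ← pow_mul]
  ring

/-- The weight `2l + 2` of `η` gives `y^{a-l-1} η` the same weight `2a` as `y^a`, so the relation
between forced coefficients is homogeneous. -/
theorem torusMap_mem {h m j l : ℕ} (hm : 1 ≤ m) (hj : j + l = h + 1) (c t : k) {s : ChartRing k}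
    (hs : s ∈ sectionsOf h m (Polynomial.C c * X ^ j) (X ^ (h + 1))) :
    torusMap l t s ∈ sectionsOf h m (Polynomial.C c * X ^ j) (X ^ (h + 1)) := by
  rw [mem_sectionsOf_monomial hm hj] at hs ⊢
  rw [natDegree_le_iff_coeff_eq_zero] at hs ⊢
  refine ⟨fun a ha => ?_, fun i hi => ?_⟩
  · rw [coeff_fst_torusMap, hs.1 a ha, mul_zero]
  · rw [coeff_fst_torusMap, coeff_snd_torusMap, hs.2 i hi]
    ring

theorem two_zpow_ne_one [CharZero k] {z : ℤ} (hz : z ≠ 0) : (2 : k) ^ z ≠ 1 := by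
  intro h1
  have h2 : ((2 ^ z : ℚ) : k) = ((1 : ℚ) : k) := by push_cast; exact h1
  rw [Rat.cast_inj] at h2
  rcases lt_or_gt_of_ne hz with h3 | h3
  · exact (zpow_lt_one_of_neg₀ (by norm_num) h3).ne h2
  · exact (one_lt_zpow₀ (by norm_num) h3).ne' h2

/-- With `K = m(h+2) - (h+3)`, the normalized torus element has determinant `2 ^ (K (2l - 2 - h))`
on sections of the `m`-th power. For `m = 1` no `y^i η` occurs and the determinant is `1`; for `m ≥
2`, `K > 0`, and the other factor is odd. -/
theorem isGood_monomial [CharZero k] {h : ℕ} (hh : Odd h) (c : k) (j : ℕ) (hc : c ≠ 0)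
    (hjh : j ≤ h) : IsGood h (Polynomial.C c * X ^ j) := by
  obtain ⟨l, hj⟩ : ∃ l, j + l = h + 1 := ⟨h + 1 - j, by omega⟩
  have hl : 1 ≤ l := by omega
  intro m hm
  have ht : (2 : k) ≠ 0 := two_ne_zero
  -- The twist by `2^{-(h+2)}` per factor centres the weights `2a`, `0 ≤ a ≤ m(h+2)`, at zero. Using
  -- `y ↦ t² y` rather than `y ↦ t y` keeps this exponent an integer.
  have key : ∀ m, 1 ≤ m → ∃ Θ : sectionsOf h m (Polynomial.C c * X ^ j) (X ^ (h + 1)) →ₗ[k]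
      sectionsOf h m (Polynomial.C c * X ^ j) (X ^ (h + 1)),
      (∀ s, (Θ s : ChartRing k) = ((2 : k) ^ (-((h : ℤ) + 2))) ^ m • torusMap l 2 s) ∧
      LinearMap.det Θ = 2 ^ (((m * (h + 2) - (h + 3) : ℕ) : ℤ) *
        ((m * (h + 2) - (h + 3) : ℕ) - 1 + (2 * l + 2 - m * (h + 2)))) := by
    intro m hm
    obtain ⟨E, hE⟩ := exists_equiv_sectionsOf_monomial (m := m) hm hj c
    let Θ : sectionsOf h m (Polynomial.C c * X ^ j) (X ^ (h + 1)) →ₗ[k]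
        sectionsOf h m (Polynomial.C c * X ^ j) (X ^ (h + 1)) :=
      ((2 : k) ^ (-((h : ℤ) + 2))) ^ m • (torusMap l (2 : k)).toLinearMap.restrict
        fun s hs => torusMap_mem hm hj c 2 hs
    refine ⟨Θ, fun s => rfl, ?_⟩
    have e1 : ((2 : k) ^ (-((h : ℤ) + 2))) ^ m = 2 ^ (-(m * (h + 2)) : ℤ) := by
      rw [← zpow_natCast, ← zpow_mul]
      congr 1
      ring
    rw [det_eq_prod_of_equiv E Θ (Sum.elim (fun a => 2 ^ (2 * ((a : ℕ) : ℤ) + -(m * (h + 2))))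
      (fun i => 2 ^ (2 * ((i : ℕ) : ℤ) + (2 * l + 2 - m * (h + 2)))))]
    · rw [Fintype.prod_sum_type]
      simp only [Sum.elim_inl, Sum.elim_inr]
      rw [Fin.prod_univ_eq_prod_range (fun a : ℕ => (2 : k) ^ (2 * (a : ℤ) + -(m * (h + 2)))),
        Fin.prod_univ_eq_prod_range
          (fun i : ℕ => (2 : k) ^ (2 * (i : ℤ) + (2 * l + 2 - m * (h + 2)))),
        prod_zpow_range ht, prod_zpow_range ht]
      push_cast
      rw [add_sub_cancel_right, add_neg_cancel, mul_zero, zpow_zero, one_mul]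
    · rintro s (a | i)
      · rw [(hE _).1, (hE _).1]
        change (((2 : k) ^ (-((h : ℤ) + 2))) ^ m • torusMap l 2 (s : ChartRing k)).fst.coeff a = _
        rw [TrivSqZeroExt.fst_smul, Polynomial.coeff_smul, coeff_fst_torusMap, smul_eq_mul, e1,
          ← mul_assoc, ← zpow_natCast, ← zpow_add₀ ht, Sum.elim_inl]
        congr 2
        push_cast
        ring
      · rw [(hE _).2, (hE _).2]
        change (((2 : k) ^ (-((h : ℤ) + 2))) ^ m • torusMap l 2 (s : ChartRing k)).snd.coeff i = _
        rw [TrivSqZeroExt.snd_smul, Polynomial.coeff_smul, coeff_snd_torusMap, smul_eq_mul, e1,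
          ← mul_assoc, ← zpow_natCast, ← zpow_add₀ ht, Sum.elim_inr]
        congr 2
        push_cast
        ring
  obtain ⟨Θ₁, h₁, hd₁⟩ := key 1 le_rfl
  obtain ⟨Θₘ, hₘ, hdₘ⟩ := key m (by omega)
  obtain ⟨E, -⟩ := exists_equiv_sectionsOf_monomial (m := m) (by omega) hj c
  refine ⟨Module.Finite.equiv E.symm, sectionsOf_monomial_pow hm hl hj hc, Θ₁, Θₘ, ?_, ?_, ?_⟩
  · rw [hd₁, show 1 * (h + 2) - (h + 3) = 0 by omega]
    simp
  · intro d hd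
    have hM : 2 * (h + 2) ≤ m * (h + 2) := Nat.mul_le_mul_right _ hm
    rw [hdₘ, ← zpow_natCast, ← zpow_mul]
    refine two_zpow_ne_one ?_
    obtain ⟨r, hr⟩ := hh
    refine mul_ne_zero (mul_ne_zero (by omega) ?_) (by omega)
    have e2 : ((m * (h + 2) - (h + 3) : ℕ) : ℤ) = m * (h + 2) - (h + 3) := by
      rw [Nat.cast_sub (by omega)]
      push_cast
      ring
    rw [e2]
    intro h0
    -- Only here does parity enter: for odd `h` this equation has no integer solution.
    have h3 : (2 * (l : ℤ) - 2 - h) = 0 := by linarith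
    omega
  · intro v s hs
    rw [hₘ, hs, map_prod]
    simp only [h₁, pow_one]
    rw [Finset.prod_smul, Finset.prod_const, Finset.card_univ, Fintype.card_fin]

end Torus

/-! ### Split ribbons are not canonically embedded -/

section Embedded

variable {k : Type u} [Field k]

/-- When `f = 0`, the `η`-part in the second chart is a polynomial of order at most `(g - 1) - (g +
1) = -2` at infinity, hence zero, and with it the `ε`-part in the first chart. -/
theorem snd_fst_eq_zero_of_mem {g : ℕ} {v : ChartRing k × ChartRing k}
    (hv : v ∈ canonicalSections g (0 : Fin (g - 2) → k) 1) : v.1.snd = 0 := by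
  rw [mem_canonicalSections_iff] at hv
  have ht : tail g (0 : Fin (g - 2) → k) = 0 := by simp [tail]
  have h2 := hv.2
  rw [ht, map_zero, zero_mul, mul_zero, zero_mul, add_zero, add_zero] at h2
  have h3 := (exists_eq_jacobianLead_mul_iff g 1 (-(g : ℤ) - 1) (toLaurent v.2.snd)).mp ⟨_, h2⟩
  have h4 : v.2.snd = 0 := by
    ext i
    rw [← coeff_toLaurent_nat, h3 _ (by push_cast; linarith), Polynomial.coeff_zero]
  rw [h4, map_zero, eq_comm,
    ((isUnit_jacobianLead_pow g 1).mul (isUnit_T _)).mul_right_eq_zero] at h2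
  exact toLaurent_eq_zero.mp (invert.injective (h2.trans (map_zero _).symm))

/-- A split ribbon is not canonically embedded. -/
theorem IsCanonicallyEmbedded.ne_zero {g : ℕ} {f : Fin (g - 2) → k}
    (hf : IsCanonicallyEmbedded g f) : f ≠ 0 := by
  rintro rfl
  obtain ⟨⟨s, hs, hu, -, htop⟩, -⟩ := hf
  -- All quotients of sections lie in the subring `k[x]`, so they cannot generate `ε`.
  have hle : Algebra.adjoin k {a : ChartRing k | ∃ v ∈ canonicalSections g (0 : Fin (g - 2) → k) 1,
      a * s.1 = v.1} ≤ (TrivSqZeroExt.inlAlgHom k k[X] k[X]).range := by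
    refine Algebra.adjoin_le ?_
    rintro a ⟨v, hv, hav⟩
    have h1 := snd_fst_eq_zero_of_mem hv
    rw [← hav, DualNumber.snd_mul, snd_fst_eq_zero_of_mem hs, mul_zero, zero_add, mul_eq_zero,
      or_iff_left (TrivSqZeroExt.isUnit_iff_isUnit_fst.mp hu).ne_zero] at h1
    exact ⟨a.fst, TrivSqZeroExt.ext rfl h1.symm⟩
  rw [htop] at hle
  obtain ⟨q, hq⟩ := hle (Algebra.mem_top (x := (TrivSqZeroExt.inr 1 : ChartRing k)))
  have := congrArg TrivSqZeroExt.snd hq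
  rw [TrivSqZeroExt.snd_inr] at this
  exact zero_ne_one this

end Embedded
end
end Ribbon
-- The corollary
theorem mainTheorem9 {k : Type u} [Field k] [IsAlgClosed k] [CharZero k] (g : ℕ) (hg : Even g)
    {C : Scheme.{u}} (p : C ⟶ Spec (CommRingCat.of k)) (R : Ribbon.Presentation g p)
    (hR : Ribbon.IsCanonicallyEmbedded g R.f)
    (α : Ribbon.GmAction p) (hα : α.IsNontrivial)
    (b : Module.Basis (Fin g) k (Ribbon.canonicalSections g R.f 1)) :
    Ribbon.IsHilbertUnstable g R.f b := by
  have hf := hR.ne_zero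
  obtain ⟨D₁, D₂, D, h1, h2, h0⟩ := Ribbon.exists_vectorField R α hα
  obtain ⟨v, γ, hv0, hv, hI⟩ := Ribbon.exists_isInvariant g R.f hf D₁ D₂ D h1 h2 h0
  revert b
  generalize R.f = f at *
  clear R
  -- A nonzero `f` needs at least one coefficient, so `g - 2 ≥ 1`. Writing `g = h + 3`, even `g`
  -- means odd `h`.
  have hg3 : 3 ≤ g := by
    by_contra hlt
    apply hf
    ext i
    have := i.2
    omega
  obtain ⟨h, rfl⟩ := Nat.exists_eq_add_of_le' hg3
  have hodd : Odd h := by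
    rw [Nat.even_add] at hg
    rw [← Nat.not_even_iff_odd, hg]
    decide
  intro b m hm
  refine Ribbon.IsDestabilized.isHilbertUnstableAt ?_ b
  refine (Ribbon.isGood_tailPoly_iff h f).mp ?_ m hm
  have hquad : v = Ribbon.quadratic (v.coeff 0) (v.coeff 1) (v.coeff 2) := by
    rw [eq_quadratic_of_degree_le_two (natDegree_le_iff_degree_le.mp hv)]
    simp [Ribbon.quadratic]
    ring
  refine Ribbon.isGood_of_isInvariant (Ribbon.isGood_monomial hodd)
    (fun F => Ribbon.isGood_of_reflect) (Ribbon.natDegree_tailPoly_le h f)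
    ((Ribbon.tailPoly_eq_zero_iff _ f).not.mpr hf) (a := v.coeff 0) (b := v.coeff 1)
    (c := v.coeff 2) (γ := γ) ?_ ?_
  · rintro ⟨e0, e1, e2⟩
    apply hv0
    rw [hquad, e0, e1, e2]
    simp [Ribbon.quadratic]
  · rw [← hquad]
    exact hI
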